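/- Let $d\ge 2$ and $\kappa\in\{2,\dots,2d\}$ be integers and let $\mathcal E$ be the set of nearest-neighbour (non-oriented) edges of $\mathbb Z^d$. Let $U=(U_e)_{e\in\mathcal E}$ be independent uniform random variables on $[0,1]$, with law $\mathbb P$. Almost surely, the values $U_e$ are distinct and there is no infinite walk along whose successive edges $U$ is strictly monotone; we restrict to such $U$. In constrained-degree percolation each edge $e=xy$ attempts to open at time $U_e$; the attempt succeeds, and $e$ then remains open forever, if and only if just before time $U_e$ both $x$ and $y$ are incident to fewer than $\kappa$ open edges; otherwise $e$ stays closed forever. For $p\in[0,1]$, an edge is $p$-open if it has opened by time $p$ (that is, $U_e\le p$ and its attempt succeeded); a path is $p$-open if all its edges are. Write $x\xleftrightarrow{p}y$ if $x$ and $y$ are joined by a $p$-open path, and $x\xleftrightarrow{p}\infty$ if there is an infinite $p$-open path of distinct vertices starting at $x$. Set \[\theta_n(p)=\mathbb P\big(\exists x\in\mathbb Z^d:\ \|x\|_1=n,\ 0\xleftrightarrow{p}x\big),\qquad \theta(p)=\mathbb P\big(0\xleftrightarrow{p}\infty\big),\] \[p_c=\sup\{p\in[0,1]:\theta(p)=0\},\qquad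 \widehat{p_c}=\sup\Big\{p\in[0,1]:\sum_{x\in\mathbb Z^d}\mathbb P\big(0\xleftrightarrow{p}x\big)<\infty\Big\}.\] Then for every $p\in[0,1]$ with $p<p_c$ there exists $\alpha_p>0$ such that $\theta_n(p)\le e^{-\alpha_p n}$ for all $n\ge 1$. Moreover, $p_c=\widehat{p_c}$. -/

import Mathlib

open MeasureTheory

noncomputable section

namespace CDP

/-- The `ℓ¹` norm on `ℤ^d`. -/
def norm1 {d : ℕ} (x : Fin d → ℤ) : ℤ := ∑ i, |x i|

/-- The nearest neighbour graph structure on `ℤ^d`. -/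
def lattice (d : ℕ) : SimpleGraph (Fin d → ℤ) where
  Adj x y := norm1 (x - y) = 1
  symm := ⟨fun x y h => by
    simp only [norm1, Pi.sub_apply] at h ⊢
    simpa only [abs_sub_comm] using h⟩
  loopless := ⟨fun x h => by simp [norm1] at h⟩

/-- Non-oriented nearest neighbour edges of `ℤ^d`. -/
abbrev Edge (d : ℕ) : Type := (lattice d).edgeSet

/-- The edge `xy`. -/
abbrev edge {d : ℕ} {x y : Fin d → ℤ} (h : (lattice d).Adj x y) : Edge d :=
  ⟨s(x, y), h⟩

/-- Assignments `U = (U_e)` of a number in `[0,1]` to each edge. -/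
abbrev Labels (d : ℕ) : Type := Edge d → unitInterval

/-- The law of independent uniform random variables on `[0,1]`, one for each edge. -/
def P (d : ℕ) : Measure (Labels d) :=
  Measure.infinitePi (fun _ : Edge d => (volume : Measure unitInterval))

/-- Label assignments with distinct coordinates and without infinite walk along which the labels
are strictly monotone (increasing or decreasing). -/
def Omega (d : ℕ) : Set (Labels d) :=
  {U | Function.Injective U ∧
    ¬ ∃ (x : ℕ → Fin d → ℤ) (h : ∀ i, (lattice d).Adj (x i) (x (i + 1))),
      StrictMono (fun i => U (edge (h i))) ∨ StrictAnti (fun i => U (edge (h i)))}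

/-- `f` precedes `e`: the edges share a vertex and `f` attempts to open strictly before `e`. -/
def Precedes {d : ℕ} (U : Labels d) (f e : Edge d) : Prop :=
  U f < U e ∧ ∃ x, x ∈ e.1 ∧ x ∈ f.1

theorem finite_neighbors {d : ℕ} (x : Fin d → ℤ) : {z | (lattice d).Adj x z}.Finite := by
  refine (Set.Finite.pi (t := fun i => Set.Icc (x i - 1) (x i + 1))
    (fun i => Set.finite_Icc _ _)).subset ?_
  intro z hz i _
  have h1 : |x i - z i| ≤ 1 := by
    have h : norm1 (x - z) = 1 := hz
    rw [← h]
    exact Finset.single_le_sum (f := fun j => |(x - z) j|) (fun j _ => abs_nonneg _)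
      (Finset.mem_univ i)
  rw [abs_le] at h1
  constructor <;> linarith [h1.1, h1.2]

theorem exists_edge_eq {d : ℕ} {x : Fin d → ℤ} {e : Edge d} (hx : x ∈ e.1) :
    ∃ (z : Fin d → ℤ) (h : (lattice d).Adj x z), e = edge h := by
  obtain ⟨e, he⟩ := e
  obtain ⟨z, rfl⟩ := Sym2.mem_iff_exists.1 hx
  exact ⟨z, he, rfl⟩

theorem finite_edges_at {d : ℕ} (x : Fin d → ℤ) : {e : Edge d | x ∈ e.1}.Finite := by
  refine Set.Finite.of_finite_image (f := Subtype.val) ?_ Subtype.val_injective.injOn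
  refine ((finite_neighbors x).image (fun z => s(x, z))).subset ?_
  rintro _ ⟨e, he, rfl⟩
  obtain ⟨z, h, rfl⟩ := exists_edge_eq he
  exact ⟨z, h, rfl⟩

/-- There is no infinite chain of attempts going back in time. -/
theorem precedes_wellFounded {d : ℕ} {U : Labels d} (hU : U ∈ Omega d) :
    WellFounded (Precedes U) := by
  let r : (lattice d).Dart → (lattice d).Dart → Prop := fun b a =>
    a.snd = b.fst ∧ U (edge b.adj) < U (edge a.adj)
  have hr : WellFounded r := by
    rw [wellFounded_iff_isEmpty_descending_chain]
    refine ⟨fun ⟨a, ha⟩ => hU.2 ?_⟩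
    have hadj : ∀ i, (lattice d).Adj (a i).fst (a (i + 1)).fst := fun i => by
      rw [← (ha i).1]; exact (a i).adj
    refine ⟨fun i => (a i).fst, hadj, Or.inr ?_⟩
    have he : ∀ i, edge (hadj i) = edge (a i).adj := fun i =>
      Subtype.ext (by simp only [(ha i).1])
    simp only [he]
    exact strictAnti_nat_of_succ_lt fun i => (ha i).2
  have key : ∀ a : (lattice d).Dart, ∀ f : Edge d, a.snd ∈ f.1 → U f < U (edge a.adj) →
      Acc (Precedes U) f := by
    intro a
    induction a using hr.induction with
    | _ a ih =>
    have hwf : ({e : Edge d | a.snd ∈ e.1}).WellFoundedOn (fun f e => U f < U e) :=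
      letI : IsStrictOrder (Edge d) (fun f e => U f < U e) :=
        { irrefl := fun f => lt_irrefl (U f), trans := fun _ _ _ h h' => lt_trans h h' }
      (finite_edges_at a.snd).wellFoundedOn
    intro f hf
    refine hwf.induction (P := fun f => U f < U (edge a.adj) → Acc (Precedes U) f) hf ?_
    intro f hf ihf hlt
    refine Acc.intro _ fun g hg => ?_
    obtain ⟨hgf, x, hxf, hxg⟩ := hg
    obtain ⟨w, hw, rfl⟩ := exists_edge_eq hf
    rcases Sym2.mem_iff.1 hxf with rfl | rfl
    · exact ihf g hxg hgf (hgf.trans hlt)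
    · exact ih ⟨(a.snd, x), hw⟩ ⟨rfl, hlt⟩ g hxg hgf
  refine ⟨fun e => Acc.intro _ fun g hg => ?_⟩
  obtain ⟨hge, x, hxe, hxg⟩ := hg
  obtain ⟨w, hw, rfl⟩ := exists_edge_eq hxe
  refine key ⟨(w, x), hw.symm⟩ g hxg ?_
  have : edge hw.symm = edge hw := Subtype.ext Sym2.eq_swap
  rw [this]; exact hge

/-- The attempt of the edge `e` (at time `U e`) succeeds: at each of its end-vertices, the number of
edges whose attempt came strictly earlier and succeeded is less than `κ`. This is a recursion over
the earlier attempts at adjacent edges. -/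
def Succeeds {d : ℕ} (κ : ℕ) (U : Labels d) (hU : U ∈ Omega d) : Edge d → Prop :=
  (precedes_wellFounded hU).fix fun e rec =>
    ∀ (x : Fin d → ℤ) (hx : x ∈ e.1),
      {f : Edge d | ∃ (hf : x ∈ f.1) (h : U f < U e), rec f ⟨h, x, hx, hf⟩}.ncard < κ

/-- `e` is `p`-open, i.e. `ω_p(U, e) = 1`. -/
def EdgeOpen {d : ℕ} (κ : ℕ) (p : ℝ) (U : Labels d) (hU : U ∈ Omega d) (e : Edge d) : Prop :=
  (U e : ℝ) ≤ p ∧ Succeeds κ U hU e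

theorem succeeds_iff {d : ℕ} (κ : ℕ) (U : Labels d) (hU : U ∈ Omega d) (e : Edge d) :
    Succeeds κ U hU e ↔
      ∀ x ∈ e.1, {f : Edge d | x ∈ f.1 ∧ U f < U e ∧ Succeeds κ U hU f}.ncard < κ := by
  conv_lhs => rw [Succeeds, WellFounded.fix_eq]
  simp only [exists_prop]
  rfl

/-- The dynamics: `xy` is open at time `p` iff its attempt came by time `p` and, just before the
attempt, both `x` and `y` had degree less than `κ`. -/
theorem edgeOpen_iff {d : ℕ} (κ : ℕ) (p : ℝ) (U : Labels d) (hU : U ∈ Omega d)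
    {x y : Fin d → ℤ} (h : (lattice d).Adj x y) :
    EdgeOpen κ p U hU (edge h) ↔
      (U (edge h) : ℝ) ≤ p ∧
      {z | ∃ hz : (lattice d).Adj x z,
        ∃ q < (U (edge h) : ℝ), EdgeOpen κ q U hU (edge hz)}.ncard < κ ∧
      {z | ∃ hz : (lattice d).Adj y z,
        ∃ q < (U (edge h) : ℝ), EdgeOpen κ q U hU (edge hz)}.ncard < κ := by
  have key : ∀ v : Fin d → ℤ,
      {f : Edge d | v ∈ f.1 ∧ U f < U (edge h) ∧ Succeeds κ U hU f}.ncard =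
      {z | ∃ hz : (lattice d).Adj v z,
        ∃ q < (U (edge h) : ℝ), EdgeOpen κ q U hU (edge hz)}.ncard := by
    intro v
    symm
    refine Set.ncard_congr (fun z hz => edge hz.1) ?_ ?_ ?_
    · rintro z ⟨hz, q, hq, hzq, hs⟩
      exact ⟨Sym2.mem_mk_left _ _, Subtype.coe_lt_coe.1 (lt_of_le_of_lt hzq hq), hs⟩
    · intro a b ha hb hab
      exact Sym2.congr_right.1 (congrArg Subtype.val hab)
    · rintro f ⟨hv, hlt, hs⟩
      obtain ⟨z, hz, rfl⟩ := exists_edge_eq hv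
      exact ⟨z, ⟨hz, U (edge hz), hlt, le_rfl, hs⟩, rfl⟩
  rw [EdgeOpen, succeeds_iff, ← key x, ← key y]
  simp [edge]

/-- The random subgraph of `ℤ^d` formed by the `p`-open edges. -/
def openGraph {d : ℕ} (κ : ℕ) (p : ℝ) (U : Labels d) (hU : U ∈ Omega d) :
    SimpleGraph (Fin d → ℤ) where
  Adj x y := ∃ h : (lattice d).Adj x y, EdgeOpen κ p U hU (edge h)
  symm := ⟨fun x y ⟨h, ho⟩ => ⟨h.symm, by
    have : edge h.symm = edge h := Subtype.ext Sym2.eq_swap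
    rwa [this]⟩⟩
  loopless := ⟨fun x ⟨h, _⟩ => (lattice d).irrefl h⟩

/-- The event that `x` and `y` are connected by a `p`-open path. -/
def connEvent {d : ℕ} (κ : ℕ) (p : ℝ) (x y : Fin d → ℤ) : Set (Labels d) :=
  {U | ∃ hU : U ∈ Omega d, (openGraph κ p U hU).Reachable x y}

/-- The event that there is an infinite `p`-open path (with distinct vertices) starting at `x`. -/
def connInftyEvent {d : ℕ} (κ : ℕ) (p : ℝ) (x : Fin d → ℤ) : Set (Labels d) :=
  {U | ∃ hU : U ∈ Omega d, ∃ γ : ℕ → Fin d → ℤ, γ 0 = x ∧ Function.Injective γ ∧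
    ∀ i, (openGraph κ p U hU).Adj (γ i) (γ (i + 1))}

/-- The one-arm probability `θ_n(p)`. -/
def thetaN (d κ n : ℕ) (p : ℝ) : ℝ :=
  (P d).real (⋃ x ∈ {x : Fin d → ℤ | norm1 x = n}, connEvent κ p 0 x)

/-- The percolation probability `θ(p)`. -/
def theta (d κ : ℕ) (p : ℝ) : ℝ := (P d).real (connInftyEvent κ p (0 : Fin d → ℤ))

/-- The critical point `p_c`. -/
def pc (d κ : ℕ) : ℝ := sSup {p : ℝ | p ∈ Set.Icc (0 : ℝ) 1 ∧ theta d κ p = 0}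

/-- The susceptibility `∑_x P(0 ↔ x)`, possibly infinite. -/
def susceptibility (d κ : ℕ) (p : ℝ) : ENNReal :=
  ∑' x : Fin d → ℤ, P d (connEvent κ p 0 x)

/-- The susceptibility critical threshold. -/
def pcHat (d κ : ℕ) : ℝ := sSup {p : ℝ | p ∈ Set.Icc (0 : ℝ) 1 ∧ susceptibility d κ p < ⊤}

end CDP

end

open MeasureTheory

noncomputable section

namespace CDP

/-! The plan is the OSSS route to sharpness: prove, locally uniformly in p in (0,1), an integrated
form of θ_n' ≥ c (n / S_n) θ_n (1 - θ_n) with S_n = ∑_{k<n} θ_k, and deduce that θ_n(b) → 0 forces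
exponential decay at every p < b. Monotonicity in p is free, since open edges stay open. But the
success of an attempt is not monotone in the labels and may depend on distant labels, so neither
Russo's formula nor the usual cluster exploration applies directly.

The remedy is that dependence only travels along chains of adjacent edges with monotone labels. A
given chain of m edges is monotone with probability at most C^m / m!, which beats every exponential
factor (`ncard_increasing_le_exp`). This gain is spent three times. (1) The model in a box of radius
n agrees, off an event of small probability, with a model on a larger finite box with labels in `Fin
M` (`succeeds_iff_succ`, `exists_P_badSet_le`), where probabilities are cardinalities. (2) An
exploration of the clusters of a sphere queries the edges from which an increasing chain leads to
these clusters. It determines the one-arm event (`cross_of_explored`), and averaging over the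
spheres of radius k < n gives revealment of order S_n / n (`sum_revealment_le`). (3) If relabelling
e creates the connection, increasing chains lead from e to the cluster of the origin and to a
cluster of the sphere. Near these chains all open edges but two entry edges are removed and a simple
path is laid instead. Its degrees are at most 2 ≤ κ, so the dynamics accepts it, and its first edge,
given the threshold label j, is pivotal (`exists_pivot_modification`). The cost is exponential in
the length of the chains, so the total influence is bounded by the pivotal probabilities
(`sum_influence_le`), whose sum is at most the discrete derivative of the connection probability
plus a small error from ties (`sum_pivotal_le`).

OSSS combines (2) and (3) into `finite_differential_inequality`; refining the discretisation yields
`differential_inequality`. A discrete version of the usual calculus argument gives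
`exists_exp_decay`. If θ(b) = 0, then θ_n(b) → 0 by König's lemma and continuity of the measure.
Finally, exponential decay makes the susceptibility finite, and finite susceptibility forces θ = 0
by Borel–Cantelli, so the two thresholds coincide. -/

/-! ### Connectivity in finite multigraphs -/

section Reach

variable {V E : Type*} (ends : E → Sym2 V)

/-- `x` and `y` are joined by a path of edges in `ω`. -/
def Reach (ω : Set E) : V → V → Prop :=
  Relation.ReflTransGen fun x y => ∃ e ∈ ω, ends e = s(x, y)

/-- The vertices touched by `K`. -/
def verts (K : Set E) : Set V := {x | ∃ e ∈ K, x ∈ ends e}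

/-- The number of edges of `ω` at `x`. -/
def deg (ω : Set E) (x : V) : ℕ := {e | e ∈ ω ∧ x ∈ ends e}.ncard

/-- The edges of `ω` that avoid the vertices in `X`. -/
def avoiding (ω : Set E) (X : Set V) : Set E := {e | e ∈ ω ∧ ∀ v ∈ ends e, v ∉ X}

variable {ends}

theorem avoiding_subset (ω : Set E) (X : Set V) : avoiding ends ω X ⊆ ω := fun _ h => h.1

theorem Reach.mono {ω ω' : Set E} (h : ω ⊆ ω') {x y : V} (hr : Reach ends ω x y) :
    Reach ends ω' x y :=
  Relation.ReflTransGen.mono (fun _ _ ⟨e, he, h'⟩ => ⟨e, h he, h'⟩) _ _ hr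

theorem Reach.symm {ω : Set E} {x y : V} (hr : Reach ends ω x y) : Reach ends ω y x := by
  induction hr with
  | refl => exact .refl
  | tail _ h ih =>
    obtain ⟨e, he, h'⟩ := h
    exact .head ⟨e, he, h'.trans Sym2.eq_swap⟩ ih

theorem Reach.trans {ω : Set E} {x y z : V} (h : Reach ends ω x y) (h' : Reach ends ω y z) :
    Reach ends ω x z := Relation.ReflTransGen.trans h h'

theorem Reach.of_edge {ω : Set E} {x y : V} {e : E} (he : e ∈ ω) (h : ends e = s(x, y)) :
    Reach ends ω x y := .single ⟨e, he, h⟩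

theorem Reach.of_mem {ω : Set E} {x y : V} {e : E} (he : e ∈ ω) (hx : x ∈ ends e)
    (hy : y ∈ ends e) : Reach ends ω x y := by
  obtain ⟨z, hz⟩ := Sym2.mem_iff_exists.1 hx
  rw [hz] at hy
  rcases Sym2.mem_iff.1 hy with rfl | rfl
  · exact .refl
  · exact .of_edge he hz

/-- A path entering `X` does so for the first time through an edge. -/
theorem Reach.exists_entry {ω : Set E} {X : Set V} {a b : V} (h : Reach ends ω a b) (ha : a ∉ X)
    (hb : b ∈ X) : ∃ x ∈ X, ∃ x' ∉ X, ∃ e ∈ ω, ends e = s(x', x) ∧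
      Reach ends (avoiding ends ω X) a x' := by
  suffices H : (b ∉ X ∧ Reach ends (avoiding ends ω X) a b) ∨
      ∃ x ∈ X, ∃ x' ∉ X, ∃ e ∈ ω, ends e = s(x', x) ∧ Reach ends (avoiding ends ω X) a x' from
    H.resolve_left fun h => h.1 hb
  clear hb
  induction h with
  | refl => exact Or.inl ⟨ha, .refl⟩
  | @tail b c _ h ih =>
    rcases ih with ⟨hb, hr⟩ | hhit
    · obtain ⟨e, he, hbc⟩ := h
      by_cases hc : c ∈ X
      · exact Or.inr ⟨c, hc, b, hb, e, he, hbc, hr⟩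
      · refine Or.inl ⟨hc, hr.tail ⟨e, ⟨he, ?_⟩, hbc⟩⟩
        rw [hbc]
        intro v hv
        rcases Sym2.mem_iff.1 hv with rfl | rfl <;> assumption
    · exact Or.inr hhit

/-- First entrance to `X`, including the case of a path that starts in `X`. -/
theorem Reach.first_hit {ω : Set E} {X : Set V} {a b : V} (h : Reach ends ω a b) (hb : b ∈ X) :
    ∃ x ∈ X, ∃ kept : Set E, kept ⊆ ω ∧ kept.Subsingleton ∧
      (∀ e ∈ kept, ∃ x' ∉ X, ends e = s(x', x)) ∧
      Reach ends (avoiding ends ω X ∪ kept) a x ∧ (a ∈ X → x = a) := by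
  by_cases ha : a ∈ X
  -- `kept` is empty if the path starts in `X` and otherwise is the entry edge alone, so it costs
  -- one unit of degree at `x` and none at the other vertices of `X`.
  · exact ⟨a, ha, ∅, by simp, by simp, by simp, .refl, fun _ => rfl⟩
  · obtain ⟨x, hx, x', hx', e, he, hee, hr⟩ := h.exists_entry ha hb
    refine ⟨x, hx, {e}, by simpa using he, by simp, ?_, ?_, fun h => absurd h ha⟩
    · rintro _ rfl
      exact ⟨x', hx', hee⟩
    · exact (hr.mono Set.subset_union_left).trans (.of_edge (Or.inr rfl) hee)

theorem deg_mono [Finite E] {ω ω' : Set E} (h : ω ⊆ ω') (x : V) : deg ends ω x ≤ deg ends ω' x :=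
  Set.ncard_le_ncard (fun _ he => ⟨h he.1, he.2⟩) (Set.toFinite _)

theorem deg_union_le [Finite E] (ω ω' : Set E) (x : V) :
    deg ends (ω ∪ ω') x ≤ deg ends ω x + deg ends ω' x := by
  refine (Set.ncard_le_ncard (t := {e | e ∈ ω ∧ x ∈ ends e} ∪ {e | e ∈ ω' ∧ x ∈ ends e}) ?_
    (Set.toFinite _)).trans (Set.ncard_union_le _ _)
  rintro e ⟨he | he, hx⟩
  · exact Or.inl ⟨he, hx⟩
  · exact Or.inr ⟨he, hx⟩

theorem deg_eq_zero {ω : Set E} {x : V} (h : ∀ e ∈ ω, x ∉ ends e) : deg ends ω x = 0 := by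
  have : {e | e ∈ ω ∧ x ∈ ends e} = ∅ := by
    ext e
    simpa using h e
  rw [deg, this, Set.ncard_empty]

theorem deg_le_one_of_subsingleton {ω : Set E} (h : ω.Subsingleton) (x : V) :
    deg ends ω x ≤ 1 := by
  rw [deg, Set.ncard_le_one ((h.anti fun e he => he.1).finite)]
  exact fun a ha b hb => h ha.1 hb.1

/-- Two distinct connected vertices are joined by a simple path, whose first edge is `g`. -/
theorem Reach.exists_path [Finite E] {K : Set E} {x y : V} (hxy : x ≠ y)
    (h : Reach ends K x y) :
    ∃ g ∈ K, ∃ π ⊆ K, ∃ x₁, ends g = s(x, x₁) ∧ (∀ e ∈ π, x ∉ ends e) ∧ Reach ends π x₁ y ∧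
      deg ends ({g} ∪ π) y ≤ 1 ∧ ∀ v, deg ends ({g} ∪ π) v ≤ 2 := by
  induction hn : K.ncard using Nat.strong_induction_on generalizing K x with
  | _ n ih =>
  -- Read from `y`, the path first arrives at `x` through `g` and avoids `x` before that. So the
  -- induction can continue in the edges avoiding `x`, a set that has lost `g`.
  obtain ⟨x', rfl, x₁, hx₁, g, hg, hge, hr⟩ := h.symm.exists_entry (X := {x}) hxy.symm rfl
  have hx' : x' ≠ x₁ := fun h => hx₁ h.symm
  have hge' : ends g = s(x', x₁) := hge.trans Sym2.eq_swap
  by_cases h1 : x₁ = y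
  · subst h1
    refine ⟨g, hg, ∅, by simp, x₁, hge', by simp, .refl, ?_, fun v => ?_⟩
    · exact deg_le_one_of_subsingleton (by simp) _
    · exact (deg_le_one_of_subsingleton (by simp) _).trans one_le_two
  · have hlt : (avoiding ends K {x'}).ncard < n := by
      rw [← hn]
      refine Set.ncard_lt_ncard ⟨avoiding_subset _ _, fun hs => ?_⟩ (Set.toFinite _)
      exact (hs hg).2 x' (by simp [hge']) rfl
    obtain ⟨g', hg', π', hπ', x₂, hge₂, hπx, hr', hdy, hd⟩ := ih _ hlt h1 hr.symm rfl
    have hsub : {g'} ∪ π' ⊆ avoiding ends K {x'} :=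
      Set.union_subset (by simpa using hg') hπ'
    refine ⟨g, hg, {g'} ∪ π', hsub.trans (avoiding_subset _ _), x₁, hge', ?_, ?_, ?_, ?_⟩
    · exact fun e he hx => (hsub he).2 x' hx rfl
    · exact (Reach.of_edge (ω := {g'} ∪ π') (Or.inl rfl) hge₂).trans
        (hr'.mono Set.subset_union_right)
    · refine (deg_union_le _ _ _).trans ?_
      rw [deg_eq_zero (ω := {g})]
      · simpa using hdy
      · rintro _ rfl hy
        rw [hge', Sym2.mem_iff] at hy
        rcases hy with rfl | rfl
        · exact hxy rfl
        · exact h1 rfl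
    · intro v
      refine (deg_union_le _ _ _).trans ?_
      -- At an end of `g` the rest of the path has degree at most one: zero at `x'`, and only `g'`
      -- can contribute at `x₁`.
      by_cases hv : v ∈ ends g
      · have h1 : deg ends ({g} : Set E) v ≤ 1 := deg_le_one_of_subsingleton (by simp) _
        have h2 : deg ends ({g'} ∪ π') v ≤ 1 := by
          rw [hge', Sym2.mem_iff] at hv
          rcases hv with rfl | rfl
          · rw [deg_eq_zero]
            · exact Nat.zero_le _
            · exact fun e he hx => (hsub he).2 v hx rfl
          · refine (deg_union_le _ _ _).trans ?_
            rw [deg_eq_zero hπx]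
            exact deg_le_one_of_subsingleton (by simp) _
        omega
      · rw [deg_eq_zero (ω := {g})]
        · simpa using hd v
        · rintro _ rfl
          exact hv

/-- If every edge of `ω` at the `ω'`-cluster of `a` were in `ω'`, the `ω`-path could be followed
inside `ω'`. This locates a changed edge at the boundary of an old cluster. -/
theorem Reach.exists_disagreement {ω ω' : Set E} {a b : V} (h : Reach ends ω a b)
    (h' : ¬ Reach ends ω' a b) :
    ∃ x, Reach ends ω' a x ∧ ∃ d ∈ ω, d ∉ ω' ∧ x ∈ ends d := by
  by_contra! hcon
  refine h' ?_
  clear h'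
  induction h with
  | refl => exact .refl
  | @tail x y _ hxy ih =>
    obtain ⟨e, he, hee⟩ := hxy
    refine ih.tail ⟨e, ?_, hee⟩
    by_contra hne
    exact hcon x ih e he hne (by simp [hee])

end Reach

/-! ### The dynamics with discrete labels -/

section Dynamics

variable {V E : Type*} [LinearOrder E] {M : ℕ}

/-- `f` attempts before `e`; ties between labels are broken by the order of the edges. -/
def Lt (u : E → Fin M) (f e : E) : Prop := u f < u e ∨ (u f = u e ∧ f < e)

theorem Lt.irrefl (u : E → Fin M) (e : E) : ¬ Lt u e e := by simp [Lt]

theorem Lt.trans {u : E → Fin M} {e f g : E} (h : Lt u e f) (h' : Lt u f g) : Lt u e g := by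
  unfold Lt at *
  rcases h with h | ⟨h, h1⟩ <;> rcases h' with h' | ⟨h', h1'⟩
  · exact Or.inl (h.trans h')
  · exact Or.inl (h' ▸ h)
  · exact Or.inl (h ▸ h')
  · exact Or.inr ⟨h.trans h', h1.trans h1'⟩

theorem Lt.ne {u : E → Fin M} {e f : E} (h : Lt u e f) : e ≠ f := by
  rintro rfl
  exact Lt.irrefl u e h

theorem Lt.le {u : E → Fin M} {e f : E} (h : Lt u e f) : u e ≤ u f := by
  rcases h with h | h
  · exact h.le
  · exact h.1.le

theorem Lt.total (u : E → Fin M) {e f : E} (h : e ≠ f) : Lt u e f ∨ Lt u f e := by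
  unfold Lt
  rcases lt_trichotomy (u e) (u f) with h1 | h1 | h1
  · exact Or.inl (Or.inl h1)
  · rcases lt_or_gt_of_ne h with h2 | h2
    · exact Or.inl (Or.inr ⟨h1, h2⟩)
    · exact Or.inr (Or.inr ⟨h1.symm, h2⟩)
  · exact Or.inr (Or.inl h1)

theorem lt_congr {u u' : E → Fin M} {f e : E} (hf : u f = u' f) (he : u e = u' e) :
    Lt u f e ↔ Lt u' f e := by simp only [Lt, hf, he]

variable [Fintype E]

theorem lt_wf (u : E → Fin M) : WellFounded (Lt u) :=
  letI : IsTrans E (Lt u) := ⟨fun _ _ _ => Lt.trans⟩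
  letI : Std.Irrefl (Lt u) := ⟨Lt.irrefl u⟩
  Finite.wellFounded_of_trans_of_irrefl _

variable (ends : E → Sym2 V) (κ : ℕ)

/-- The attempt of `e` succeeds in the model with labels `u`. -/
def Succ (u : E → Fin M) : E → Prop :=
  (lt_wf u).fix fun e rec => ∀ x ∈ ends e, {f | x ∈ ends f ∧ ∃ h : Lt u f e, rec f h}.ncard < κ

theorem succ_iff (u : E → Fin M) (e : E) : Succ ends κ u e ↔
    ∀ x ∈ ends e, {f | x ∈ ends f ∧ Lt u f e ∧ Succ ends κ u f}.ncard < κ := by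
  conv_lhs => rw [Succ, WellFounded.fix_eq]
  simp only [exists_prop]
  rfl

/-- The edges that are open when all labels below `j` have been handled. -/
def openSet (j : ℕ) (u : E → Fin M) : Set E := {e | (u e : ℕ) < j ∧ Succ ends κ u e}

variable {ends κ}

theorem openSet_mono {j j' : ℕ} (h : j ≤ j') (u : E → Fin M) :
    openSet ends κ j u ⊆ openSet ends κ j' u := fun _ he => ⟨he.1.trans_le h, he.2⟩

/-- Among the open edges at `x`, all others precede the last one to attempt; as that one succeeded,
they number less than `κ`. -/
theorem deg_openSet_le (j : ℕ) (u : E → Fin M) (x : V) : deg ends (openSet ends κ j u) x ≤ κ := by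
  by_contra! hlt
  set A : Set E := {e | e ∈ openSet ends κ j u ∧ x ∈ ends e}
  have hA : A.Nonempty := Set.nonempty_of_ncard_ne_zero (by change κ < A.ncard at hlt; omega)
  have hwf : WellFounded (Function.swap (Lt u)) :=
    letI : IsTrans E (Function.swap (Lt u)) := ⟨fun _ _ _ h h' => Lt.trans h' h⟩
    letI : Std.Irrefl (Function.swap (Lt u)) := ⟨Lt.irrefl u⟩
    Finite.wellFounded_of_trans_of_irrefl _
  obtain ⟨e, he, hmax⟩ := hwf.has_min A hA
  have h1 := (succ_iff ends κ u e).1 he.1.2 x he.2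
  have h2 : A \ {e} ⊆ {f | x ∈ ends f ∧ Lt u f e ∧ Succ ends κ u f} := by
    rintro f ⟨hf, hne⟩
    exact ⟨hf.2, (Lt.total u hne).resolve_right (hmax f hf), hf.1.2⟩
  have h3 := Set.ncard_le_ncard h2 (Set.toFinite _)
  have h4 := Set.ncard_sdiff_singleton_add_one he (Set.toFinite _)
  change κ < A.ncard at hlt
  omega

/-- Local modification: relabelling the edges near `W` realises any prescribed graph `η` which
respects the degree constraint and agrees with the open graph away from `W`. -/
theorem openSet_modification {j : ℕ} {u u' : E → Fin M} {W : Set V} {η : Set E}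
    (hdeg : ∀ x ∈ W, deg ends η x ≤ κ)
    (hin : ∀ e, (∃ x ∈ ends e, x ∈ W) → ((u' e : ℕ) < j ↔ e ∈ η))
    (hout : ∀ e, (∀ x ∈ ends e, x ∉ W) → u' e = u e)
    (hkeep : ∀ e ∈ η, ∀ x ∈ ends e, x ∉ W → u' e = u e)
    (hη : ∀ e, ∀ x ∈ ends e, x ∉ W → (e ∈ η ↔ e ∈ openSet ends κ j u)) :
    openSet ends κ j u' = η := by
  have key : ∀ e, (u' e : ℕ) < j → (Succ ends κ u' e ↔ e ∈ η) := by
    intro e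
    induction e using (lt_wf u').induction with
    | _ e ih =>
    intro hej
    have ih' : ∀ f, Lt u' f e → (Succ ends κ u' f ↔ f ∈ η) := fun f hf =>
      ih f hf (lt_of_le_of_lt (Fin.le_def.1 hf.le) hej)
    constructor
    · intro hs
      by_contra hne
      -- An edge outside `η` with label below `j` avoids `W`, so it kept its label and failed under
      -- `u`, blocked by `κ` earlier open edges at some `y ∉ W`. These lie in `η`, kept their labels
      -- and by induction succeed under `u'`, so they block again.
      have hW : ∀ x ∈ ends e, x ∉ W := fun x hx hxW => hne ((hin e ⟨x, hx, hxW⟩).1 hej)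
      have heu := hout e hW
      obtain ⟨x, hx⟩ : ∃ x, x ∈ ends e := ⟨_, Sym2.out_fst_mem _⟩
      have hno : ¬ Succ ends κ u e := fun h =>
        hne ((hη e x hx (hW x hx)).2 ⟨by rw [← heu]; exact hej, h⟩)
      rw [succ_iff] at hno
      push Not at hno
      obtain ⟨y, hy, hcard⟩ := hno
      have hs' := (succ_iff ends κ u' e).1 hs y hy
      refine absurd (hcard.trans (Set.ncard_le_ncard ?_ (Set.toFinite _))) hs'.not_ge
      rintro f ⟨hyf, hlt, hsf⟩
      have hfη : f ∈ η := (hη f y hyf (hW y hy)).2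
        ⟨lt_of_le_of_lt (Fin.le_def.1 hlt.le) (by rw [← heu]; exact hej), hsf⟩
      have hlt' : Lt u' f e := (lt_congr (hkeep f hfη y hyf (hW y hy)) heu).2 hlt
      exact ⟨hyf, hlt', (ih' f hlt').2 hfη⟩
    · intro heη
      rw [succ_iff]
      intro x hx
      -- At a vertex of `W` the earlier successes lie in `η` without `e`, and `η` has degree at most
      -- `κ` there. At any other vertex they were earlier successes under `u` too.
      by_cases hxW : x ∈ W
      · have h1 : {f | x ∈ ends f ∧ Lt u' f e ∧ Succ ends κ u' f} ⊆
            {f | f ∈ η ∧ x ∈ ends f} \ {e} := by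
          rintro f ⟨hxf, hlt, hs⟩
          exact ⟨⟨(ih' f hlt).1 hs, hxf⟩, hlt.ne⟩
        have h2 := Set.ncard_le_ncard h1 (Set.toFinite _)
        have h3 := Set.ncard_sdiff_singleton_add_one
          (show e ∈ {f | f ∈ η ∧ x ∈ ends f} from ⟨heη, hx⟩) (Set.toFinite _)
        have h4 := hdeg x hxW
        unfold deg at h4
        omega
      · have heu := hkeep e heη x hx hxW
        have hs := ((hη e x hx hxW).1 heη).2
        refine lt_of_le_of_lt (Set.ncard_le_ncard ?_ (Set.toFinite _))
          ((succ_iff ends κ u e).1 hs x hx)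
        rintro f ⟨hxf, hlt, hsf⟩
        have hfη := (ih' f hlt).1 hsf
        exact ⟨hxf, (lt_congr (hkeep f hfη x hxf hxW) heu).1 hlt, ((hη f x hxf hxW).1 hfη).2⟩
  ext e
  constructor
  · rintro ⟨h1, h2⟩
    exact (key e h1).1 h2
  · intro he
    have hlt : (u' e : ℕ) < j := by
      by_cases hW : ∃ x ∈ ends e, x ∈ W
      · exact (hin e hW).2 he
      · push Not at hW
        obtain ⟨x, hx⟩ : ∃ x, x ∈ ends e := ⟨_, Sym2.out_fst_mem _⟩
        rw [hout e hW]
        exact ((hη e x hx (hW x hx)).1 he).1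
    exact ⟨hlt, (key e hlt).2 he⟩

end Dynamics

/-! ### Decision trees and the OSSS inequality -/

section OSSS

variable {E α : Type*} [DecidableEq E]

/-- The configuration equal to `u` on `R` and to `v` elsewhere. -/
def hybrid (R : Finset E) (u v : E → α) : E → α := fun e => if e ∈ R then u e else v e

/-- Decision trees: each node queries a coordinate and branches according to its value. -/
inductive DT (E α : Type*) : Type _
  | leaf : DT E α
  | node (e : E) (c : α → DT E α) : DT E α

/-- The coordinates queried on the input `u`. -/
def DT.rev : DT E α → (E → α) → Finset E
  | .leaf, _ => ∅
  | .node e c, u => insert e ((c (u e)).rev u)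

/-- The coordinate `e` does not appear in the tree. -/
def DT.Avoids (e : E) : DT E α → Prop
  | .leaf => True
  | .node e' c => e ≠ e' ∧ ∀ a, (c a).Avoids e

/-- No coordinate is queried twice on a branch. -/
def DT.Nodup : DT E α → Prop
  | .leaf => True
  | .node e c => ∀ a, (c a).Avoids e ∧ (c a).Nodup

theorem DT.Avoids.notMem_rev {e : E} {T : DT E α} (h : T.Avoids e) (u : E → α) :
    e ∉ T.rev u := by
  induction T with
  | leaf => simp [DT.rev]
  | node e' c ih => simpa [DT.rev, h.1] using ih _ (h.2 _)

theorem DT.rev_congr (T : DT E α) {u u' : E → α} (h : ∀ e ∈ T.rev u, u' e = u e) :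
    T.rev u' = T.rev u := by
  induction T with
  | leaf => rfl
  | node e c ih =>
    have he : u' e = u e := h e (by simp [DT.rev])
    simp only [DT.rev, he]
    rw [ih (u e) fun f hf => h f (by simp [DT.rev, hf])]

theorem DT.Avoids.rev_update {e : E} {T : DT E α} (h : T.Avoids e) (u : E → α) (a : α) :
    T.rev (Function.update u e a) = T.rev u :=
  T.rev_congr fun f hf => Function.update_of_ne (by rintro rfl; exact h.notMem_rev u hf) _ _

variable [Fintype E]

/-- The tree queries, as long as there is one, a coordinate that is certain to lie in `R` given the
values already seen, and stops otherwise. Hence everything queried is in `R u`, and any other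
coordinate avoids `R` for some configuration compatible with the answers. In the induction `S` is
the set already queried, with answers `u₀`. -/
theorem exists_exploration (R : (E → α) → Set E) : ∃ T : DT E α, T.Nodup ∧ ∀ u,
    (∀ e ∈ T.rev u, e ∈ R u) ∧
    ∀ e ∉ T.rev u, ∃ u', (∀ f ∈ T.rev u, u' f = u f) ∧ e ∉ R u' := by
  suffices H : ∀ (n : ℕ) (S : Finset E) (u₀ : E → α), Fintype.card E - S.card ≤ n →
      ∃ T : DT E α, T.Nodup ∧ (∀ e ∈ S, T.Avoids e) ∧ ∀ u, (∀ f ∈ S, u f = u₀ f) →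
        (∀ e ∈ T.rev u, e ∈ R u) ∧
        ∀ e ∉ S ∪ T.rev u, ∃ u', (∀ f ∈ S ∪ T.rev u, u' f = u f) ∧ e ∉ R u' by
    by_cases hne : Nonempty (E → α)
    · obtain ⟨u₀⟩ := hne
      obtain ⟨T, h1, -, h2⟩ := H _ ∅ u₀ le_rfl
      exact ⟨T, h1, fun u => by simpa using h2 u (by simp)⟩
    · exact ⟨.leaf, trivial, fun u => absurd ⟨u⟩ hne⟩
  intro n
  induction n with
  | zero =>
    intro S u₀ hS
    have hS' : S = Finset.univ := Finset.eq_univ_of_card S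
      (le_antisymm (Finset.card_le_univ S) (by omega))
    exact ⟨.leaf, trivial, fun _ _ => trivial, fun u _ =>
      ⟨by simp [DT.rev], fun e he => absurd (by simp [hS']) he⟩⟩
  | succ n ih =>
    intro S u₀ hS
    by_cases hex : ∃ e, e ∉ S ∧ ∀ u', (∀ f ∈ S, u' f = u₀ f) → e ∈ R u'
    · obtain ⟨e, heS, heR⟩ := hex
      have hcard : Fintype.card E - (insert e S).card ≤ n := by
        rw [Finset.card_insert_of_notMem heS]; omega
      choose T hT1 hT2 hT3 using fun a => ih (insert e S) (Function.update u₀ e a) hcard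
      refine ⟨.node e T, fun a => ⟨hT2 a e (by simp), hT1 a⟩, fun g hg => ⟨?_, fun a =>
        hT2 a g (by simp [hg])⟩, fun u hu => ?_⟩
      · rintro rfl; exact heS hg
      · have hu' : ∀ f ∈ insert e S, u f = Function.update u₀ e (u e) f := by
          intro f hf
          by_cases hfe : f = e
          · subst hfe; simp
          · rw [Function.update_of_ne hfe]
            exact hu f (by simpa [hfe] using hf)
        obtain ⟨h1, h2⟩ := hT3 (u e) u hu'
        have hset : S ∪ (DT.node e T).rev u = insert e S ∪ (T (u e)).rev u := by
          ext g; simp [DT.rev]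
        refine ⟨fun g hg => ?_, fun g hg => ?_⟩
        · rw [DT.rev, Finset.mem_insert] at hg
          rcases hg with rfl | hg
          · exact heR u hu
          · exact h1 g hg
        · rw [hset] at hg ⊢
          exact h2 g hg
    · push Not at hex
      refine ⟨.leaf, trivial, fun _ _ => trivial, fun u hu => ⟨by simp [DT.rev], fun e he => ?_⟩⟩
      obtain ⟨u', h1, h2⟩ := hex e (by simpa [DT.rev] using he)
      exact ⟨u', fun f hf => by
        have hf' : f ∈ S := by simpa [DT.rev] using hf
        rw [h1 f hf', hu f hf'], h2⟩
variable [Fintype α]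

/-- Exchanging `u e` with the independent value `a` is an involution of the pairs `(u, a)`. -/
theorem sum_update_involution (e : E) (K : (E → α) → α → ℝ) :
    ∑ u : E → α, ∑ a, K (Function.update u e a) (u e) = ∑ u : E → α, ∑ a, K u a := by
  rw [← Fintype.sum_prod_type' (f := fun u a => K (Function.update u e a) (u e)),
    ← Fintype.sum_prod_type' (f := fun u a => K u a)]
  let φ : (E → α) × α → (E → α) × α := fun p => (Function.update p.1 e p.2, p.1 e)
  have hφ : Function.Involutive φ := fun p => by simp [φ]
  exact Fintype.sum_bijective φ hφ.bijective _ _ fun p => rfl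

theorem sum_apply_eval (e : E) (F : α → (E → α) → ℝ)
    (hF : ∀ a u b, F a (Function.update u e b) = F a u) :
    (Fintype.card α : ℝ) * ∑ u : E → α, F (u e) u = ∑ a, ∑ u : E → α, F a u := by
  have h := sum_update_involution e fun (u : E → α) (_ : α) => F (u e) u
  simp only [Function.update_self, hF, Finset.sum_const, Finset.card_univ, nsmul_eq_mul] at h
  rw [Finset.mul_sum, ← h, Finset.sum_comm]

/-- Exchange `u` and `v` off the coordinates revealed by `u`. The revealed set is a function of the
values on it, so it does not change and the exchange is an involution; hence the hybrid is uniform.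
-/
theorem sum_hybrid_rev (T : DT E α) (h : (E → α) → ℝ) :
    ∑ u : E → α, ∑ v : E → α, h (hybrid (T.rev u) u v) =
      (Fintype.card (E → α) : ℝ) * ∑ w : E → α, h w := by
  let φ : (E → α) × (E → α) → (E → α) × (E → α) := fun p =>
    (hybrid (T.rev p.1) p.1 p.2, hybrid (T.rev p.1) p.2 p.1)
  have hrev : ∀ p, T.rev (φ p).1 = T.rev p.1 := fun p =>
    T.rev_congr fun e he => by simp [φ, hybrid, he]
  have hφ : Function.Involutive φ := by
    intro p
    have h1 := hrev p
    refine Prod.ext ?_ ?_ <;> funext e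
    · change hybrid (T.rev (φ p).1) (φ p).1 (φ p).2 e = _
      rw [h1]
      by_cases he : e ∈ T.rev p.1 <;> simp [φ, hybrid, he]
    · change hybrid (T.rev (φ p).1) (φ p).2 (φ p).1 e = _
      rw [h1]
      by_cases he : e ∈ T.rev p.1 <;> simp [φ, hybrid, he]
  rw [← Fintype.sum_prod_type' (f := fun u v => h (hybrid (T.rev u) u v))]
  rw [Fintype.sum_bijective φ hφ.bijective _ (fun p => h p.1) fun p => rfl]
  rw [Fintype.sum_prod_type]
  simp [Finset.mul_sum]

/-- The (unnormalised) influence of the coordinate `e`. -/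
def influence (f : (E → α) → ℝ) (e : E) : ℝ :=
  ∑ v : E → α, ∑ a, |f (Function.update v e a) - f v|

theorem influence_nonneg (f : (E → α) → ℝ) (e : E) : 0 ≤ influence f e :=
  Finset.sum_nonneg fun _ _ => Finset.sum_nonneg fun _ _ => abs_nonneg _

/-- The OSSS inequality for a decision tree. -/
theorem DT.osss [Nonempty α] (f : (E → α) → ℝ) (T : DT E α) (hT : T.Nodup) :
    (Fintype.card α : ℝ) * ∑ u : E → α, ∑ v : E → α, |f (hybrid (T.rev u) u v) - f v| ≤
      ∑ e, (∑ u : E → α, if e ∈ T.rev u then (1 : ℝ) else 0) * influence f e := by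
  have hα : (0 : ℝ) < Fintype.card α := by exact_mod_cast Fintype.card_pos
  induction T with
  | leaf =>
    have h0 : ∀ u v : E → α, hybrid ∅ u v = v := fun u v => funext fun e => by simp [hybrid]
    simp [DT.rev, h0]
  | node e c ih =>
    have hav : ∀ a, (c a).Avoids e := fun a => (hT a).1
    -- The root is treated as if revealed after its subtree: the full hybrid is that of the subtree
    -- with coordinate `e` set to `u e`. The triangle inequality splits the sum into `A`, due to
    -- this last change, and `B`, due to the subtree.
    have hup : ∀ u v : E → α, hybrid ((DT.node e c).rev u) u v =
        Function.update (hybrid ((c (u e)).rev u) u v) e (u e) := by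
      intro u v
      funext g
      by_cases hg : g = e
      · subst hg; simp [hybrid, DT.rev]
      · simp [hybrid, DT.rev, hg]
    have hhyb : ∀ a u b, ∀ v : E → α,
        hybrid ((c a).rev (Function.update u e b)) (Function.update u e b) v =
          hybrid ((c a).rev u) u v := by
      intro a u b v
      rw [(hav a).rev_update]
      funext g
      by_cases hg : g ∈ (c a).rev u
      · have : g ≠ e := by rintro rfl; exact (hav a).notMem_rev u hg
        simp [hybrid, hg, this]
      · simp [hybrid, hg]
    set A := ∑ u : E → α, ∑ v : E → α,
      |f (Function.update (hybrid ((c (u e)).rev u) u v) e (u e)) -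
        f (hybrid ((c (u e)).rev u) u v)| with hA
    set B := ∑ u : E → α, ∑ v : E → α, |f (hybrid ((c (u e)).rev u) u v) - f v| with hB
    -- No subtree queries `e`, so for a fixed subtree the hybrid does not depend on `u e`, and it is
    -- uniform by `sum_hybrid_rev`. Resetting coordinate `e` therefore costs exactly the influence.
    have hAeq : (Fintype.card α : ℝ) * A = (Fintype.card (E → α) : ℝ) * influence f e := by
      rw [hA, sum_apply_eval e (fun a u => ∑ v : E → α,
        |f (Function.update (hybrid ((c a).rev u) u v) e a) - f (hybrid ((c a).rev u) u v)|)
        (fun a u b => by simp only [hhyb])]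
      rw [Finset.sum_congr rfl fun a _ =>
        sum_hybrid_rev (c a) (fun w => |f (Function.update w e a) - f w|)]
      rw [← Finset.mul_sum, Finset.sum_comm]
      rfl
    have hBeq : (Fintype.card α : ℝ) * B ≤
        ∑ g, (∑ u : E → α, if g ∈ (c (u e)).rev u then (1 : ℝ) else 0) * influence f g := by
      rw [hB, sum_apply_eval e (fun a u => ∑ v : E → α, |f (hybrid ((c a).rev u) u v) - f v|)
        (fun a u b => by simp only [hhyb])]
      refine le_of_mul_le_mul_left ?_ hα
      rw [Finset.mul_sum, Finset.mul_sum]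
      refine (Finset.sum_le_sum fun a _ => ih a (hT a).2).trans (le_of_eq ?_)
      rw [Finset.sum_comm]
      refine Finset.sum_congr rfl fun g _ => ?_
      rw [← Finset.sum_mul, ← mul_assoc, sum_apply_eval e
        (fun a u => if g ∈ (c a).rev u then (1 : ℝ) else 0)
        (fun a u b => by simp only [(hav a).rev_update])]
    calc (Fintype.card α : ℝ) * ∑ u : E → α, ∑ v : E → α,
          |f (hybrid ((DT.node e c).rev u) u v) - f v|
        ≤ Fintype.card α * (A + B) := by
          refine mul_le_mul_of_nonneg_left ?_ hα.le
          rw [hA, hB, ← Finset.sum_add_distrib]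
          refine Finset.sum_le_sum fun u _ => ?_
          rw [← Finset.sum_add_distrib]
          refine Finset.sum_le_sum fun v _ => ?_
          rw [hup]
          exact abs_sub_le _ _ _
      _ ≤ (Fintype.card (E → α) : ℝ) * influence f e +
          ∑ g, (∑ u : E → α, if g ∈ (c (u e)).rev u then (1 : ℝ) else 0) * influence f g := by
          rw [mul_add, hAeq]
          exact add_le_add le_rfl hBeq
      _ = ∑ g, (∑ u : E → α, if g ∈ (DT.node e c).rev u then (1 : ℝ) else 0) *
          influence f g := by
          have h1 : (Fintype.card (E → α) : ℝ) * influence f e =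
              ∑ g, if g = e then (Fintype.card (E → α) : ℝ) * influence f g else 0 := by
            rw [Finset.sum_ite_eq' Finset.univ e]
            simp
          rw [h1, ← Finset.sum_add_distrib]
          refine Finset.sum_congr rfl fun g _ => ?_
          by_cases hg : g = e
          · subst hg
            simp [DT.rev, (hav _).notMem_rev]
          · simp [DT.rev, hg]

open scoped Classical in
/-- The OSSS inequality for an exploration: if `f` is determined by any set `S` of coordinates
outside of which no coordinate is certain to lie in `R`, then the variance of `f` is controlled by
the probabilities to belong to `R` and the influences. -/
theorem osss_exploration [Nonempty α] (f : (E → α) → ℝ) (R : (E → α) → Set E)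
    (hf : ∀ (S : Finset E) (u v : E → α), (∀ e ∈ S, v e = u e) →
      (∀ e ∉ S, ∃ u', (∀ g ∈ S, u' g = u g) ∧ e ∉ R u') → f v = f u) :
    (Fintype.card α : ℝ) * ∑ u : E → α, ∑ v : E → α, |f u - f v| ≤
      ∑ e, ({u | e ∈ R u}.ncard : ℝ) * influence f e := by
  obtain ⟨T, hT, hR⟩ := exists_exploration R
  have h1 : ∀ u v, f (hybrid (T.rev u) u v) = f u := fun u v =>
    hf (T.rev u) u _ (fun e he => by simp [hybrid, he]) (hR u).2
  have h2 := T.osss f hT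
  simp only [h1] at h2
  refine h2.trans (Finset.sum_le_sum fun e _ => mul_le_mul_of_nonneg_right ?_
    (influence_nonneg f e))
  rw [Finset.sum_boole, Set.ncard_eq_toFinset_card']
  refine Nat.cast_le.2 (Finset.card_le_card fun u hu => ?_)
  simp only [Finset.mem_filter, Finset.mem_univ, true_and] at hu
  simpa using (hR u).1 e hu

/-- The influence on an event, in terms of configurations outside the event. -/
theorem influence_indicator_le (A : Set (E → α)) (e : E) :
    influence (A.indicator 1) e ≤
      2 * Fintype.card α * {v | v ∉ A ∧ ∃ a, Function.update v e a ∈ A}.ncard := by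
  classical
  set B := {v | v ∉ A ∧ ∃ a, Function.update v e a ∈ A}
  let k : (E → α) → (E → α) → ℝ := fun v w => if v ∉ A ∧ w ∈ A then 1 else 0
  have h0 : ∀ v w, |A.indicator (1 : (E → α) → ℝ) w - A.indicator 1 v| = k v w + k w v := by
    intro v w
    by_cases hv : v ∈ A <;> by_cases hw : w ∈ A <;> simp [k, hv, hw]
  -- Entering and leaving `A` are exchanged by the involution, so it suffices to count entries,
  -- twice.
  have h1 : ∑ v : E → α, ∑ a, k (Function.update v e a) v =
      ∑ v : E → α, ∑ a, k v (Function.update v e a) := by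
    have := sum_update_involution e fun (v : E → α) (a : α) => k v (Function.update v e a)
    simpa using this
  have h2 : ∑ v : E → α, ∑ a, k v (Function.update v e a) ≤ Fintype.card α * B.ncard := by
    rw [Set.ncard_eq_toFinset_card', mul_comm, ← nsmul_eq_mul, ← Finset.sum_const,
      ← Finset.sum_subset (Finset.subset_univ B.toFinset)]
    · refine Finset.sum_le_sum fun v _ => ?_
      rw [← Finset.card_univ, ← mul_one ((Finset.univ : Finset α).card : ℝ), ← nsmul_eq_mul]
      refine Finset.sum_le_card_nsmul _ _ _ fun a _ => ?_
      simp only [k]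
      split_ifs <;> norm_num
    · intro v _ hv
      refine Finset.sum_eq_zero fun a _ => ?_
      rw [Set.mem_toFinset] at hv
      simp only [k, ite_eq_right_iff, one_ne_zero, imp_false]
      exact fun h => hv ⟨h.1, a, h.2⟩
  calc influence (A.indicator 1) e
      = ∑ v : E → α, ∑ a, (k v (Function.update v e a) + k (Function.update v e a) v) := by
        simp only [influence, h0]
    _ = 2 * ∑ v : E → α, ∑ a, k v (Function.update v e a) := by
        simp only [Finset.sum_add_distrib, h1]; ring
    _ ≤ _ := by rw [mul_assoc]; gcongr

/-- Resampling the coordinates in `Q`: an event `A` that depends on `Q` only, and an event `B` from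
which `G` is reached by setting the coordinates in `Q` according to the pattern `t`. -/
theorem ncard_resample (Q : Finset E) (t : E → Set α) (A B G : Set (E → α))
    (hA : ∀ u v, (∀ e ∈ Q, u e = v e) → u ∈ A → v ∈ A)
    (hB : ∀ u ∈ B, ∀ v, (∀ e ∉ Q, v e = u e) → (∀ e ∈ Q, v e ∈ t e) → v ∈ G) :
    (A ∩ B).ncard * {v : E → α | ∀ e ∈ Q, v e ∈ t e}.ncard ≤ A.ncard * G.ncard := by
  rw [← Set.ncard_prod, ← Set.ncard_prod]
  -- Exchange `u` and `v` off `Q`: the first component keeps `u` on `Q` and stays in `A`, the second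
  -- has the pattern `v` on `Q` and `u` elsewhere, so it is in `G`.
  refine Set.ncard_le_ncard_of_injOn (fun p => (hybrid Q p.1 p.2, hybrid Q p.2 p.1)) ?_ ?_
    (Set.toFinite _)
  · rintro ⟨u, v⟩ ⟨⟨huA, huB⟩, hv⟩
    refine ⟨hA u _ (fun e he => by simp [hybrid, he]) huA, hB u huB _ (fun e he => ?_)
      fun e he => ?_⟩
    · simp [hybrid, he]
    · simpa [hybrid, he] using hv e he
  · rintro ⟨u, v⟩ - ⟨u', v'⟩ - h
    simp only [Prod.mk.injEq] at h
    have h1 : ∀ e, u e = u' e ∧ v e = v' e := by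
      intro e
      have ha := congrFun h.1 e
      have hb := congrFun h.2 e
      by_cases he : e ∈ Q
      · simp only [hybrid, he, if_true] at ha hb; exact ⟨ha, hb⟩
      · simp only [hybrid, he, if_false] at ha hb; exact ⟨hb, ha⟩
    exact Prod.ext (funext fun e => (h1 e).1) (funext fun e => (h1 e).2)

theorem ncard_pattern (Q : Finset E) (t : E → Set α) :
    ({v : E → α | ∀ e ∈ Q, v e ∈ t e}.ncard : ℝ) =
      (∏ e ∈ Q, ((t e).ncard : ℝ) / Fintype.card α) * Fintype.card (E → α) := by
  classical
  have h1 : {v : E → α | ∀ e ∈ Q, v e ∈ t e} =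
      Set.pi Set.univ fun e => if e ∈ Q then t e else Set.univ := by
    ext v
    simp only [Set.mem_ofPred_eq, Set.mem_pi, Set.mem_univ, true_imp_iff]
    refine forall_congr' fun e => ?_
    by_cases he : e ∈ Q <;> simp [he]
  rw [h1]
  by_cases hα : Nonempty α
  · have hα' : (Fintype.card α : ℝ) ≠ 0 := by
      exact_mod_cast (Fintype.card_pos (α := α)).ne'
    have h2 : (Set.pi Set.univ fun e => if e ∈ Q then t e else Set.univ) =
        ((Fintype.piFinset fun e => (if e ∈ Q then t e else Set.univ).toFinset :
          Finset (E → α)) : Set (E → α)) := by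
      ext v; simp [Set.mem_pi]
    rw [h2, Set.ncard_coe_finset, Fintype.card_piFinset, Fintype.card_fun]
    push_cast
    rw [← Finset.prod_mul_prod_compl Q, ← Finset.card_add_card_compl Q, pow_add,
      Finset.prod_div_distrib, Finset.prod_const]
    have h3 : ∀ e ∈ Q, (((if e ∈ Q then t e else Set.univ).toFinset.card : ℕ) : ℝ) =
        (t e).ncard := by
      intro e he
      rw [Set.ncard_eq_toFinset_card']
      simp [he]
    have h4 : ∀ e ∈ Qᶜ, (((if e ∈ Q then t e else Set.univ).toFinset.card : ℕ) : ℝ) =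
        Fintype.card α := by
      intro e he
      have : e ∉ Q := by simpa using he
      simp [this]
    rw [Finset.prod_congr rfl h3, Finset.prod_congr rfl h4, Finset.prod_const]
    field_simp
  · have hemp : IsEmpty α := not_nonempty_iff.1 hα
    by_cases hE : Nonempty E
    · have : IsEmpty (E → α) := by
        obtain ⟨e⟩ := hE
        exact ⟨fun f => hemp.elim (f e)⟩
      simp [Set.eq_empty_of_isEmpty]
    · have : IsEmpty E := not_nonempty_iff.1 hE
      have hQ : Q = ∅ := Finset.eq_empty_of_isEmpty Q
      subst hQ
      simp

end OSSS

/-! ### Chains of adjacent edges -/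

section Chains

variable {V E : Type*} (ends : E → Sym2 V)

/-- The edges share a vertex. -/
def Adjacent (e f : E) : Prop := ∃ x, x ∈ ends e ∧ x ∈ ends f

variable {ends}

theorem Adjacent.symm {e f : E} (h : Adjacent ends e f) : Adjacent ends f e := by
  obtain ⟨x, h1, h2⟩ := h
  exact ⟨x, h2, h1⟩

theorem Adjacent.refl (e : E) : Adjacent ends e e :=
  ⟨_, Sym2.out_fst_mem _, Sym2.out_fst_mem _⟩

theorem reach_of_isChain {e : E} {l : List E} (h : (e :: l).IsChain (Adjacent ends)) {x y : V}
    (hx : x ∈ ends e) (hy : y ∈ verts ends {f | f ∈ e :: l}) :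
    Reach ends {f | f ∈ e :: l} x y := by
  induction l generalizing e x with
  | nil =>
    obtain ⟨f, hf, hyf⟩ := hy
    obtain rfl : f = e := by simpa using hf
    exact .of_mem hf hx hyf
  | cons f l ih =>
    obtain ⟨⟨z, hz, hz'⟩, hc⟩ := List.isChain_cons_cons.1 h
    obtain ⟨g, hg, hyg⟩ := hy
    rcases List.mem_cons.1 hg with rfl | hg'
    · exact .of_mem hg hx hyg
    · have h1 : Reach ends {f' | f' ∈ e :: f :: l} x z :=
        .of_mem (e := e) (List.mem_cons_self) hx hz
      exact h1.trans ((ih hc hz' ⟨g, hg', hyg⟩).mono fun f' hf' => List.mem_cons_of_mem _ hf')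

variable (ends) [Fintype E]

open scoped Classical in
/-- The edges adjacent to `e`. -/
def nbrs (e : E) : Finset E := Finset.univ.filter (Adjacent ends e)

variable {ends}

theorem mem_nbrs {e f : E} : f ∈ nbrs ends e ↔ Adjacent ends e f := by simp [nbrs]

theorem card_nbrs_le {Δ : ℕ} (hΔ : ∀ x, {e | x ∈ ends e}.ncard ≤ Δ) (e : E) :
    (nbrs ends e).card ≤ 2 * Δ := by
  classical
  obtain ⟨x, y, hxy⟩ : ∃ x y, ends e = s(x, y) := by
    induction h : ends e with
    | _ x y => exact ⟨x, y, rfl⟩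
  have h1 : (nbrs ends e : Set E) ⊆ {f | x ∈ ends f} ∪ {f | y ∈ ends f} := by
    intro f hf
    obtain ⟨z, hz, hzf⟩ := mem_nbrs.1 hf
    rw [hxy] at hz
    rcases Sym2.mem_iff.1 hz with rfl | rfl
    · exact Or.inl hzf
    · exact Or.inr hzf
  have h2 := (Set.ncard_le_ncard h1 (Set.toFinite _)).trans (Set.ncard_union_le _ _)
  rw [Set.ncard_coe_finset] at h2
  have := hΔ x
  have := hΔ y
  omega

variable (ends)

/-- The sum of `Φ` over the lists of `m` edges which, preceded by `e`, form a chain of adjacent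
edges. -/
def chainSum : ℕ → E → (List E → ℝ) → ℝ
  | 0, _, Φ => Φ []
  | m + 1, e, Φ => ∑ f ∈ nbrs ends e, chainSum m f fun l => Φ (f :: l)

variable {ends}

theorem chainSum_nonneg (m : ℕ) (e : E) {Φ : List E → ℝ} (h : ∀ l, 0 ≤ Φ l) :
    0 ≤ chainSum ends m e Φ := by
  induction m generalizing e Φ with
  | zero => exact h _
  | succ m ih => exact Finset.sum_nonneg fun f _ => ih f fun l => h _

theorem le_chainSum {e : E} {l : List E} (hl : (e :: l).IsChain (Adjacent ends)) {Φ : List E → ℝ}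
    (h : ∀ l, 0 ≤ Φ l) : Φ l ≤ chainSum ends l.length e Φ := by
  induction l generalizing e Φ with
  | nil => exact le_rfl
  | cons f l ih =>
    obtain ⟨h1, h2⟩ := List.isChain_cons_cons.1 hl
    refine (ih h2 (Φ := fun l => Φ (f :: l)) fun l => h _).trans ?_
    exact Finset.single_le_sum (f := fun f => chainSum ends l.length f fun l => Φ (f :: l))
      (fun f _ => chainSum_nonneg _ _ fun l => h _) (mem_nbrs.2 h1)

theorem chainSum_mono {m : ℕ} {e : E} {Φ Ψ : List E → ℝ} (h : ∀ l, l.length = m → Φ l ≤ Ψ l) :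
    chainSum ends m e Φ ≤ chainSum ends m e Ψ := by
  induction m generalizing e Φ Ψ with
  | zero => exact h _ rfl
  | succ m ih => exact Finset.sum_le_sum fun f _ => ih fun l hl => h _ (by simp [hl])

theorem chainSum_mul (m : ℕ) (e : E) (c : ℝ) (Φ : List E → ℝ) :
    chainSum ends m e (fun l => c * Φ l) = c * chainSum ends m e Φ := by
  induction m generalizing e Φ with
  | zero => rfl
  | succ m ih => simp only [chainSum, ih, Finset.mul_sum]

theorem chainSum_add (m : ℕ) (e : E) (Φ Ψ : List E → ℝ) :
    chainSum ends m e (fun l => Φ l + Ψ l) = chainSum ends m e Φ + chainSum ends m e Ψ := by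
  induction m generalizing e Φ Ψ with
  | zero => rfl
  | succ m ih => simp only [chainSum, ih, Finset.sum_add_distrib]

theorem chainSum_sum {ι : Type*} (s : Finset ι) (m : ℕ) (e : E) (Φ : ι → List E → ℝ) :
    chainSum ends m e (fun l => ∑ i ∈ s, Φ i l) = ∑ i ∈ s, chainSum ends m e (Φ i) := by
  induction m generalizing e Φ with
  | zero => rfl
  | succ m ih =>
    simp only [chainSum, ih]
    exact Finset.sum_comm

theorem chainSum_const_le {D : ℕ} (hD : ∀ e, (nbrs ends e).card ≤ D) (m : ℕ) (e : E) {c : ℝ}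
    (hc : 0 ≤ c) : chainSum ends m e (fun _ => c) ≤ (D : ℝ) ^ m * c := by
  induction m generalizing e with
  | zero => simp [chainSum]
  | succ m ih =>
    refine (Finset.sum_le_card_nsmul _ _ _ fun f _ => ih f).trans ?_
    rw [nsmul_eq_mul, pow_succ]
    have : ((nbrs ends e).card : ℝ) ≤ D := by exact_mod_cast hD e
    have h0 : (0 : ℝ) ≤ (D : ℝ) ^ m * c := by positivity
    nlinarith

/-- The edge at a given position of a chain of `m + 1` edges determines the chain up to at most `D ^
m` choices, and there are `m + 1` positions. -/
theorem sum_chainSum_le {D : ℕ} (hD : ∀ e, (nbrs ends e).card ≤ D) (m : ℕ) {φ : E → ℝ}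
    (hφ : ∀ e, 0 ≤ φ e) :
    ∑ e, chainSum ends m e (fun l => ((e :: l).map φ).sum) ≤ (m + 1) * (D : ℝ) ^ m * ∑ e, φ e := by
  induction m with
  | zero => simp [chainSum]
  | succ m ih =>
    simp only [List.map_cons, List.sum_cons, chainSum_add]
    rw [Finset.sum_add_distrib]
    have h1 : ∑ e, chainSum ends (m + 1) e (fun _ => φ e) ≤ (D : ℝ) ^ (m + 1) * ∑ e, φ e := by
      rw [Finset.mul_sum]
      exact Finset.sum_le_sum fun e _ => chainSum_const_le hD _ _ (hφ e)
    have h2 : ∑ e, chainSum ends (m + 1) e (fun l => (l.map φ).sum) ≤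
        D * ∑ e, chainSum ends m e (fun l => ((e :: l).map φ).sum) := by
      simp only [chainSum]
      have h3 : ∀ e f : E, f ∈ nbrs ends e ↔ e ∈ nbrs ends f := fun e f => by
        rw [mem_nbrs, mem_nbrs]; exact ⟨Adjacent.symm, Adjacent.symm⟩
      rw [Finset.sum_comm' (t' := Finset.univ) (s' := fun f => nbrs ends f)
        (h := fun e f => by simp [h3 e f]), Finset.mul_sum]
      refine Finset.sum_le_sum fun f _ => ?_
      rw [Finset.sum_const, nsmul_eq_mul]
      refine mul_le_mul_of_nonneg_right (by exact_mod_cast hD f) (chainSum_nonneg _ _ fun l => ?_)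
      exact List.sum_nonneg fun x hx => by
        obtain ⟨g, -, rfl⟩ := List.mem_map.1 hx
        exact hφ g
    have h4 : (D : ℝ) * ∑ e, chainSum ends m e (fun l => ((e :: l).map φ).sum) ≤
        D * ((m + 1) * (D : ℝ) ^ m * ∑ e, φ e) := mul_le_mul_of_nonneg_left ih (by positivity)
    push_cast
    calc _ ≤ (D : ℝ) ^ (m + 1) * ∑ e, φ e + D * ((m + 1) * (D : ℝ) ^ m * ∑ e, φ e) := by linarith
      _ = _ := by ring

/-- The union bound over chains. -/
theorem ncard_le_chainSum {Ω : Type*} [Finite Ω] (e : E) (n : ℕ) (A : Set Ω) (B : List E → Set Ω)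
    (h : ∀ u ∈ A, ∃ l : List E, l.length < n ∧ (e :: l).IsChain (Adjacent ends) ∧ u ∈ B l) :
    (A.ncard : ℝ) ≤ ∑ m ∈ Finset.range n, chainSum ends m e fun l => ((B l).ncard : ℝ) := by
  classical
  have := Fintype.ofFinite Ω
  have hcard : ∀ C : Set Ω, (C.ncard : ℝ) = ∑ u, if u ∈ C then (1 : ℝ) else 0 := by
    intro C
    rw [Finset.sum_boole, Set.ncard_eq_toFinset_card']
    simp
  simp only [hcard, chainSum_sum]
  rw [Finset.sum_comm]
  refine Finset.sum_le_sum fun u _ => ?_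
  have hnn : ∀ l, (0 : ℝ) ≤ if u ∈ B l then (1 : ℝ) else 0 := fun l => by split_ifs <;> norm_num
  by_cases hu : u ∈ A
  · obtain ⟨l, hl, hc, hB⟩ := h u hu
    refine le_trans ?_ (Finset.single_le_sum
      (f := fun m => chainSum ends m e fun l => if u ∈ B l then (1 : ℝ) else 0)
      (fun m _ => chainSum_nonneg _ _ hnn) (Finset.mem_range.2 hl))
    refine le_trans ?_ (le_chainSum hc hnn)
    simp [hu, hB]
  · simp only [hu, if_false]
    exact Finset.sum_nonneg fun m _ => chainSum_nonneg _ _ hnn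

end Chains

/-! ### The probability of an increasing chain -/

section Increasing

variable {E : Type*} [LinearOrder E] {M : ℕ}

/-- The attempts of the edges in the list come in increasing order. -/
def increasing (M : ℕ) (l : List E) : Set (E → Fin M) := {u | l.IsChain (Lt u)}

theorem increasing_pairwise {l : List E} {u : E → Fin M} (h : u ∈ increasing M l) :
    l.Pairwise (Lt u) :=
  letI : IsTrans E (Lt u) := ⟨fun _ _ _ => Lt.trans⟩
  List.isChain_iff_pairwise.1 h

theorem increasing_nodup {l : List E} {u : E → Fin M} (h : u ∈ increasing M l) : l.Nodup :=
  (increasing_pairwise h).imp fun h => h.ne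

theorem increasing_congr {l : List E} {u v : E → Fin M} (huv : ∀ e ∈ l, u e = v e)
    (h : u ∈ increasing M l) : v ∈ increasing M l :=
  List.IsChain.imp_of_mem_imp (fun a b ha hb hab => (lt_congr (huv a ha) (huv b hb)).1 hab) h

variable [Fintype E]

theorem increasing_length_le {l : List E} {u : E → Fin M} (h : u ∈ increasing M l) :
    l.length ≤ Fintype.card E := (increasing_nodup h).length_le_card

/-- Along the list the labels are only weakly increasing, because of ties. Adding `i` to the `i`-th
label makes them strictly increasing, so they are encoded by a subset of `Fin (M + m)` with `m`
elements. The hypothesis `m ≤ M` turns `M + m` into `2 * M`. -/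
theorem ncard_increasing_le (l : List E) (hM : l.length ≤ M) :
    ((increasing M l).ncard : ℝ) ≤
      2 ^ l.length / (l.length.factorial : ℝ) * Fintype.card (E → Fin M) := by
  by_cases hne : (increasing M l).Nonempty
  swap
  · rw [Set.not_nonempty_iff_eq_empty.1 hne, Set.ncard_empty]
    push_cast
    positivity
  obtain ⟨u₀, hu₀⟩ := hne
  have hnd := increasing_nodup hu₀
  set m := l.length with hm
  let s : (E → Fin M) → Fin m → Fin (M + m) := fun u i => ⟨u l[i] + i, by
    have := (u l[i]).2
    have := i.2
    omega⟩
  have hs : ∀ u ∈ increasing M l, StrictMono (s u) := by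
    intro u hu i k hik
    have h1 := List.pairwise_iff_getElem.1 (increasing_pairwise hu) i k i.2 k.2 hik
    have h2 := Fin.le_def.1 h1.le
    have h3 := Fin.lt_def.1 hik
    rw [Fin.lt_def]
    change (u l[i] : ℕ) + i < u l[k] + k
    have : (u l[(i : ℕ)] : ℕ) ≤ u l[(k : ℕ)] := h2
    exact Nat.add_lt_add_of_le_of_lt this h3
  let φ : increasing M l → ({e // e ∉ l} → Fin M) × {t : Finset (Fin (M + m)) // t.card = m} :=
    fun u => (fun e => u.1 e, ⟨Finset.univ.image (s u.1), by
      rw [Finset.card_image_of_injective _ (hs u.1 u.2).injective]; simp⟩)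
  have hφ : Function.Injective φ := by
    rintro ⟨u, hu⟩ ⟨v, hv⟩ h
    simp only [φ, Prod.mk.injEq, Subtype.mk.injEq] at h
    have h1 : s u = s v := by
      refine ((hs u hu).range_inj (hs v hv)).1 ?_
      have := congrArg (fun t : Finset (Fin (M + m)) => (t : Set (Fin (M + m)))) h.2
      simpa using this
    refine Subtype.ext (funext fun e => ?_)
    by_cases he : e ∈ l
    · obtain ⟨i, hi, rfl⟩ := List.getElem_of_mem he
      have := congrArg Fin.val (congrFun h1 ⟨i, hi⟩)
      change (u l[i] : ℕ) + i = v l[i] + i at this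
      exact Fin.ext (Nat.add_right_cancel this)
    · exact congrFun h.1 ⟨e, he⟩
  have hcard := Nat.card_le_card_of_injective φ hφ
  rw [Nat.card_coe_set_eq, Nat.card_prod, Nat.card_eq_fintype_card, Nat.card_eq_fintype_card,
    Fintype.card_finset_len, Fintype.card_fun, Fintype.card_fin, Fintype.card_fin] at hcard
  have hcompl : Fintype.card {e // e ∉ l} + m = Fintype.card E := by
    rw [hm, ← List.toFinset_card_of_nodup hnd]
    have := Fintype.card_subtype_compl (fun e => e ∈ l)
    have h2 : Fintype.card {e // e ∈ l} = l.toFinset.card := by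
      rw [Fintype.card_subtype]; congr 1; ext; simp
    have h3 := Finset.card_le_univ l.toFinset
    omega
  have hchoose : ((M + m).choose m : ℝ) ≤ (2 * M) ^ m / m.factorial := by
    refine (Nat.choose_le_pow_div m (M + m)).trans ?_
    gcongr
    push_cast
    have : (m : ℝ) ≤ M := by exact_mod_cast hM
    linarith
  calc ((increasing M l).ncard : ℝ)
      ≤ (M : ℝ) ^ Fintype.card {e // e ∉ l} * (M + m).choose m := by exact_mod_cast hcard
    _ ≤ (M : ℝ) ^ Fintype.card {e // e ∉ l} * ((2 * M) ^ m / m.factorial) := by gcongr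
    _ = _ := by
      rw [Fintype.card_fun, Fintype.card_fin, ← hcompl]
      push_cast
      ring

/-- The factorial beats any geometric rate: `z ^ m / m! ≤ exp z` at `z = 2 * Y ^ 2`, with `Y` free.
The exponent is twice the length so that one chain can pay for another that is no longer than it. -/
theorem ncard_increasing_le_exp (l : List E) (hM : Fintype.card E ≤ M) {Y : ℝ} (hY : 0 < Y) :
    ((increasing M l).ncard : ℝ) ≤
      Real.exp (2 * Y ^ 2) * (1 / Y) ^ (2 * l.length) * Fintype.card (E → Fin M) := by
  by_cases hl : l.length ≤ Fintype.card E
  · refine (ncard_increasing_le l (hl.trans hM)).trans ?_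
    gcongr
    have h1 := Real.pow_div_factorial_le_exp (2 * Y ^ 2) (by positivity) l.length
    calc (2 : ℝ) ^ l.length / (l.length.factorial : ℝ)
        = (2 * Y ^ 2) ^ l.length / (l.length.factorial : ℝ) * (1 / Y) ^ (2 * l.length) := by
          rw [mul_pow, one_div, inv_pow, ← pow_mul]
          field_simp
      _ ≤ _ := by gcongr
  · have : increasing M l = ∅ := by
      by_contra h
      obtain ⟨u, hu⟩ := Set.nonempty_iff_ne_empty.2 h
      exact hl (increasing_length_le hu)
    rw [this, Set.ncard_empty]
    push_cast
    positivity

end Increasing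

/-! ### Local modifications near a set of edges -/

section Modification

variable {V E : Type*} [Fintype E] [LinearOrder E] {M : ℕ} (ends : E → Sym2 V) (κ : ℕ)

/-- The edges within distance two of `K`. -/
def near (K : Finset E) : Finset E := (K.biUnion (nbrs ends)).biUnion (nbrs ends)

variable {ends κ}

theorem mem_near {K : Finset E} {e : E} :
    e ∈ near ends K ↔ ∃ f, (∃ k ∈ K, Adjacent ends k f) ∧ Adjacent ends f e := by
  simp [near, mem_nbrs]

theorem subset_near (K : Finset E) : K ⊆ near ends K := fun e he =>
  mem_near.2 ⟨e, ⟨e, he, .refl e⟩, .refl e⟩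

theorem mem_near_of_mem_verts {K : Finset E} {e : E} {x : V} (hx : x ∈ ends e)
    (hK : x ∈ verts ends (K : Set E)) : e ∈ near ends K := by
  obtain ⟨k, hk, hxk⟩ := hK
  exact mem_near.2 ⟨e, ⟨k, hk, x, hxk, hx⟩, .refl e⟩

theorem card_near_le {D : ℕ} (hD : ∀ e, (nbrs ends e).card ≤ D) (K : Finset E) :
    (near ends K).card ≤ K.card * D ^ 2 := by
  refine (Finset.card_biUnion_le_card_mul _ _ D fun e _ => hD e).trans ?_
  refine (Nat.mul_le_mul_right D (Finset.card_biUnion_le_card_mul _ _ D fun e _ => hD e)).trans ?_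
  rw [pow_two, mul_assoc]

/-- All open edges touching `K` are removed except those in `kept`, and `π` is opened inside `K`. In
`openSet_modification`, `W` is taken one layer beyond the vertices of `K`: then every removed or
added edge has both ends in `W`, and the edges meeting `W` are those of `near ends K`. -/
theorem openSet_local_modification {j : ℕ} {K : Finset E} {u u' : E → Fin M} {kept π : Set E}
    (hkept : kept ⊆ openSet ends κ j u) (hπ : π ⊆ K)
    (hdeg : ∀ x ∈ verts ends (K : Set E), deg ends (kept ∪ π) x ≤ κ)
    (hsame : ∀ e, (e ∉ near ends K ∨
      e ∈ avoiding ends (openSet ends κ j u) (verts ends K) ∪ kept) → u' e = u e)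
    (hnew : ∀ e ∈ near ends K, e ∉ avoiding ends (openSet ends κ j u) (verts ends K) ∪ kept →
      ((u' e : ℕ) < j ↔ e ∈ π)) :
    openSet ends κ j u' = avoiding ends (openSet ends κ j u) (verts ends K) ∪ kept ∪ π := by
  set VK := verts ends (K : Set E) with hVK
  set base := avoiding ends (openSet ends κ j u) VK ∪ kept with hbase
  have hbaseω : base ⊆ openSet ends κ j u := Set.union_subset (avoiding_subset _ _) hkept
  set W : Set V := {x | ∃ f, x ∈ ends f ∧ ∃ k ∈ K, Adjacent ends k f} with hW
  have hVW : ∀ x ∈ VK, x ∈ W := by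
    rintro x ⟨k, hk, hx⟩
    exact ⟨k, hx, k, hk, .refl k⟩
  have hπV : ∀ e ∈ π, ∀ x ∈ ends e, x ∈ VK := fun e he x hx => ⟨e, hπ he, hx⟩
  refine openSet_modification (W := W) (u := u) ?_ ?_ ?_ ?_ ?_
  · intro x _
    by_cases hx : x ∈ VK
    · refine le_trans (Set.ncard_le_ncard ?_ (Set.toFinite _)) (hdeg x hx)
      rintro e ⟨(⟨-, he⟩ | he) | he, hxe⟩
      · exact absurd hx (he x hxe)
      · exact ⟨Or.inl he, hxe⟩
      · exact ⟨Or.inr he, hxe⟩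
    · refine le_trans (Set.ncard_le_ncard ?_ (Set.toFinite _)) (deg_openSet_le (ends := ends) j u x)
      rintro e ⟨he | he, hxe⟩
      · exact ⟨hbaseω he, hxe⟩
      · exact absurd (hπV e he x hxe) hx
  · rintro e ⟨x, hx, f, hxf, k, hk, hkf⟩
    have hnear : e ∈ near ends K := mem_near.2 ⟨f, ⟨k, hk, hkf⟩, x, hxf, hx⟩
    by_cases he : e ∈ base
    · rw [hsame e (Or.inr he)]
      exact ⟨fun _ => Or.inl he, fun _ => (hbaseω he).1⟩
    · rw [hnew e hnear he]
      exact ⟨fun h => Or.inr h, fun h => h.resolve_left he⟩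
  · intro e he
    refine hsame e (Or.inl fun hn => ?_)
    obtain ⟨f, hf, x, hxf, hxe⟩ := mem_near.1 hn
    exact he x hxe ⟨f, hxf, hf⟩
  · rintro e (he | he) x hx hxW
    · exact hsame e (Or.inr he)
    · exact absurd (hVW x (hπV e he x hx)) hxW
  · intro e x hx hxW
    constructor
    · rintro (he | he)
      · exact hbaseω he
      · exact absurd (hVW x (hπV e he x hx)) hxW
    · intro he
      refine Or.inl (Or.inl ⟨he, fun v hv hvK => hxW ?_⟩)
      obtain ⟨k, hk, hvk⟩ := hvK
      exact ⟨e, hx, k, hk, v, hvk, hv⟩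

variable (ends κ) in
/-- The event that `a` is connected to `T` when the labels below `j` have been handled. -/
def cross (M : ℕ) (a : V) (T : Set V) (j : ℕ) : Set (E → Fin M) :=
  {u | ∃ t ∈ T, Reach ends (openSet ends κ j u) a t}

variable (ends κ) in
/-- The edge `g` has label `j`, succeeds and then connects `a` to `T`. -/
def pivotal (M : ℕ) (a : V) (T : Set V) (j : ℕ) (g : E) : Set (E → Fin M) :=
  {u | (u g : ℕ) = j ∧ u ∉ cross ends κ M a T j ∧ Succ ends κ u g ∧
    ∃ t ∈ T, Reach ends (openSet ends κ j u ∪ {g}) a t}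

variable (ends κ) in
/-- `a` and `T` are not connected, but both are connected to `K`. -/
def bridgeable (M : ℕ) (a : V) (T : Set V) (j : ℕ) (K : Finset E) : Set (E → Fin M) :=
  {u | u ∉ cross ends κ M a T j ∧
    (∃ x ∈ verts ends (K : Set E), Reach ends (openSet ends κ j u) a x) ∧
    ∃ y ∈ verts ends (K : Set E), ∃ t ∈ T, Reach ends (openSet ends κ j u) t y}

/-- Labels equal to `j` at `g`, below `j` on the rest of `π` and above `j` elsewhere. -/
def pivotPattern (M j : ℕ) (g : E) (π : Finset E) (e : E) : Set (Fin M) :=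
  {b | (e = g → (b : ℕ) = j) ∧ (e ≠ g → e ∈ π → (b : ℕ) < j) ∧ (e ≠ g → e ∉ π → j < (b : ℕ))}

/-- If `K` is connected, then relabelling edges near `K` creates a pivotal edge in `K`. -/
theorem exists_pivot_modification (hκ : 2 ≤ κ) {a : V} {T : Set V} {j : ℕ} {K : Finset E}
    (hconn : ∀ x ∈ verts ends (K : Set E), ∀ y ∈ verts ends (K : Set E),
      Reach ends (K : Set E) x y)
    {u : E → Fin M} (hu : u ∈ bridgeable ends κ M a T j K) :
    ∃ g ∈ K, ∃ Q ⊆ near ends K, K ⊆ Q ∧ ∃ π ⊆ near ends K, ∀ v : E → Fin M,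
      (∀ e ∉ Q, v e = u e) → (∀ e ∈ Q, v e ∈ pivotPattern M j g π e) →
        v ∈ pivotal ends κ M a T j g := by
  classical
  obtain ⟨hnc, ⟨x₀, hx₀, hax₀⟩, y₀, hy₀, t, ht, hty₀⟩ := hu
  set ω := openSet ends κ j u with hω
  set VK := verts ends (K : Set E) with hVK
  obtain ⟨x, hx, kx, hkxω, hkxs, hkx, hax, hxa⟩ := hax₀.first_hit hx₀
  obtain ⟨y, hy, ky, hkyω, hkys, hky, hty, -⟩ := hty₀.first_hit hy₀
  have haxω : Reach ends ω a x :=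
    hax.mono (Set.union_subset (avoiding_subset _ _) hkxω)
  have htyω : Reach ends ω t y :=
    hty.mono (Set.union_subset (avoiding_subset _ _) hkyω)
  have hxy : x ≠ y := by
    rintro rfl
    exact hnc ⟨t, ht, haxω.trans htyω.symm⟩
  -- The clusters of `a` and `t` enter `K` at `x` and `y`. They are joined by a simple path in `K`,
  -- whose first edge `g`, at `x`, is the only link missing before label `j`.
  obtain ⟨g, hgK, π, hπK, x₁, hgx, hπx, hx₁y, hdy, hd⟩ := (hconn x hx y hy).exists_path hxy
  set kept := kx ∪ ky with hkept
  have hkeptω : kept ⊆ ω := Set.union_subset hkxω hkyω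
  have hkeptK : ∀ e ∈ K, e ∉ kept := by
    rintro e he (h | h)
    · obtain ⟨x', hx', he'⟩ := hkx e h
      exact hx' ⟨e, he, by simp [he']⟩
    · obtain ⟨x', hx', he'⟩ := hky e h
      exact hx' ⟨e, he, by simp [he']⟩
  have hkxdeg : ∀ v ∈ VK, v ≠ x → deg ends kx v = 0 := by
    refine fun v hv hvx => deg_eq_zero fun e he hve => ?_
    obtain ⟨x', hx', he'⟩ := hkx e he
    rw [he', Sym2.mem_iff] at hve
    rcases hve with rfl | rfl
    · exact hx' hv
    · exact hvx rfl
  have hkydeg : ∀ v ∈ VK, v ≠ y → deg ends ky v = 0 := by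
    refine fun v hv hvy => deg_eq_zero fun e he hve => ?_
    obtain ⟨y', hy', he'⟩ := hky e he
    rw [he', Sym2.mem_iff] at hve
    rcases hve with rfl | rfl
    · exact hy' hv
    · exact hvy rfl
  have hdegx : deg ends ({g} ∪ π) x ≤ 1 := by
    refine (deg_union_le _ _ _).trans ?_
    rw [deg_eq_zero hπx]
    exact deg_le_one_of_subsingleton (by simp) _
  -- At `x` and at `y` one entry edge meets one edge of the path; elsewhere the path alone has
  -- degree at most two. With `2 ≤ κ`, the degree constraint then allows this graph.
  have hdegall : ∀ v ∈ VK, deg ends (kept ∪ ({g} ∪ π)) v ≤ 2 := by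
    intro v hv
    have h1 := deg_union_le (ends := ends) kept ({g} ∪ π) v
    have h2 : deg ends kept v ≤ deg ends kx v + deg ends ky v := deg_union_le _ _ v
    have h3 : deg ends kx v ≤ 1 := deg_le_one_of_subsingleton hkxs v
    have h4 : deg ends ky v ≤ 1 := deg_le_one_of_subsingleton hkys v
    have h5 := hd v
    by_cases hvx : v = x
    · subst hvx
      have := hkydeg v hv hxy
      omega
    · have := hkxdeg v hv hvx
      by_cases hvy : v = y
      · subst hvy
        omega
      · have := hkydeg v hv hvy
        omega
  set base := avoiding ends ω VK ∪ kept with hbase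
  have hKbase : ∀ e ∈ K, e ∉ base := by
    rintro e he (h | h)
    · obtain ⟨z, hz⟩ : ∃ z, z ∈ ends e := ⟨_, Sym2.out_fst_mem _⟩
      exact h.2 z hz ⟨e, he, hz⟩
    · exact hkeptK e he h
  -- The edges of `base` keep their labels and all other edges near `K` are resampled. The inclusion
  -- `K ⊆ Q` matters: an event depending on `K` only then depends on `Q` only, as `ncard_resample`
  -- requires.
  refine ⟨g, hgK, (near ends K).filter (· ∉ base), Finset.filter_subset _ _,
    fun e he => Finset.mem_filter.2 ⟨subset_near K he, hKbase e he⟩, K.filter (· ∈ π),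
    (Finset.filter_subset _ _).trans (subset_near K), fun v hv hvQ => ?_⟩
  have hgπ : g ∉ π := fun h => hπx g h (by simp [hgx])
  have hQ : ∀ e ∈ near ends K, e ∉ base → v e ∈ pivotPattern M j g (K.filter (· ∈ π)) e :=
    fun e he he' => hvQ e (Finset.mem_filter.2 ⟨he, he'⟩)
  have hopen : openSet ends κ j v = base ∪ π := by
    refine openSet_local_modification hkeptω hπK ?_ ?_ ?_
    · exact fun z hz => ((deg_mono (Set.union_subset_union_right _ Set.subset_union_right) z).trans
        (hdegall z hz)).trans hκ
    · rintro e he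
      refine hv e fun heQ => ?_
      rw [Finset.mem_filter] at heQ
      rcases he with he | he
      · exact he heQ.1
      · exact heQ.2 he
    · intro e he he'
      obtain ⟨h1, h2, h3⟩ := hQ e he he'
      by_cases heg : e = g
      · subst heg
        simp [h1 rfl, hgπ]
      · by_cases heπ : e ∈ π
        · simp only [heπ, iff_true]
          exact h2 heg (Finset.mem_filter.2 ⟨hπK heπ, heπ⟩)
        · simp only [heπ, iff_false, not_lt]
          exact (h3 heg fun h => heπ (Finset.mem_filter.1 h).2).le
  have hgj : (v g : ℕ) = j := (hQ g (subset_near K hgK) (hKbase g hgK)).1 rfl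
  have hbaseω : base ⊆ ω := Set.union_subset (avoiding_subset _ _) hkeptω
  refine ⟨hgj, ?_, ?_, t, ht, ?_⟩
  · rintro ⟨t', ht', hr⟩
    rw [hopen] at hr
    -- Without `g`, the new cluster of `a` stays in its old cluster and meets `K` at most at `x`: an
    -- edge of `ky` would have joined `a` to `T` before, and `π` avoids `x`.
    have hZ : ∀ z, Reach ends (base ∪ π) a z → Reach ends ω a z ∧ (z ∉ VK ∨ z = x) := by
      intro z hz
      induction hz with
      | refl =>
        refine ⟨.refl, ?_⟩
        by_cases ha : a ∈ VK
        · exact Or.inr (hxa ha).symm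
        · exact Or.inl ha
      | @tail z w _ h ih =>
        obtain ⟨e, he, hzw⟩ := h
        obtain ⟨hz, hz'⟩ := ih
        rcases he with he | he
        · refine ⟨hz.trans (.of_edge (hbaseω he) hzw), ?_⟩
          rcases he with he | he | he
          · exact Or.inl (he.2 w (by simp [hzw]))
          · obtain ⟨x', hx', he'⟩ := hkx e he
            have hw : w ∈ s(x', x) := by rw [← he', hzw]; simp
            rcases Sym2.mem_iff.1 hw with rfl | rfl
            · exact Or.inl hx'
            · exact Or.inr rfl
          · exfalso
            obtain ⟨y', hy', he'⟩ := hky e he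
            refine hnc ⟨t, ht, hz.trans (Reach.trans (y := y) ?_ htyω.symm)⟩
            exact .of_mem (hkyω he) (by simp [hzw]) (by simp [he'])
        · exfalso
          have hzK : z ∈ VK := ⟨e, hπK he, by simp [hzw]⟩
          rcases hz' with h | rfl
          · exact h hzK
          · exact hπx e he (by simp [hzw])
    exact hnc ⟨t', ht', (hZ t' hr).1⟩
  · rw [succ_iff]
    intro z hz
    have hzK : z ∈ VK := ⟨g, hgK, hz⟩
    -- An edge at an end of `g` attempting before `g` has label below `j`: those in `base` had this
    -- already, and near `K` the pattern reserves the label `j` for `g`. So the earlier successes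
    -- lie in `kept ∪ π` and, together with `g`, number at most two.
    have hsub : {f | z ∈ ends f ∧ Lt v f g ∧ Succ ends κ v f} ⊆
        {f | f ∈ kept ∪ ({g} ∪ π) ∧ z ∈ ends f} \ {g} := by
      rintro f ⟨hzf, hlt, hs⟩
      have hfg : f ≠ g := hlt.ne
      have hfj : (v f : ℕ) < j := by
        have hle : (v f : ℕ) ≤ j := hgj ▸ Fin.le_def.1 hlt.le
        by_cases hfb : f ∈ base
        · have : v f = u f := hv f fun h => (Finset.mem_filter.1 h).2 hfb
          rw [this]
          exact (hbaseω hfb).1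
        · obtain ⟨-, h2, h3⟩ := hQ f (mem_near_of_mem_verts hzf hzK) hfb
          by_cases hfπ : f ∈ K.filter (· ∈ π)
          · exact h2 hfg hfπ
          · exact absurd (h3 hfg hfπ) hle.not_gt
      have hf : f ∈ base ∪ π := hopen ▸ (⟨hfj, hs⟩ : f ∈ openSet ends κ j v)
      refine ⟨⟨?_, hzf⟩, hfg⟩
      rcases hf with (hf | hf) | hf
      · exact absurd hzK (hf.2 z hzf)
      · exact Or.inl hf
      · exact Or.inr (Or.inr hf)
    have h1 := Set.ncard_le_ncard hsub (Set.toFinite _)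
    have h2 := Set.ncard_sdiff_singleton_add_one
      (show g ∈ {f | f ∈ kept ∪ ({g} ∪ π) ∧ z ∈ ends f} from ⟨Or.inr (Or.inl rfl), hz⟩)
      (Set.toFinite _)
    have h3 := hdegall z hzK
    unfold deg at h3
    omega
  · rw [hopen]
    have s1 : avoiding ends ω VK ∪ kx ⊆ base ∪ π ∪ {g} := by
      rintro e (he | he)
      · exact Or.inl (Or.inl (Or.inl he))
      · exact Or.inl (Or.inl (Or.inr (Or.inl he)))
    have s2 : avoiding ends ω VK ∪ ky ⊆ base ∪ π ∪ {g} := by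
      rintro e (he | he)
      · exact Or.inl (Or.inl (Or.inl he))
      · exact Or.inl (Or.inl (Or.inr (Or.inr he)))
    refine (hax.mono s1).trans (Reach.trans (.of_edge (e := g) (Or.inr rfl) hgx) ?_)
    exact (hx₁y.mono fun e he => Or.inl (Or.inr he)).trans (hty.mono s2).symm

variable (ends κ) in
/-- The event that the edge `e` has an end-vertex connected to `T` within `E₀`. -/
def touched (M : ℕ) (E₀ : Set E) (T : Set V) (j : ℕ) (e : E) : Set (E → Fin M) :=
  {u | ∃ x ∈ ends e, ∃ t ∈ T, Reach ends (openSet ends κ j u ∩ E₀) t x}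

/-- If an edge of `K` is touched, then it remains so after closing all but one edges around `K`. -/
theorem exists_touched_modification (hκ : 1 ≤ κ) {E₀ : Set E} {T : Set V} {j : ℕ} {K : Finset E}
    {u : E → Fin M} (hu : ∃ k ∈ K, u ∈ touched ends κ M E₀ T j k) :
    ∃ k ∈ K, ∃ Q ⊆ near ends K, K ⊆ Q ∧ ∀ v : E → Fin M,
      (∀ e ∉ Q, v e = u e) → (∀ e ∈ Q, v e ∈ {b : Fin M | j < (b : ℕ)}) →
        v ∈ touched ends κ M E₀ T j k := by
  classical
  obtain ⟨k₀, hk₀, x₀, hx₀, t, ht, hr₀⟩ := hu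
  set ω := openSet ends κ j u with hω
  set VK := verts ends (K : Set E) with hVK
  -- The edge of `K` that remains touched is one at the vertex where the path from `T` first meets
  -- `K`. It need not be `k₀`, which is why a union over `K` appears later.
  obtain ⟨x, ⟨k, hkK, hxk⟩, kept, hkω, hks, hkx, hr, -⟩ := hr₀.first_hit (X := VK) ⟨k₀, hk₀, hx₀⟩
  have hkeptω : kept ⊆ ω := hkω.trans Set.inter_subset_left
  set base := avoiding ends ω VK ∪ kept with hbase
  have hKbase : ∀ e ∈ K, e ∉ base := by
    rintro e he (h | h)
    · obtain ⟨z, hz⟩ : ∃ z, z ∈ ends e := ⟨_, Sym2.out_fst_mem _⟩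
      exact h.2 z hz ⟨e, he, hz⟩
    · obtain ⟨x', hx', he'⟩ := hkx e h
      exact hx' ⟨e, he, by simp [he']⟩
  refine ⟨k, hkK, (near ends K).filter (· ∉ base), Finset.filter_subset _ _,
    fun e he => Finset.mem_filter.2 ⟨subset_near K he, hKbase e he⟩, fun v hv hvQ => ?_⟩
  have hopen : openSet ends κ j v = base ∪ ∅ := by
    refine openSet_local_modification hkeptω (Set.empty_subset _) ?_ ?_ ?_
    · intro z _
      rw [Set.union_empty]
      exact (deg_le_one_of_subsingleton hks z).trans hκ
    · rintro e he
      refine hv e fun heQ => ?_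
      rw [Finset.mem_filter] at heQ
      rcases he with he | he
      · exact he heQ.1
      · exact heQ.2 he
    · intro e he he'
      have : j < (v e : ℕ) := hvQ e (Finset.mem_filter.2 ⟨he, he'⟩)
      simpa using this.le
  refine ⟨x, hxk, t, ht, hr.mono ?_⟩
  rw [hopen, Set.union_empty]
  rintro e (he | he)
  · exact ⟨Or.inl ⟨he.1.1, he.2⟩, he.1.2⟩
  · exact ⟨Or.inr he, (hkω he).2⟩

/-! ### Disagreement -/

/-- If the outcome of `d` changes, so does the contribution of some edge `f` adjacent to `d`. Unless
`f = e`, the order of `f` and `d` is unaffected, so `f` comes earlier and its own outcome changed.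
Going back in time, this ends at `e`. The label of `e` itself has changed, so it is left out of the
increasing part. -/
theorem exists_chain_of_disagreement {e : E} {u u' : E → Fin M} (h : ∀ f, f ≠ e → u f = u' f)
    {d : E} (hde : d ≠ e) (hd : ¬ (Succ ends κ u d ↔ Succ ends κ u' d)) :
    ∃ l : List E, (e :: (l ++ [d])).IsChain (Adjacent ends) ∧
      u' ∈ increasing M (l ++ [d]) := by
  induction d using (lt_wf u').induction with
  | _ d ih =>
  obtain ⟨x, hxd, f, hxf, hf⟩ : ∃ x ∈ ends d, ∃ f, x ∈ ends f ∧
      ¬ ((Lt u f d ∧ Succ ends κ u f) ↔ (Lt u' f d ∧ Succ ends κ u' f)) := by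
    by_contra! hcon
    refine hd ?_
    rw [succ_iff, succ_iff]
    refine forall₂_congr fun x hx => ?_
    have : {f | x ∈ ends f ∧ Lt u f d ∧ Succ ends κ u f} =
        {f | x ∈ ends f ∧ Lt u' f d ∧ Succ ends κ u' f} := by
      ext f
      exact and_congr_right fun hxf => hcon x hx f hxf
    rw [this]
  by_cases hfe : f = e
  · subst hfe
    exact ⟨[], by simpa using ⟨x, hxf, hxd⟩, by simp [increasing]⟩
  · have hlt := lt_congr (h f hfe) (h d hde)
    rw [hlt] at hf
    have hlt' : Lt u' f d := by
      by_contra hn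
      exact hf (by simp [hn])
    obtain ⟨l, hl1, hl2⟩ := ih f hlt' hfe fun hs => hf (by rw [hs])
    refine ⟨l ++ [f], ?_, ?_⟩
    · rw [← List.cons_append]
      refine List.isChain_append.2 ⟨hl1, by simp, ?_⟩
      intro p hp q hq
      rw [← List.cons_append, List.getLast?_concat] at hp
      simp at hp hq
      subst hp hq
      exact ⟨x, hxf, hxd⟩
    · refine List.isChain_append.2 ⟨hl2, by simp, ?_⟩
      intro p hp q hq
      simp at hp hq
      subst hp hq
      exact hlt'

/-- If changing the label of `e` creates a connection, then increasing chains from `e` lead to the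
clusters of `a` and of `T`. -/
theorem exists_chains_of_influence {a : V} {T : Set V} {j : ℕ} {e : E} {v : E → Fin M}
    (hv : v ∉ cross ends κ M a T j) {b : Fin M}
    (hb : Function.update v e b ∈ cross ends κ M a T j) :
    ∃ l₁ l₂ : List E, (e :: l₁).IsChain (Adjacent ends) ∧ (e :: l₂).IsChain (Adjacent ends) ∧
      v ∈ increasing M l₁ ∩ increasing M l₂ ∩
        bridgeable ends κ M a T j (e :: (l₁ ++ l₂)).toFinset := by
  obtain ⟨t, ht, hr⟩ := hb
  have hno : ¬ Reach ends (openSet ends κ j v) a t := fun h => hv ⟨t, ht, h⟩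
  have key : ∀ d, d ∈ openSet ends κ j (Function.update v e b) → d ∉ openSet ends κ j v →
      ∃ l : List E, (e :: l).IsChain (Adjacent ends) ∧ v ∈ increasing M l ∧ d ∈ e :: l := by
    intro d hd hd'
    by_cases hde : d = e
    · exact ⟨[], by simp, by simp [increasing], by simp [hde]⟩
    · have hsame : ∀ f, f ≠ e → Function.update v e b f = v f := fun f hf =>
        Function.update_of_ne hf _ _
      obtain ⟨l, h1, h2⟩ := exists_chain_of_disagreement (ends := ends) (κ := κ) hsame hde
        (fun hs => hd' ⟨hsame d hde ▸ hd.1, hs.1 hd.2⟩)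
      exact ⟨_, h1, h2, by simp⟩
  -- Follow the new path from each of its ends: it leaves the old cluster of `a`, and likewise that
  -- of `t`, through a newly opened edge.
  obtain ⟨x, hax, d₁, hd₁, hd₁', hxd⟩ := hr.exists_disagreement hno
  obtain ⟨y, hty, d₂, hd₂, hd₂', hyd⟩ := hr.symm.exists_disagreement fun h => hno h.symm
  obtain ⟨l₁, hc₁, hi₁, hm₁⟩ := key d₁ hd₁ hd₁'
  obtain ⟨l₂, hc₂, hi₂, hm₂⟩ := key d₂ hd₂ hd₂'
  refine ⟨l₁, l₂, hc₁, hc₂, ⟨hi₁, hi₂⟩, hv, ⟨x, ⟨d₁, ?_, hxd⟩, hax⟩, y, ⟨d₂, ?_, hyd⟩, t, ht, hty⟩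
  · simp only [List.mem_cons] at hm₁
    simp only [List.coe_toFinset, Set.mem_ofPred_eq, List.mem_cons, List.mem_append]
    tauto
  · simp only [List.mem_cons] at hm₂
    simp only [List.coe_toFinset, Set.mem_ofPred_eq, List.mem_cons, List.mem_append]
    tauto

end Modification

theorem chains_connected {V E : Type*} [DecidableEq E] {ends : E → Sym2 V} {e : E}
    {l₁ l₂ : List E} (h₁ : (e :: l₁).IsChain (Adjacent ends))
    (h₂ : (e :: l₂).IsChain (Adjacent ends)) :
    ∀ x ∈ verts ends ((e :: (l₁ ++ l₂)).toFinset : Set E),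
      ∀ y ∈ verts ends ((e :: (l₁ ++ l₂)).toFinset : Set E),
        Reach ends ((e :: (l₁ ++ l₂)).toFinset : Set E) x y := by
  obtain ⟨z, hz⟩ : ∃ z, z ∈ ends e := ⟨_, Sym2.out_fst_mem _⟩
  have key : ∀ x ∈ verts ends ((e :: (l₁ ++ l₂)).toFinset : Set E),
      Reach ends ((e :: (l₁ ++ l₂)).toFinset : Set E) z x := by
    rintro x ⟨f, hf, hxf⟩
    have hf' : f ∈ e :: l₁ ∨ f ∈ e :: l₂ := by
      simp only [List.coe_toFinset, Set.mem_ofPred_eq, List.mem_cons, List.mem_append] at hf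
      simp only [List.mem_cons]
      tauto
    rcases hf' with hf' | hf'
    · refine (reach_of_isChain h₁ hz ⟨f, hf', hxf⟩).mono fun g hg => ?_
      simp only [Set.mem_ofPred_eq, List.mem_cons] at hg
      simp only [List.coe_toFinset, Set.mem_ofPred_eq, List.mem_cons, List.mem_append]
      tauto
    · refine (reach_of_isChain h₂ hz ⟨f, hf', hxf⟩).mono fun g hg => ?_
      simp only [Set.mem_ofPred_eq, List.mem_cons] at hg
      simp only [List.coe_toFinset, Set.mem_ofPred_eq, List.mem_cons, List.mem_append]
      tauto
  exact fun x hx y hy => (key x hx).symm.trans (key y hy)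

/-! ### Counting resampled configurations -/

section Resample

variable {E α : Type*} [DecidableEq E] [Fintype E] [Fintype α]

/-- The resampled set `Q` and the pattern `i` depend on the configuration, so `ncard_resample` is
combined with a union bound over all admissible pairs, which costs `2 ^ S.card * I.card`. -/
theorem ncard_resample_union {ι : Type*} (S K : Finset E) (I : Finset ι) (t : ι → E → Set α)
    {ρ : ℝ}
    (hpat : ∀ Q ⊆ S, K ⊆ Q → ∀ i ∈ I,
      ρ * Fintype.card (E → α) ≤ ({v : E → α | ∀ e ∈ Q, v e ∈ t i e}.ncard : ℝ))
    (A B G : Set (E → α)) (hA : ∀ u v, (∀ e ∈ K, u e = v e) → u ∈ A → v ∈ A)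
    (hB : ∀ u ∈ B, ∃ Q ⊆ S, K ⊆ Q ∧ ∃ i ∈ I, ∀ v, (∀ e ∉ Q, v e = u e) →
      (∀ e ∈ Q, v e ∈ t i e) → v ∈ G) :
    ((A ∩ B).ncard : ℝ) * (ρ * Fintype.card (E → α)) ≤
      2 ^ S.card * I.card * (A.ncard * G.ncard) := by
  classical
  let Bp : Finset E × ι → Set (E → α) := fun p =>
    {u | ∀ v, (∀ e ∉ p.1, v e = u e) → (∀ e ∈ p.1, v e ∈ t p.2 e) → v ∈ G}
  let J := (S.powerset ×ˢ I).filter fun p => K ⊆ p.1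
  have hJ : (J.card : ℝ) ≤ 2 ^ S.card * I.card := by
    have h1 := Finset.card_filter_le (S.powerset ×ˢ I) fun p => K ⊆ p.1
    rw [Finset.card_product, Finset.card_powerset] at h1
    exact_mod_cast h1
  have hsub : A ∩ B ⊆ ⋃ p ∈ J, A ∩ Bp p := by
    rintro u ⟨huA, huB⟩
    obtain ⟨Q, hQS, hKQ, i, hi, h⟩ := hB u huB
    refine Set.mem_iUnion₂.2 ⟨(Q, i), ?_, huA, h⟩
    simp [J, hQS, hi, hKQ]
  have h1 : ((A ∩ B).ncard : ℝ) ≤ ∑ p ∈ J, ((A ∩ Bp p).ncard : ℝ) := by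
    exact_mod_cast (Set.ncard_le_ncard hsub (Set.toFinite _)).trans
      (Finset.set_ncard_biUnion_le J fun p => A ∩ Bp p)
  by_cases hρ : 0 ≤ ρ
  · calc ((A ∩ B).ncard : ℝ) * (ρ * Fintype.card (E → α))
        ≤ (∑ p ∈ J, ((A ∩ Bp p).ncard : ℝ)) * (ρ * Fintype.card (E → α)) := by gcongr
      _ = ∑ p ∈ J, ((A ∩ Bp p).ncard : ℝ) * (ρ * Fintype.card (E → α)) := Finset.sum_mul ..
      _ ≤ ∑ p ∈ J, (A.ncard * G.ncard : ℝ) := by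
          refine Finset.sum_le_sum fun p hp => ?_
          simp only [J, Finset.mem_filter, Finset.mem_product, Finset.mem_powerset] at hp
          refine (mul_le_mul_of_nonneg_left (hpat p.1 hp.1.1 hp.2 p.2 hp.1.2) (by positivity)).trans
            ?_
          exact_mod_cast ncard_resample p.1 (t p.2) A (Bp p) G
            (fun u v h => hA u v fun e he => h e (hp.2 he)) fun u hu => hu
      _ ≤ _ := by
          rw [Finset.sum_const, nsmul_eq_mul]
          gcongr
  · have : ((A ∩ B).ncard : ℝ) * (ρ * Fintype.card (E → α)) ≤ 0 :=
      mul_nonpos_of_nonneg_of_nonpos (by positivity)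
        (mul_nonpos_of_nonpos_of_nonneg (le_of_not_ge hρ) (by positivity))
    exact this.trans (by positivity)

theorem le_ncard_pattern (Q : Finset E) (t : E → Set α) {c : ℝ} (hc : 0 ≤ c)
    (h : ∀ e ∈ Q, c * Fintype.card α ≤ ((t e).ncard : ℝ)) [Nonempty α] :
    c ^ Q.card * Fintype.card (E → α) ≤ ({v : E → α | ∀ e ∈ Q, v e ∈ t e}.ncard : ℝ) := by
  rw [ncard_pattern]
  have hα : (0 : ℝ) < Fintype.card α := by exact_mod_cast Fintype.card_pos
  refine mul_le_mul_of_nonneg_right ?_ (by positivity)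
  rw [← Finset.prod_const]
  exact Finset.prod_le_prod (fun _ _ => hc) fun e he => (le_div_iff₀ hα).2 (h e he)

end Resample

theorem sum_toFinset_le {E : Type*} [DecidableEq E] {φ : E → ℝ} (hφ : ∀ e, 0 ≤ φ e) (l : List E) :
    ∑ e ∈ l.toFinset, φ e ≤ (l.map φ).sum := by
  induction l with
  | nil => simp
  | cons e l ih =>
    rw [List.toFinset_cons, List.map_cons, List.sum_cons]
    by_cases he : e ∈ l.toFinset
    · rw [Finset.insert_eq_of_mem he]
      linarith [hφ e]
    · rw [Finset.sum_insert he]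
      linarith

/-! ### The cost of local modifications -/

section Quantitative

variable {V E : Type*} [Fintype E] [LinearOrder E] {M : ℕ} {ends : E → Sym2 V} {κ : ℕ}

theorem ncard_fin_lt {j : ℕ} (hj : j < M) : {b : Fin M | (b : ℕ) < j}.ncard = j := by
  have : {b : Fin M | (b : ℕ) < j} = (Finset.Iio (⟨j, hj⟩ : Fin M) : Set (Fin M)) := by
    ext b; simp [Fin.lt_def]
  rw [this, Set.ncard_coe_finset, Fin.card_Iio]

theorem ncard_fin_gt {j : ℕ} (hj : j < M) : {b : Fin M | j < (b : ℕ)}.ncard = M - 1 - j := by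
  have : {b : Fin M | j < (b : ℕ)} = (Finset.Ioi (⟨j, hj⟩ : Fin M) : Set (Fin M)) := by
    ext b; simp [Fin.lt_def]
  rw [this, Set.ncard_coe_finset, Fin.card_Ioi]

theorem le_ncard_fin_gt {j : ℕ} {c : ℝ} (hc : 0 < c) (hj : (j : ℝ) + 1 + c * M ≤ M) (hM : 0 < M) :
    c * M ≤ ({b : Fin M | j < (b : ℕ)}.ncard : ℝ) := by
  have hM' : (0 : ℝ) < M := by exact_mod_cast hM
  have hjM' : (j : ℝ) + 1 ≤ M := by nlinarith
  have hjM : j + 1 ≤ M := by exact_mod_cast hjM'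
  rw [ncard_fin_gt (by omega), Nat.sub_sub, Nat.cast_sub (by omega)]
  push_cast
  linarith

/-- The cost per edge of a local modification. -/
def modCost (D : ℕ) (c : ℝ) : ℝ := (4 / c) ^ (D ^ 2)

theorem one_le_modCost {D : ℕ} {c : ℝ} (hc : 0 < c) (hc1 : c ≤ 1) : 1 ≤ modCost D c :=
  one_le_pow₀ ((one_le_div hc).2 (by linarith))

/-- Each edge near `K` costs `4 / c`: a factor 2 for the choice of `Q`, a factor 2 for that of `π`,
and `1 / c` for its label. There are at most `D ^ 2` such edges per edge of `K`. -/
theorem four_div_pow_le {D : ℕ} (hD : ∀ e, (nbrs ends e).card ≤ D) {c : ℝ} (hc : 0 < c)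
    (hc1 : c ≤ 1) (K : Finset E) {n : ℕ} (hn : K.card ≤ n) :
    (4 / c) ^ (near ends K).card ≤ modCost D c ^ n := by
  have h1 : 1 ≤ 4 / c := (one_le_div hc).2 (by linarith)
  rw [modCost, ← pow_mul]
  refine pow_le_pow_right₀ h1 ((card_near_le hD K).trans ?_)
  rw [mul_comm]
  exact Nat.mul_le_mul_left _ hn

/-- Given an event `A` that depends on `K` only, a bridge becomes a pivotal edge at a price
exponential in the size of `K`. The extra factor `M` is the price of giving `g` the single label
`j`. -/
theorem ncard_inter_bridgeable_le (hκ : 2 ≤ κ) {D : ℕ} (hD : ∀ e, (nbrs ends e).card ≤ D) {c : ℝ}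
    (hc : 0 < c) (hc1 : c ≤ 1) {j : ℕ} (hM : 0 < M) (hj0 : c * M ≤ j)
    (hj1 : (j : ℝ) + 1 + c * M ≤ M) {a : V} {T : Set V} {K : Finset E}
    (hconn : ∀ x ∈ verts ends (K : Set E), ∀ y ∈ verts ends (K : Set E),
      Reach ends (K : Set E) x y) {n : ℕ} (hn : K.card ≤ n)
    (A : Set (E → Fin M)) (hA : ∀ u v, (∀ e ∈ K, u e = v e) → u ∈ A → v ∈ A) :
    ((A ∩ bridgeable ends κ M a T j K).ncard : ℝ) * Fintype.card (E → Fin M) ≤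
      modCost D c ^ n * M * (A.ncard * ∑ g ∈ K, ((pivotal ends κ M a T j g).ncard : ℝ)) := by
  classical
  have hMne : Nonempty (Fin M) := ⟨⟨0, hM⟩⟩
  have hM' : (0 : ℝ) < M := by exact_mod_cast hM
  have hjM : j < M := by
    have : (j : ℝ) < M := by nlinarith
    exact_mod_cast this
  set S := near ends K with hS
  let Bg : E → Set (E → Fin M) := fun g => {u | ∃ Q ⊆ S, K ⊆ Q ∧ ∃ π ∈ S.powerset, ∀ v,
    (∀ e ∉ Q, v e = u e) → (∀ e ∈ Q, v e ∈ pivotPattern M j g π e) →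
      v ∈ pivotal ends κ M a T j g}
  have hpat : ∀ g ∈ K, ∀ Q ⊆ S, K ⊆ Q → ∀ π ∈ S.powerset,
      (c ^ S.card / M) * Fintype.card (E → Fin M) ≤
        ({v : E → Fin M | ∀ e ∈ Q, v e ∈ pivotPattern M j g π e}.ncard : ℝ) := by
    intro g hg Q hQ hKQ π _
    rw [ncard_pattern]
    refine mul_le_mul_of_nonneg_right ?_ (by positivity)
    rw [← Finset.mul_prod_erase Q _ (hKQ hg), Fintype.card_fin, mul_comm, div_eq_mul_one_div]
    have h1 : (1 : ℝ) ≤ ((pivotPattern M j g π g).ncard : ℝ) := by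
      have : (⟨j, hjM⟩ : Fin M) ∈ pivotPattern M j g π g := by simp [pivotPattern]
      exact_mod_cast (Set.ncard_pos (Set.toFinite _)).2 ⟨_, this⟩
    have h2 : c ^ S.card ≤ ∏ e ∈ Q.erase g, ((pivotPattern M j g π e).ncard : ℝ) / M := by
      have hle : (Q.erase g).card ≤ S.card := Finset.card_le_card ((Finset.erase_subset _ _).trans hQ)
      refine (pow_le_pow_of_le_one hc.le hc1 hle).trans ?_
      rw [← Finset.prod_const]
      refine Finset.prod_le_prod (fun _ _ => hc.le) fun e he => ?_
      rw [le_div_iff₀ hM']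
      have heg : e ≠ g := (Finset.mem_erase.1 he).1
      by_cases heπ : e ∈ π
      · have : pivotPattern M j g π e = {b : Fin M | (b : ℕ) < j} := by
          ext b; simp [pivotPattern, heg, heπ]
        rw [this, ncard_fin_lt hjM]
        exact hj0
      · have : pivotPattern M j g π e = {b : Fin M | j < (b : ℕ)} := by
          ext b; simp [pivotPattern, heg, heπ]
        rw [this]
        exact le_ncard_fin_gt hc hj1 hM
    refine mul_le_mul h2 (by gcongr) (by positivity) ?_
    exact Finset.prod_nonneg fun _ _ => by positivity
  have hg : ∀ g ∈ K, ((A ∩ Bg g).ncard : ℝ) * Fintype.card (E → Fin M) ≤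
      modCost D c ^ n * M * (A.ncard * (pivotal ends κ M a T j g).ncard) := by
    intro g hg
    have h1 := ncard_resample_union S K S.powerset (pivotPattern M j g) (hpat g hg) A (Bg g)
      (pivotal ends κ M a T j g) hA fun u hu => hu
    rw [Finset.card_powerset] at h1
    push_cast at h1
    have h2 := four_div_pow_le hD hc hc1 K hn
    have hcS : 0 < c ^ S.card := by positivity
    have h3 : (4 / c) ^ S.card = 2 ^ S.card * 2 ^ S.card / c ^ S.card := by
      rw [div_pow, ← mul_pow]; norm_num
    calc ((A ∩ Bg g).ncard : ℝ) * Fintype.card (E → Fin M)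
        = (((A ∩ Bg g).ncard : ℝ) * (c ^ S.card / M * Fintype.card (E → Fin M))) *
          (M / c ^ S.card) := by field_simp
      _ ≤ (2 ^ S.card * 2 ^ S.card * (A.ncard * (pivotal ends κ M a T j g).ncard)) *
          (M / c ^ S.card) := by
          refine mul_le_mul_of_nonneg_right ?_ (by positivity)
          exact_mod_cast h1
      _ = (4 / c) ^ S.card * M * (A.ncard * (pivotal ends κ M a T j g).ncard) := by
          rw [h3]; ring
      _ ≤ _ := by gcongr
  have hsub : A ∩ bridgeable ends κ M a T j K ⊆ ⋃ g ∈ K, A ∩ Bg g := by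
    rintro u ⟨huA, hu⟩
    obtain ⟨g, hgK, Q, hQ, hKQ, π, hπ, h⟩ := exists_pivot_modification hκ hconn hu
    exact Set.mem_iUnion₂.2 ⟨g, hgK, huA, Q, hQ, hKQ, π, Finset.mem_powerset.2 hπ, h⟩
  have h1 : ((A ∩ bridgeable ends κ M a T j K).ncard : ℝ) ≤ ∑ g ∈ K, ((A ∩ Bg g).ncard : ℝ) := by
    exact_mod_cast (Set.ncard_le_ncard hsub (Set.toFinite _)).trans
      (Finset.set_ncard_biUnion_le K fun g => A ∩ Bg g)
  calc _ ≤ (∑ g ∈ K, ((A ∩ Bg g).ncard : ℝ)) * Fintype.card (E → Fin M) := by gcongr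
    _ ≤ ∑ g ∈ K, modCost D c ^ n * M * (A.ncard * (pivotal ends κ M a T j g).ncard) := by
        rw [Finset.sum_mul]
        exact Finset.sum_le_sum hg
    _ = _ := by rw [← Finset.mul_sum, ← Finset.mul_sum]

/-- The counterpart for the revealment; no label is prescribed exactly, so there is no factor `M`.
-/
theorem ncard_inter_touched_le (hκ : 1 ≤ κ) {D : ℕ} (hD : ∀ e, (nbrs ends e).card ≤ D) {c : ℝ}
    (hc : 0 < c) (hc1 : c ≤ 1) {j : ℕ} (hM : 0 < M) (hj1 : (j : ℝ) + 1 + c * M ≤ M)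
    {E₀ : Set E} {T : Set V} {K : Finset E} {n : ℕ} (hn : K.card ≤ n)
    (A : Set (E → Fin M)) (hA : ∀ u v, (∀ e ∈ K, u e = v e) → u ∈ A → v ∈ A) :
    ((A ∩ {u | ∃ k ∈ K, u ∈ touched ends κ M E₀ T j k}).ncard : ℝ) * Fintype.card (E → Fin M) ≤
      modCost D c ^ n * (A.ncard * ∑ k ∈ K, ((touched ends κ M E₀ T j k).ncard : ℝ)) := by
  classical
  have hMne : Nonempty (Fin M) := ⟨⟨0, hM⟩⟩
  set S := near ends K with hS
  let t : Unit → E → Set (Fin M) := fun _ _ => {b : Fin M | j < (b : ℕ)}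
  let Bk : E → Set (E → Fin M) := fun k => {u | ∃ Q ⊆ S, K ⊆ Q ∧ ∃ i ∈ ({()} : Finset Unit), ∀ v,
    (∀ e ∉ Q, v e = u e) → (∀ e ∈ Q, v e ∈ t i e) → v ∈ touched ends κ M E₀ T j k}
  have hpat : ∀ Q ⊆ S, K ⊆ Q → ∀ i ∈ ({()} : Finset Unit),
      c ^ S.card * Fintype.card (E → Fin M) ≤
        ({v : E → Fin M | ∀ e ∈ Q, v e ∈ t i e}.ncard : ℝ) := by
    intro Q hQ _ i _
    refine le_trans ?_ (le_ncard_pattern Q (t i) hc.le fun e _ => ?_)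
    · exact mul_le_mul_of_nonneg_right
        (pow_le_pow_of_le_one hc.le hc1 (Finset.card_le_card hQ)) (by positivity)
    · rw [Fintype.card_fin]
      exact le_ncard_fin_gt hc hj1 hM
  have hk : ∀ k ∈ K, ((A ∩ Bk k).ncard : ℝ) * Fintype.card (E → Fin M) ≤
      modCost D c ^ n * (A.ncard * (touched ends κ M E₀ T j k).ncard) := by
    intro k _
    have h1 := ncard_resample_union S K {()} t hpat A (Bk k)
      (touched ends κ M E₀ T j k) hA fun u hu => hu
    rw [Finset.card_singleton, Nat.cast_one, mul_one] at h1
    have h2 := four_div_pow_le hD hc hc1 K hn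
    have hcS : 0 < c ^ S.card := by positivity
    have h3 : 2 ^ S.card / c ^ S.card ≤ (4 / c) ^ S.card := by
      rw [div_pow]; gcongr; norm_num
    calc ((A ∩ Bk k).ncard : ℝ) * Fintype.card (E → Fin M)
        = (((A ∩ Bk k).ncard : ℝ) * (c ^ S.card * Fintype.card (E → Fin M))) *
          (1 / c ^ S.card) := by field_simp
      _ ≤ (2 ^ S.card * (A.ncard * (touched ends κ M E₀ T j k).ncard)) * (1 / c ^ S.card) :=
          mul_le_mul_of_nonneg_right h1 (by positivity)
      _ = 2 ^ S.card / c ^ S.card * (A.ncard * (touched ends κ M E₀ T j k).ncard) := by ring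
      _ ≤ _ := by gcongr; exact h3.trans h2
  have hsub : A ∩ {u | ∃ k ∈ K, u ∈ touched ends κ M E₀ T j k} ⊆ ⋃ k ∈ K, A ∩ Bk k := by
    rintro u ⟨huA, hu⟩
    obtain ⟨k, hkK, Q, hQ, hKQ, h⟩ := exists_touched_modification hκ hu
    exact Set.mem_iUnion₂.2 ⟨k, hkK, huA, Q, hQ, hKQ, (), by simp, h⟩
  have h1 : ((A ∩ {u | ∃ k ∈ K, u ∈ touched ends κ M E₀ T j k}).ncard : ℝ) ≤
      ∑ k ∈ K, ((A ∩ Bk k).ncard : ℝ) := by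
    exact_mod_cast (Set.ncard_le_ncard hsub (Set.toFinite _)).trans
      (Finset.set_ncard_biUnion_le K fun k => A ∩ Bk k)
  calc _ ≤ (∑ k ∈ K, ((A ∩ Bk k).ncard : ℝ)) * Fintype.card (E → Fin M) := by gcongr
    _ ≤ ∑ k ∈ K, modCost D c ^ n * (A.ncard * (touched ends κ M E₀ T j k).ncard) := by
        rw [Finset.sum_mul]
        exact Finset.sum_le_sum hk
    _ = _ := by rw [← Finset.mul_sum, ← Finset.mul_sum]

end Quantitative

/-! ### Bounds for the influence, the revealment and the discrete derivative -/

section FiniteInequality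

variable {V E : Type*} [Fintype E] [LinearOrder E] {M : ℕ} {ends : E → Sym2 V} {κ : ℕ}

/-- The inverse decay rate of chains used to absorb the cost of modifications. -/
def chainRate (D : ℕ) (c : ℝ) : ℝ := 4 * D * modCost D c

/-- The constant in the bounds for sums over chains. -/
def chainConst (D : ℕ) (c : ℝ) : ℝ := Real.exp (2 * chainRate D c ^ 2) * modCost D c

theorem chainConst_pos {D : ℕ} {c : ℝ} (hc : 0 < c) (hc1 : c ≤ 1) : 0 < chainConst D c :=
  mul_pos (Real.exp_pos _) (zero_lt_one.trans_le (one_le_modCost hc hc1))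

theorem one_le_chainRate {D : ℕ} (hD1 : 1 ≤ D) {c : ℝ} (hc : 0 < c) (hc1 : c ≤ 1) :
    1 ≤ chainRate D c := by
  have h1 := one_le_modCost (D := D) hc hc1
  have h2 : (1 : ℝ) ≤ D := by exact_mod_cast hD1
  unfold chainRate
  nlinarith

theorem sum_half_pow_le (n : ℕ) : ∑ m ∈ Finset.range n, (1 / 2 : ℝ) ^ m ≤ 2 :=
  sum_geometric_two_le n

/-- The total influence is bounded by the probabilities of pivotal edges. -/
theorem sum_influence_le (hκ : 2 ≤ κ) {D : ℕ} (hD1 : 1 ≤ D) (hD : ∀ e, (nbrs ends e).card ≤ D)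
    {c : ℝ} (hc : 0 < c) (hc1 : c ≤ 1) {j : ℕ} (hM : 0 < M) (hEM : Fintype.card E ≤ M)
    (hj0 : c * M ≤ j) (hj1 : (j : ℝ) + 1 + c * M ≤ M) (a : V) (T : Set V) :
    ∑ e, ({v | v ∉ cross ends κ M a T j ∧
        ∃ b, Function.update v e b ∈ cross ends κ M a T j}.ncard : ℝ) ≤
      8 * chainConst D c * M * ∑ g, ((pivotal ends κ M a T j g).ncard : ℝ) := by
  classical
  have hMne : Nonempty (Fin M) := ⟨⟨0, hM⟩⟩
  set X := modCost D c with hX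
  set Y := chainRate D c with hY
  have hX1 : 1 ≤ X := one_le_modCost hc hc1
  have hY1 : 1 ≤ Y := one_le_chainRate hD1 hc hc1
  have hY0 : 0 < Y := by linarith
  have hD0 : (0 : ℝ) < D := by exact_mod_cast hD1
  set N : ℝ := ((Fintype.card (E → Fin M) : ℕ) : ℝ) with hN
  have hN0 : 0 < N := by
    rw [hN]; exact_mod_cast Fintype.card_pos
  set φ : E → ℝ := fun g => ((pivotal ends κ M a T j g).ncard : ℝ) with hφ
  have hφ0 : ∀ g, 0 ≤ φ g := fun g => by positivity
  let Φ : List E → ℝ := fun l => (l.map φ).sum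
  have hΦ0 : ∀ l, 0 ≤ Φ l := fun l => List.sum_nonneg fun x hx => by
    obtain ⟨g, -, rfl⟩ := List.mem_map.1 hx
    exact hφ0 g
  set C₀ := Real.exp (2 * Y ^ 2) with hC₀
  let B₂ : E → List E → List E → Set (E → Fin M) := fun e l₁ l₂ =>
    {u | ((e :: l₁).IsChain (Adjacent ends) ∧ (e :: l₂).IsChain (Adjacent ends)) ∧
      u ∈ increasing M l₁ ∩ increasing M l₂ ∩ bridgeable ends κ M a T j (e :: (l₁ ++ l₂)).toFinset}
  let B₁ : E → List E → Set (E → Fin M) := fun e l₁ =>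
    {u | ∃ l₂, u ∈ B₂ e l₁ l₂}
  let w : ℕ → ℝ := fun m => C₀ * X * M * (X / Y) ^ m
  have hw0 : ∀ m, 0 ≤ w m := fun m => by positivity
  have hB₂ : ∀ e l₁ l₂, ((B₂ e l₁ l₂).ncard : ℝ) ≤
      w (l₁.length + l₂.length) * (Φ (e :: l₁) + Φ (e :: l₂)) := by
    intro e l₁ l₂
    by_cases hch : (e :: l₁).IsChain (Adjacent ends) ∧ (e :: l₂).IsChain (Adjacent ends)
    swap
    · have : B₂ e l₁ l₂ = ∅ := by
        ext u; simp only [B₂, Set.mem_ofPred_eq, Set.mem_empty_iff_false, iff_false]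
        exact fun h => hch h.1
      rw [this, Set.ncard_empty, Nat.cast_zero]
      exact mul_nonneg (hw0 _) (add_nonneg (hΦ0 _) (hΦ0 _))
    have hset : B₂ e l₁ l₂ = increasing M l₁ ∩ increasing M l₂ ∩
        bridgeable ends κ M a T j (e :: (l₁ ++ l₂)).toFinset := by
      ext u; simp only [B₂, Set.mem_ofPred_eq, hch, true_and, and_self]
    set K := (e :: (l₁ ++ l₂)).toFinset with hK
    have hKcard : K.card ≤ l₁.length + l₂.length + 1 := by
      refine (List.toFinset_card_le _).trans ?_
      simp
    have hdep : ∀ u v : E → Fin M, (∀ e ∈ K, u e = v e) →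
        u ∈ increasing M l₁ ∩ increasing M l₂ → v ∈ increasing M l₁ ∩ increasing M l₂ := by
      rintro u v huv ⟨h1, h2⟩
      exact ⟨increasing_congr (fun f hf => huv f (by simp [hK, hf])) h1,
        increasing_congr (fun f hf => huv f (by simp [hK, hf])) h2⟩
    have h1 := ncard_inter_bridgeable_le hκ hD hc hc1 hM hj0 hj1 (a := a) (T := T)
      (chains_connected hch.1 hch.2) hKcard _ hdep
    rw [← hset] at h1
    -- The two chains may share edges, so independence is not available. Only the longer one is
    -- used, and its length counted twice is at least the sum of the lengths.
    have h2 : ((increasing M l₁ ∩ increasing M l₂).ncard : ℝ) ≤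
        C₀ * (1 / Y) ^ (l₁.length + l₂.length) * N := by
      have hle : 1 / Y ≤ 1 := (div_le_one hY0).2 hY1
      rcases le_total l₁.length l₂.length with h | h
      · have h3 : ((increasing M l₁ ∩ increasing M l₂).ncard : ℝ) ≤ (increasing M l₂).ncard := by
          exact_mod_cast Set.ncard_le_ncard Set.inter_subset_right (Set.toFinite _)
        refine (h3.trans (ncard_increasing_le_exp l₂ hEM hY0)).trans ?_
        have := pow_le_pow_of_le_one (by positivity) hle
          (show l₁.length + l₂.length ≤ 2 * l₂.length by omega)
        gcongr
      · have h3 : ((increasing M l₁ ∩ increasing M l₂).ncard : ℝ) ≤ (increasing M l₁).ncard := by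
          exact_mod_cast Set.ncard_le_ncard Set.inter_subset_left (Set.toFinite _)
        refine (h3.trans (ncard_increasing_le_exp l₁ hEM hY0)).trans ?_
        have := pow_le_pow_of_le_one (by positivity) hle
          (show l₁.length + l₂.length ≤ 2 * l₁.length by omega)
        gcongr
    have h3 : ∑ g ∈ K, φ g ≤ Φ (e :: l₁) + Φ (e :: l₂) := by
      refine (sum_toFinset_le hφ0 _).trans ?_
      simp only [Φ, List.map_cons, List.map_append, List.sum_cons, List.sum_append]
      linarith [hφ0 e]
    refine le_of_mul_le_mul_right (h1.trans ?_) hN0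
    calc X ^ (l₁.length + l₂.length + 1) * M *
          (((increasing M l₁ ∩ increasing M l₂).ncard : ℝ) * ∑ g ∈ K, φ g)
        ≤ X ^ (l₁.length + l₂.length + 1) * M *
          ((C₀ * (1 / Y) ^ (l₁.length + l₂.length) * N) * (Φ (e :: l₁) + Φ (e :: l₂))) := by
          gcongr
      _ = _ := by simp only [w]; rw [div_pow, div_pow, one_pow]; ring
  set n := Fintype.card E + 1 with hn
  have he : ∀ e, ({v | v ∉ cross ends κ M a T j ∧
        ∃ b, Function.update v e b ∈ cross ends κ M a T j}.ncard : ℝ) ≤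
      ∑ m₁ ∈ Finset.range n, ∑ m₂ ∈ Finset.range n, w (m₁ + m₂) *
        ((D : ℝ) ^ m₂ * chainSum ends m₁ e (fun l => Φ (e :: l)) +
          (D : ℝ) ^ m₁ * chainSum ends m₂ e (fun l => Φ (e :: l))) := by
    intro e
    have s1 : ({v | v ∉ cross ends κ M a T j ∧
        ∃ b, Function.update v e b ∈ cross ends κ M a T j}.ncard : ℝ) ≤
        ∑ m ∈ Finset.range n, chainSum ends m e fun l => ((B₁ e l).ncard : ℝ) := by
      refine ncard_le_chainSum e n _ (B₁ e) ?_
      rintro v ⟨hv, b, hb⟩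
      obtain ⟨l₁, l₂, h1, h2, h3⟩ := exists_chains_of_influence hv hb
      exact ⟨l₁, Nat.lt_succ_of_le (increasing_length_le h3.1.1), h1, l₂, ⟨h1, h2⟩, h3⟩
    refine s1.trans (Finset.sum_le_sum fun m₁ _ => ?_)
    have s2 : ∀ l₁, ((B₁ e l₁).ncard : ℝ) ≤
        ∑ m ∈ Finset.range n, chainSum ends m e fun l₂ => ((B₂ e l₁ l₂).ncard : ℝ) := by
      refine fun l₁ => ncard_le_chainSum e n _ (B₂ e l₁) ?_
      rintro v ⟨l₂, hv⟩
      exact ⟨l₂, Nat.lt_succ_of_le (increasing_length_le hv.2.1.2), hv.1.2, hv⟩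
    have s3 : ∀ l₁ : List E, l₁.length = m₁ → ((B₁ e l₁).ncard : ℝ) ≤
        ∑ m₂ ∈ Finset.range n, w (m₁ + m₂) * ((D : ℝ) ^ m₂ * Φ (e :: l₁) +
          chainSum ends m₂ e (fun l => Φ (e :: l))) := by
      intro l₁ hl₁
      refine (s2 l₁).trans (Finset.sum_le_sum fun m₂ _ => ?_)
      refine (chainSum_mono (Ψ := fun l₂ => w (m₁ + m₂) * (Φ (e :: l₁) + Φ (e :: l₂)))
        fun l₂ hl₂ => ?_).trans ?_
      · have := hB₂ e l₁ l₂
        rwa [hl₁, hl₂] at this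
      · rw [chainSum_mul, chainSum_add]
        have := chainSum_const_le hD m₂ e (hΦ0 (e :: l₁))
        exact mul_le_mul_of_nonneg_left (by linarith) (hw0 _)
    refine (chainSum_mono s3).trans ?_
    rw [chainSum_sum]
    refine Finset.sum_le_sum fun m₂ _ => ?_
    rw [chainSum_mul, chainSum_add, chainSum_mul]
    have := chainSum_const_le hD m₁ e (c := chainSum ends m₂ e fun l => Φ (e :: l))
      (chainSum_nonneg _ _ fun l => hΦ0 _)
    exact mul_le_mul_of_nonneg_left (by linarith) (hw0 _)
  refine (Finset.sum_le_sum fun e _ => he e).trans ?_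
  rw [Finset.sum_comm]
  simp only [fun m₁ => Finset.sum_comm (s := (Finset.univ : Finset E)) (t := Finset.range n)
    (f := fun e m₂ => w (m₁ + m₂) *
        ((D : ℝ) ^ m₂ * chainSum ends m₁ e (fun l => Φ (e :: l)) +
          (D : ℝ) ^ m₁ * chainSum ends m₂ e (fun l => Φ (e :: l))))]
  have hbound : ∀ m₁ m₂ : ℕ, ∑ e, w (m₁ + m₂) *
        ((D : ℝ) ^ m₂ * chainSum ends m₁ e (fun l => Φ (e :: l)) +
          (D : ℝ) ^ m₁ * chainSum ends m₂ e (fun l => Φ (e :: l))) ≤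
      (2 * (C₀ * X) * M * ∑ g, φ g) * ((1 / 2) ^ m₁ * (1 / 2) ^ m₂) := by
    intro m₁ m₂
    rw [← Finset.mul_sum, Finset.sum_add_distrib, ← Finset.mul_sum, ← Finset.mul_sum]
    have h1 := sum_chainSum_le hD m₁ hφ0
    have h2 := sum_chainSum_le hD m₂ hφ0
    have hs : 0 ≤ ∑ g, φ g := Finset.sum_nonneg fun g _ => hφ0 g
    have hpow : ((m₁ + m₂ + 2 : ℕ) : ℝ) ≤ 2 * 2 ^ (m₁ + m₂) := by
      have : m₁ + m₂ + 2 ≤ 2 * 2 ^ (m₁ + m₂) := by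
        have := Nat.lt_two_pow_self (n := m₁ + m₂)
        omega
      exact_mod_cast this
    push_cast at hpow
    -- `chainRate` is chosen for this: after the cost `X` of the modification and the `D` choices,
    -- each edge of a chain contributes `1 / 4`. One factor `1 / 2` absorbs the linear term in the
    -- lengths and the other makes the series converge.
    have hXY : X / Y = 1 / (4 * D) := by
      rw [hY, chainRate, ← hX]
      field_simp
    calc w (m₁ + m₂) * ((D : ℝ) ^ m₂ * ∑ e, chainSum ends m₁ e (fun l => Φ (e :: l)) +
          (D : ℝ) ^ m₁ * ∑ e, chainSum ends m₂ e (fun l => Φ (e :: l)))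
        ≤ w (m₁ + m₂) * ((D : ℝ) ^ m₂ * ((m₁ + 1) * (D : ℝ) ^ m₁ * ∑ e, φ e) +
          (D : ℝ) ^ m₁ * ((m₂ + 1) * (D : ℝ) ^ m₂ * ∑ e, φ e)) := by
          refine mul_le_mul_of_nonneg_left ?_ (hw0 _)
          gcongr
      _ = w (m₁ + m₂) * (D : ℝ) ^ (m₁ + m₂) * (∑ e, φ e) * (m₁ + m₂ + 2) := by ring
      _ ≤ w (m₁ + m₂) * (D : ℝ) ^ (m₁ + m₂) * (∑ e, φ e) * (2 * 2 ^ (m₁ + m₂)) := by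
          have := hw0 (m₁ + m₂)
          gcongr
      _ = _ := by
          simp only [w]
          rw [hXY, ← pow_add, div_pow, div_pow, mul_pow, show (4 : ℝ) = 2 * 2 by norm_num, mul_pow]
          field_simp
  refine (Finset.sum_le_sum fun m₁ _ => Finset.sum_le_sum fun m₂ _ => hbound m₁ m₂).trans ?_
  simp only [← Finset.mul_sum]
  rw [← Finset.sum_mul]
  have h1 := sum_half_pow_le n
  have h0 : 0 ≤ ∑ m ∈ Finset.range n, (1 / 2 : ℝ) ^ m :=
    Finset.sum_nonneg fun _ _ => by positivity
  have hs : 0 ≤ ∑ g, φ g := Finset.sum_nonneg fun g _ => hφ0 g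
  calc _ ≤ (2 * (C₀ * X) * M * ∑ g, φ g) * (2 * 2) := by gcongr
    _ = _ := by rw [chainConst, ← hX, ← hY]; ring

/-- The edges inspected when exploring the clusters of `T` within `E₀`: those from which a chain,
increasing after its first edge, leads to an edge at these clusters. -/
def explored (ends : E → Sym2 V) (κ M : ℕ) (E₀ : Set E) (T : Set V) (j : ℕ) (u : E → Fin M) :
    Set E :=
  {e | ∃ l : List E, (e :: l).IsChain (Adjacent ends) ∧ u ∈ increasing M l ∧
    u ∈ touched ends κ M E₀ T j ((e :: l).getLast (by simp))}

/-- The bound on the revealment of the exploration. -/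
theorem sum_revealment_le {ι : Type*} (s : Finset ι) (hκ : 1 ≤ κ) {D : ℕ} (hD1 : 1 ≤ D)
    (hD : ∀ e, (nbrs ends e).card ≤ D) {c : ℝ} (hc : 0 < c) (hc1 : c ≤ 1) {j : ℕ} (hM : 0 < M)
    (hEM : Fintype.card E ≤ M) (hj1 : (j : ℝ) + 1 + c * M ≤ M) (E₀ : Set E) (T : ι → Set V)
    {χ : ℝ} (hχ : ∀ e, ∑ i ∈ s, ((touched ends κ M E₀ (T i) j e).ncard : ℝ) ≤
      χ * Fintype.card (E → Fin M)) (e : E) :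
    ∑ i ∈ s, ({u | e ∈ explored ends κ M E₀ (T i) j u}.ncard : ℝ) ≤
      2 * chainConst D c * χ * Fintype.card (E → Fin M) := by
  classical
  have hMne : Nonempty (Fin M) := ⟨⟨0, hM⟩⟩
  set X := modCost D c with hX
  set Y := chainRate D c with hY
  have hX1 : 1 ≤ X := one_le_modCost hc hc1
  have hY1 : 1 ≤ Y := one_le_chainRate hD1 hc hc1
  have hY0 : 0 < Y := by linarith
  have hD0 : (0 : ℝ) < D := by exact_mod_cast hD1
  set N : ℝ := ((Fintype.card (E → Fin M) : ℕ) : ℝ) with hN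
  have hN0 : 0 < N := by
    rw [hN]; exact_mod_cast Fintype.card_pos
  set C₀ := Real.exp (2 * Y ^ 2) with hC₀
  have hχ0 : 0 ≤ χ * N := le_trans (Finset.sum_nonneg fun _ _ => by positivity) (hχ e)
  set n := Fintype.card E + 1 with hn
  let B : ι → List E → Set (E → Fin M) := fun i l =>
    increasing M l ∩ {u | ∃ k ∈ (e :: l).toFinset, u ∈ touched ends κ M E₀ (T i) j k}
  have h1 : ∀ i, ({u | e ∈ explored ends κ M E₀ (T i) j u}.ncard : ℝ) ≤
      ∑ m ∈ Finset.range n, chainSum ends m e fun l => ((B i l).ncard : ℝ) := by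
    intro i
    refine ncard_le_chainSum e n _ (B i) ?_
    rintro u ⟨l, hl, hi, ht⟩
    exact ⟨l, Nat.lt_succ_of_le (increasing_length_le hi), hl, hi, _,
      List.mem_toFinset.2 (List.getLast_mem _), ht⟩
  -- The sum over `i` is kept inside, because `χ` only controls the touching probabilities summed
  -- over the targets.
  have h2 : ∀ l : List E, ∑ i ∈ s, ((B i l).ncard : ℝ) ≤
      C₀ * X * (X / Y) ^ l.length * ((l.length + 1) * (χ * N)) := by
    intro l
    have hcard : (e :: l).toFinset.card ≤ l.length + 1 := (List.toFinset_card_le _).trans (by simp)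
    have hinc : ((increasing M l).ncard : ℝ) ≤ C₀ * (1 / Y) ^ l.length * N := by
      refine (ncard_increasing_le_exp l hEM hY0).trans ?_
      have := pow_le_pow_of_le_one (show 0 ≤ 1 / Y by positivity) ((div_le_one hY0).2 hY1)
          (show l.length ≤ 2 * l.length by omega)
      gcongr
    refine le_of_mul_le_mul_right ?_ hN0
    calc (∑ i ∈ s, ((B i l).ncard : ℝ)) * N
        ≤ ∑ i ∈ s, X ^ (l.length + 1) * ((increasing M l).ncard *
            ∑ k ∈ (e :: l).toFinset, ((touched ends κ M E₀ (T i) j k).ncard : ℝ)) := by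
          rw [Finset.sum_mul]
          refine Finset.sum_le_sum fun i _ => ?_
          exact ncard_inter_touched_le hκ hD hc hc1 hM hj1 hcard _ fun u v huv hu =>
            increasing_congr (fun f hf => huv f (by simp [hf])) hu
      _ = X ^ (l.length + 1) * ((increasing M l).ncard *
            ∑ k ∈ (e :: l).toFinset, ∑ i ∈ s, ((touched ends κ M E₀ (T i) j k).ncard : ℝ)) := by
          rw [← Finset.mul_sum, ← Finset.mul_sum, Finset.sum_comm]
      _ ≤ X ^ (l.length + 1) * ((C₀ * (1 / Y) ^ l.length * N) *
            ((l.length + 1) * (χ * N))) := by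
          have h3 : ∑ k ∈ (e :: l).toFinset,
              ∑ i ∈ s, ((touched ends κ M E₀ (T i) j k).ncard : ℝ) ≤
              (l.length + 1) * (χ * N) := by
            refine (Finset.sum_le_card_nsmul _ _ _ fun k _ => hχ k).trans ?_
            rw [nsmul_eq_mul]
            refine mul_le_mul_of_nonneg_right ?_ hχ0
            exact_mod_cast hcard
          gcongr
      _ = _ := by rw [div_pow, div_pow, one_pow]; ring
  calc ∑ i ∈ s, ({u | e ∈ explored ends κ M E₀ (T i) j u}.ncard : ℝ)
      ≤ ∑ i ∈ s, ∑ m ∈ Finset.range n, chainSum ends m e fun l => ((B i l).ncard : ℝ) :=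
        Finset.sum_le_sum fun i _ => h1 i
    _ = ∑ m ∈ Finset.range n, chainSum ends m e fun l => ∑ i ∈ s, ((B i l).ncard : ℝ) := by
        rw [Finset.sum_comm]
        simp only [chainSum_sum]
    _ ≤ ∑ m ∈ Finset.range n, (C₀ * X * (χ * N)) * (1 / 2) ^ m := by
        refine Finset.sum_le_sum fun m _ => ?_
        refine (chainSum_mono (Ψ := fun _ => C₀ * X * (X / Y) ^ m * ((m + 1) * (χ * N)))
          fun l hl => ?_).trans ?_
        · have := h2 l
          rwa [hl] at this
        · refine (chainSum_const_le hD m e (by positivity)).trans ?_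
          have hpow : (m : ℝ) + 1 ≤ 2 ^ m := by
            have := Nat.lt_two_pow_self (n := m)
            exact_mod_cast this
          have hXY : X / Y = 1 / (4 * D) := by
            rw [hY, chainRate, ← hX]
            field_simp
          calc (D : ℝ) ^ m * (C₀ * X * (X / Y) ^ m * ((m + 1) * (χ * N)))
              ≤ (D : ℝ) ^ m * (C₀ * X * (X / Y) ^ m * (2 ^ m * (χ * N))) := by gcongr
            _ = _ := by
              rw [hXY, div_pow, div_pow, mul_pow, show (4 : ℝ) = 2 * 2 by norm_num, mul_pow]
              field_simp
    _ ≤ (C₀ * X * (χ * N)) * 2 := by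
        rw [← Finset.mul_sum]
        have := sum_half_pow_le n
        gcongr
    _ = _ := by rw [chainConst, ← hX, ← hY]; ring

/-- The discrete derivative of the connection probability. -/
theorem sum_pivotal_le (hM : 0 < M) (a : V) (T : Set V) (j : ℕ) :
    ∑ g, ((pivotal ends κ M a T j g).ncard : ℝ) ≤
      (cross ends κ M a T (j + 1)).ncard - (cross ends κ M a T j).ncard +
        (Fintype.card E : ℝ) ^ 2 / M ^ 2 * Fintype.card (E → Fin M) := by
  classical
  have hMne : Nonempty (Fin M) := ⟨⟨0, hM⟩⟩
  set N : ℝ := ((Fintype.card (E → Fin M) : ℕ) : ℝ) with hN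
  let tie : E → E → Set (E → Fin M) := fun g h => {u | (u g : ℕ) = j ∧ (u h : ℕ) = j}
  -- If `g` is pivotal and alone in having label `j`, then `a` and `T` become connected exactly when
  -- `j` is handled, and these events are disjoint for distinct `g`. Otherwise two edges share the
  -- label `j`, with probability at most `1 / M ^ 2` per pair.
  let uniq : E → Set (E → Fin M) := fun g =>
    {u | u ∈ pivotal ends κ M a T j g ∧ ∀ h, h ≠ g → (u h : ℕ) ≠ j}
  have htie : ∀ g h, g ≠ h → ((tie g h).ncard : ℝ) ≤ 1 / M ^ 2 * N := by
    intro g h hgh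
    have h1 := ncard_pattern ({g, h} : Finset E) (fun _ => {b : Fin M | (b : ℕ) = j})
    have h2 : {v : E → Fin M | ∀ e ∈ ({g, h} : Finset E), v e ∈ {b : Fin M | (b : ℕ) = j}} =
        tie g h := by
      ext u; simp [tie]
    rw [h2, Finset.prod_pair hgh, Fintype.card_fin] at h1
    rw [h1]
    have h3 : ({b : Fin M | (b : ℕ) = j}.ncard : ℝ) ≤ 1 := by
      have : {b : Fin M | (b : ℕ) = j}.ncard ≤ 1 :=
        (Set.ncard_le_one (Set.toFinite _)).2 fun b hb b' hb' => Fin.ext (hb.trans hb'.symm)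
      exact_mod_cast this
    refine mul_le_mul_of_nonneg_right ?_ (by positivity)
    rw [div_mul_div_comm, ← pow_two (M : ℝ)]
    gcongr
    nlinarith [show (0 : ℝ) ≤ ({b : Fin M | (b : ℕ) = j}.ncard : ℝ) by positivity]
  have h1 : ∀ g, ((pivotal ends κ M a T j g).ncard : ℝ) ≤
      (uniq g).ncard + Fintype.card E * (1 / M ^ 2 * N) := by
    intro g
    have hsub : pivotal ends κ M a T j g ⊆ uniq g ∪ ⋃ h ∈ Finset.univ.erase g, tie g h := by
      intro u hu
      by_cases hh : ∀ h, h ≠ g → (u h : ℕ) ≠ j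
      · exact Or.inl ⟨hu, hh⟩
      · push Not at hh
        obtain ⟨h, hg, hj⟩ := hh
        exact Or.inr (Set.mem_iUnion₂.2 ⟨h, by simp [hg], hu.1, hj⟩)
    have h2 := (Set.ncard_le_ncard hsub (Set.toFinite _)).trans (Set.ncard_union_le _ _)
    have h3 := Finset.set_ncard_biUnion_le (Finset.univ.erase g) (tie g)
    have h4 : ((∑ h ∈ Finset.univ.erase g, (tie g h).ncard : ℕ) : ℝ) ≤
        Fintype.card E * (1 / M ^ 2 * N) := by
      push_cast
      refine (Finset.sum_le_card_nsmul _ _ _ fun h hh =>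
        htie g h (Finset.ne_of_mem_erase hh).symm).trans ?_
      rw [nsmul_eq_mul]
      have : (((Finset.univ : Finset E).erase g).card : ℝ) ≤ Fintype.card E := by
        exact_mod_cast Finset.card_le_univ _
      gcongr
    have h5 : ((pivotal ends κ M a T j g).ncard : ℝ) ≤ (uniq g).ncard +
        ((∑ h ∈ Finset.univ.erase g, (tie g h).ncard : ℕ) : ℝ) := by
      exact_mod_cast h2.trans (by omega)
    linarith
  have hsubc : cross ends κ M a T j ⊆ cross ends κ M a T (j + 1) := by
    rintro u ⟨t, ht, hr⟩
    exact ⟨t, ht, hr.mono (openSet_mono (Nat.le_succ j) u)⟩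
  have h2 : ∑ g, ((uniq g).ncard : ℝ) ≤
      (cross ends κ M a T (j + 1)).ncard - (cross ends κ M a T j).ncard := by
    have hdis : (Set.univ : Set E).PairwiseDisjoint uniq := by
      intro g _ h _ hgh
      refine Set.disjoint_left.2 fun u hu hu' => ?_
      exact hu.2 h hgh.symm hu'.1.1
    have hsum : ∑ g, (uniq g).ncard = (⋃ g ∈ (Finset.univ : Finset E), uniq g).ncard := by
      simp only [Set.ncard_eq_toFinset_card']
      rw [← Finset.card_biUnion]
      · congr 1
        ext u
        simp
      · intro g _ h _ hgh
        exact Set.disjoint_toFinset.2 (hdis (Set.mem_univ g) (Set.mem_univ h) hgh)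
    have hsub : (⋃ g ∈ (Finset.univ : Finset E), uniq g) ⊆
        cross ends κ M a T (j + 1) \ cross ends κ M a T j := by
      intro u hu
      obtain ⟨g, -, ⟨hj, hnc, hs, t, ht, hr⟩, -⟩ := Set.mem_iUnion₂.1 hu
      refine ⟨⟨t, ht, hr.mono (Set.union_subset (openSet_mono (Nat.le_succ j) u) ?_)⟩, hnc⟩
      rintro _ rfl
      exact ⟨by omega, hs⟩
    have h3 := Set.ncard_le_ncard hsub (Set.toFinite _)
    rw [← hsum] at h3
    have h4 := Set.ncard_sdiff_add_ncard_of_subset hsubc (Set.toFinite _)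
    have h5 : ((∑ g, (uniq g).ncard : ℕ) : ℝ) + (cross ends κ M a T j).ncard ≤
        (cross ends κ M a T (j + 1)).ncard := by
      exact_mod_cast (by omega)
    push_cast at h5
    linarith
  refine (Finset.sum_le_sum fun g _ => h1 g).trans ?_
  rw [Finset.sum_add_distrib, Finset.sum_const, Finset.card_univ, nsmul_eq_mul]
  have : (Fintype.card E : ℝ) * (Fintype.card E * (1 / M ^ 2 * N)) =
      (Fintype.card E : ℝ) ^ 2 / M ^ 2 * N := by ring
  linarith

end FiniteInequality

/-! ### The exploration and the OSSS inequality for the connection event -/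

section Exploration

variable {V E : Type*} [Fintype E] [LinearOrder E] {M : ℕ} {ends : E → Sym2 V} {κ : ℕ}

/-- If all edges which are certain to be explored, given the labels in `S`, belong to `S`, then the
labels in `S` determine the explored clusters. -/
theorem reach_of_explored {E₀ : Set E} {T : Set V} {j : ℕ} {S : Finset E} {u v : E → Fin M}
    (huv : ∀ e ∈ S, v e = u e)
    (hS : ∀ e ∉ S, ∃ u', (∀ g ∈ S, u' g = u g) ∧ e ∉ explored ends κ M E₀ T j u')
    {w x y : V} (hw : w ∈ T) (hwx : Reach ends (openSet ends κ j u ∩ E₀) w x)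
    (hxy : Reach ends (openSet ends κ j u ∩ E₀) x y) :
    Reach ends (openSet ends κ j v ∩ E₀) x y := by
  have hS' : ∀ e, (∀ u', (∀ g ∈ S, u' g = u g) → e ∈ explored ends κ M E₀ T j u') → e ∈ S := by
    intro e he
    by_contra hne
    obtain ⟨u', h1, h2⟩ := hS e hne
    exact h2 (he u' h1)
  -- An edge is good if, whatever the labels off `S`, an increasing chain starting with it leads to
  -- the clusters of `T`. All neighbours of a good edge are then certain to be explored, so they lie
  -- in `S`, and the earlier ones are again good. By induction in time, `S` determines the outcome
  -- at good edges.
  let Good : E → Prop := fun e => ∀ u', (∀ g ∈ S, u' g = u g) → ∃ l : List E,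
    (e :: l).IsChain (Adjacent ends) ∧ u' ∈ increasing M (e :: l) ∧
      u' ∈ touched ends κ M E₀ T j ((e :: l).getLast (by simp))
  have good_nbr : ∀ e f, Good e → Adjacent ends f e → f ∈ S := by
    intro e f he hfe
    refine hS' f fun u' hu' => ?_
    obtain ⟨l, h1, h2, h3⟩ := he u' hu'
    exact ⟨e :: l, List.isChain_cons_cons.2 ⟨hfe, h1⟩, h2, by
      rwa [List.getLast_cons_cons]⟩
  have good_mem : ∀ e, Good e → e ∈ S := fun e he => good_nbr e e he (.refl e)
  have good_lt : ∀ e f, Good e → Adjacent ends f e → Lt u f e → Good f := by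
    intro e f he hfe hlt u' hu'
    obtain ⟨l, h1, h2, h3⟩ := he u' hu'
    refine ⟨e :: l, List.isChain_cons_cons.2 ⟨hfe, h1⟩, List.isChain_cons_cons.2 ⟨?_, h2⟩, by
      rwa [List.getLast_cons_cons]⟩
    exact (lt_congr (hu' f (good_nbr e f he hfe)) (hu' e (good_mem e he))).2 hlt
  have good_succ : ∀ e, Good e → ∀ u', (∀ g ∈ S, u' g = u g) →
      (Succ ends κ u' e ↔ Succ ends κ u e) := by
    intro e
    induction e using (lt_wf u).induction with
    | _ e ih =>
    intro he u' hu'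
    rw [succ_iff, succ_iff]
    refine forall₂_congr fun x hx => ?_
    have : {f | x ∈ ends f ∧ Lt u' f e ∧ Succ ends κ u' f} =
        {f | x ∈ ends f ∧ Lt u f e ∧ Succ ends κ u f} := by
      ext f
      refine and_congr_right fun hxf => ?_
      have hadj : Adjacent ends f e := ⟨x, hxf, hx⟩
      have hlt := lt_congr (hu' f (good_nbr e f he hadj)) (hu' e (good_mem e he))
      rw [hlt]
      exact and_congr_right fun h => ih f h (good_lt e f he hadj h) u' hu'
    rw [this]
  -- Edges at a vertex which is certainly connected to `T` are good, through the empty chain. So the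
  -- clusters can be traced edge by edge using the labels in `S` only.
  have step : ∀ e x, (∀ u', (∀ g ∈ S, u' g = u g) →
      ∃ t ∈ T, Reach ends (openSet ends κ j u' ∩ E₀) t x) → x ∈ ends e →
      e ∈ openSet ends κ j u ∩ E₀ → ∀ u', (∀ g ∈ S, u' g = u g) →
        e ∈ openSet ends κ j u' ∩ E₀ := by
    intro e x hx hxe he u' hu'
    have hgood : Good e := fun u'' hu'' => ⟨[], by simp, by simp [increasing], by
      simpa using ⟨x, hxe, hx u'' hu''⟩⟩
    exact ⟨⟨by rw [hu' e (good_mem e hgood)]; exact he.1.1, (good_succ e hgood u' hu').2 he.1.2⟩,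
      he.2⟩
  have hclus : ∀ x, Reach ends (openSet ends κ j u ∩ E₀) w x → ∀ u', (∀ g ∈ S, u' g = u g) →
      ∃ t ∈ T, Reach ends (openSet ends κ j u' ∩ E₀) t x := by
    intro x hx
    induction hx with
    | refl => exact fun u' _ => ⟨w, hw, .refl⟩
    | tail _ h ih =>
      obtain ⟨e, he, hee⟩ := h
      intro u' hu'
      obtain ⟨t, ht, hr⟩ := ih u' hu'
      exact ⟨t, ht, hr.tail ⟨e, step e _ ih (by simp [hee]) he u' hu', hee⟩⟩
  induction hxy with
  | refl => exact .refl
  | tail hxz h ih =>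
    obtain ⟨e, he, hee⟩ := h
    exact ih.tail ⟨e, step e _ (hclus _ (hwx.trans hxz)) (by simp [hee]) he v huv, hee⟩

/-- A connection from `a` to `T` can be found within `E₀` and passes through `T'`, so the clusters
of `T'` within `E₀` contain it and decide the event. -/
theorem cross_of_explored {E₀ : Set E} {a : V} {T T' : Set V} {j : ℕ}
    (hsep : ∀ (ω : Set E), ∀ t ∈ T, Reach ends ω a t → ∃ t' ∈ T, Reach ends (ω ∩ E₀) a t')
    (hthru : ∀ (ω : Set E), ∀ t ∈ T, Reach ends (ω ∩ E₀) a t →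
      ∃ w ∈ T', Reach ends (ω ∩ E₀) a w ∧ Reach ends (ω ∩ E₀) w t)
    {S : Finset E} {u v : E → Fin M} (huv : ∀ e ∈ S, v e = u e)
    (hS : ∀ e ∉ S, ∃ u', (∀ g ∈ S, u' g = u g) ∧ e ∉ explored ends κ M E₀ T' j u')
    (hu : u ∈ cross ends κ M a T j) : v ∈ cross ends κ M a T j := by
  obtain ⟨t, ht, hr⟩ := hu
  obtain ⟨t', ht', hr'⟩ := hsep _ t ht hr
  obtain ⟨w, hw, haw, hwt⟩ := hthru _ t' ht' hr'
  exact ⟨t', ht', (reach_of_explored huv hS hw haw.symm (haw.trans hwt)).mono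
    Set.inter_subset_left⟩

theorem sum_abs_indicator_sub {Ω : Type*} [Fintype Ω] (A : Set Ω) :
    ∑ u, ∑ v, |A.indicator (1 : Ω → ℝ) u - A.indicator 1 v| =
      2 * (A.ncard * (Fintype.card Ω - A.ncard)) := by
  classical
  have h1 : ∑ u, A.indicator (1 : Ω → ℝ) u = A.ncard := by
    rw [Set.ncard_eq_toFinset_card']
    simp only [Set.indicator_apply, Pi.one_apply, Finset.sum_boole]
    simp
  have h2 : ∀ u v, |A.indicator (1 : Ω → ℝ) u - A.indicator 1 v| =
      A.indicator 1 u + A.indicator 1 v - 2 * (A.indicator 1 u * A.indicator 1 v) := by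
    intro u v
    by_cases hu : u ∈ A <;> by_cases hv : v ∈ A <;> simp [hu, hv] <;> norm_num
  simp only [h2, Finset.sum_sub_distrib, Finset.sum_add_distrib, ← Finset.mul_sum, ← Finset.sum_mul,
    h1, Finset.sum_const, Finset.card_univ, nsmul_eq_mul]
  ring

/-- The differential inequality in a finite graph with discrete labels. -/
theorem finite_differential_inequality {ι : Type*} (s : Finset ι) (hκ : 2 ≤ κ) {D : ℕ}
    (hD1 : 1 ≤ D) (hD : ∀ e, (nbrs ends e).card ≤ D) {c : ℝ} (hc : 0 < c) (hc1 : c ≤ 1) {j : ℕ}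
    (hM : 0 < M) (hEM : Fintype.card E ≤ M) (hj0 : c * M ≤ j) (hj1 : (j : ℝ) + 1 + c * M ≤ M)
    (E₀ : Set E) (a : V) (T : Set V) (T' : ι → Set V)
    (hsep : ∀ (ω : Set E), ∀ t ∈ T, Reach ends ω a t → ∃ t' ∈ T, Reach ends (ω ∩ E₀) a t')
    (hthru : ∀ i ∈ s, ∀ (ω : Set E), ∀ t ∈ T, Reach ends (ω ∩ E₀) a t →
      ∃ w ∈ T' i, Reach ends (ω ∩ E₀) a w ∧ Reach ends (ω ∩ E₀) w t)
    {χ : ℝ} (hχ0 : 0 ≤ χ)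
    (hχ : ∀ e, ∑ i ∈ s, ((touched ends κ M E₀ (T' i) j e).ncard : ℝ) ≤
      χ * Fintype.card (E → Fin M)) :
    s.card * ((cross ends κ M a T j).ncard *
        (Fintype.card (E → Fin M) - (cross ends κ M a T j).ncard : ℝ)) ≤
      16 * chainConst D c ^ 2 * χ * M * Fintype.card (E → Fin M) *
        ((cross ends κ M a T (j + 1)).ncard - (cross ends κ M a T j).ncard +
          (Fintype.card E : ℝ) ^ 2 / M ^ 2 * Fintype.card (E → Fin M)) := by
  classical
  have hMne : Nonempty (Fin M) := ⟨⟨0, hM⟩⟩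
  have hM' : (0 : ℝ) < M := by exact_mod_cast hM
  set A := cross ends κ M a T j with hA
  set N : ℝ := ((Fintype.card (E → Fin M) : ℕ) : ℝ) with hN
  have hC := chainConst_pos (D := D) hc hc1
  let Bn : E → ℝ := fun e => ({v | v ∉ A ∧ ∃ b, Function.update v e b ∈ A}.ncard : ℝ)
  have hi : ∀ i ∈ s, (A.ncard * (N - A.ncard) : ℝ) ≤
      ∑ e, ({u | e ∈ explored ends κ M E₀ (T' i) j u}.ncard : ℝ) * Bn e := by
    intro i his
    have h1 := osss_exploration (A.indicator (1 : (E → Fin M) → ℝ))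
      (explored ends κ M E₀ (T' i) j) (by
        intro S u v huv hS
        have hiff : v ∈ A ↔ u ∈ A := by
          constructor
          · refine cross_of_explored hsep (hthru i his) (fun e he => (huv e he).symm) fun e he => ?_
            obtain ⟨u', h1, h2⟩ := hS e he
            exact ⟨u', fun g hg => by rw [h1 g hg, huv g hg], h2⟩
          · exact cross_of_explored hsep (hthru i his) huv hS
        by_cases hu : u ∈ A
        · simp [hu, hiff.2 hu]
        · simp [hu, mt hiff.1 hu])
    rw [sum_abs_indicator_sub, Fintype.card_fin] at h1
    have h2 : ∑ e, ({u | e ∈ explored ends κ M E₀ (T' i) j u}.ncard : ℝ) *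
        influence (A.indicator 1) e ≤
        (2 * M) * ∑ e, ({u | e ∈ explored ends κ M E₀ (T' i) j u}.ncard : ℝ) * Bn e := by
      rw [Finset.mul_sum]
      refine Finset.sum_le_sum fun e _ => ?_
      have h3 := influence_indicator_le A e
      rw [Fintype.card_fin] at h3
      refine (mul_le_mul_of_nonneg_left h3 (by positivity)).trans (le_of_eq ?_)
      simp only [Bn]
      ring
    have h3 := h1.trans h2
    have h4 : (2 * M : ℝ) * (A.ncard * (N - A.ncard)) ≤
        (2 * M) * ∑ e, ({u | e ∈ explored ends κ M E₀ (T' i) j u}.ncard : ℝ) * Bn e := by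
      refine le_trans (le_of_eq ?_) h3
      ring
    exact le_of_mul_le_mul_left h4 (by positivity)
  -- OSSS is summed over the explorations: one started from a single target may have large
  -- revealment near that target, but the sum over the targets is controlled by `χ`.
  have h1 : s.card * (A.ncard * (N - A.ncard) : ℝ) ≤
      ∑ e, (∑ i ∈ s, ({u | e ∈ explored ends κ M E₀ (T' i) j u}.ncard : ℝ)) * Bn e := by
    rw [← nsmul_eq_mul, ← Finset.sum_const]
    refine (Finset.sum_le_sum hi).trans (le_of_eq ?_)
    rw [Finset.sum_comm]
    simp only [Finset.sum_mul]
  have h2 : ∑ e, (∑ i ∈ s, ({u | e ∈ explored ends κ M E₀ (T' i) j u}.ncard : ℝ)) * Bn e ≤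
      (2 * chainConst D c * χ * N) * ∑ e, Bn e := by
    rw [Finset.mul_sum]
    refine Finset.sum_le_sum fun e _ => mul_le_mul_of_nonneg_right ?_ (by positivity)
    exact sum_revealment_le s (by omega) hD1 hD hc hc1 hM hEM hj1 E₀ T' hχ e
  have h3 := sum_influence_le hκ hD1 hD hc hc1 hM hEM hj0 hj1 a T
  have h4 := sum_pivotal_le (ends := ends) (κ := κ) hM a T j
  refine h1.trans (h2.trans ?_)
  calc (2 * chainConst D c * χ * N) * ∑ e, Bn e
      ≤ (2 * chainConst D c * χ * N) * (8 * chainConst D c * M *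
          ((cross ends κ M a T (j + 1)).ncard - (cross ends κ M a T j).ncard +
          (Fintype.card E : ℝ) ^ 2 / M ^ 2 * N)) := by
        refine mul_le_mul_of_nonneg_left (h3.trans ?_) (by positivity)
        exact mul_le_mul_of_nonneg_left h4 (by positivity)
    _ = _ := by ring

end Exploration

/-! ### Boxes in the lattice -/

section Boxes

variable {d : ℕ}

theorem norm1_nonneg (x : Fin d → ℤ) : 0 ≤ norm1 x := Finset.sum_nonneg fun _ _ => abs_nonneg _

theorem norm1_zero : norm1 (0 : Fin d → ℤ) = 0 := by simp [norm1]

theorem norm1_add_le (x y : Fin d → ℤ) : norm1 (x + y) ≤ norm1 x + norm1 y := by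
  rw [norm1, norm1, norm1, ← Finset.sum_add_distrib]
  exact Finset.sum_le_sum fun i _ => abs_add_le _ _

theorem norm1_neg (x : Fin d → ℤ) : norm1 (-x) = norm1 x := by simp [norm1]

theorem norm1_le_of_adj {x y : Fin d → ℤ} (h : (lattice d).Adj x y) : norm1 y ≤ norm1 x + 1 := by
  have h1 : norm1 (x - y) = 1 := h
  have h2 := norm1_add_le x (-(x - y))
  rw [norm1_neg, h1] at h2
  simpa using h2

theorem finite_ball (N : ℕ) : {x : Fin d → ℤ | norm1 x ≤ N}.Finite := by
  refine (Set.Finite.pi (t := fun _ : Fin d => Set.Icc (-(N : ℤ)) N)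
    (fun i => Set.finite_Icc _ _)).subset ?_
  intro x hx i _
  have h1 : |x i| ≤ norm1 x :=
    Finset.single_le_sum (f := fun j => |x j|) (fun j _ => abs_nonneg _) (Finset.mem_univ i)
  exact abs_le.1 (h1.trans hx)

theorem finite_boxEdges (N : ℕ) : {e : Edge d | ∀ x ∈ e.1, norm1 x ≤ N}.Finite := by
  refine ((finite_ball N).biUnion fun x _ => finite_edges_at x).subset ?_
  intro e he
  have hx : (Quot.out e.1).1 ∈ e.1 := Sym2.out_fst_mem _
  exact Set.mem_iUnion₂.2 ⟨_, he _ hx, hx⟩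

variable (d) in
/-- The edges with both end-vertices in the ball of radius `N`. -/
def boxEdges (N : ℕ) : Finset (Edge d) := (finite_boxEdges N).toFinset

theorem mem_boxEdges {N : ℕ} {e : Edge d} : e ∈ boxEdges d N ↔ ∀ x ∈ e.1, norm1 x ≤ N := by
  simp [boxEdges]

theorem edge_mem_boxEdges {N : ℕ} {x y : Fin d → ℤ} (h : (lattice d).Adj x y)
    (hx : norm1 x ≤ N) (hy : norm1 y ≤ N) : edge h ∈ boxEdges d N := by
  rw [mem_boxEdges]
  intro z hz
  rcases Sym2.mem_iff.1 hz with rfl | rfl <;> assumption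

theorem boxEdges_mono {N N' : ℕ} (h : N ≤ N') : boxEdges d N ⊆ boxEdges d N' := fun e he =>
  mem_boxEdges.2 fun x hx => (mem_boxEdges.1 he x hx).trans (by exact_mod_cast h)

theorem norm1_le_of_mem_edge {e : Edge d} {x y : Fin d → ℤ} (hx : x ∈ e.1) (hy : y ∈ e.1) :
    norm1 y ≤ norm1 x + 1 := by
  obtain ⟨z, h, rfl⟩ := exists_edge_eq hx
  rcases Sym2.mem_iff.1 hy with rfl | rfl
  · linarith
  · exact norm1_le_of_adj h

/-- An edge adjacent to an edge of the box belongs to the next box. -/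
theorem mem_boxEdges_succ {N : ℕ} {e f : Edge d} (he : e ∈ boxEdges d N) {x : Fin d → ℤ}
    (hxe : x ∈ e.1) (hxf : x ∈ f.1) : f ∈ boxEdges d (N + 1) := by
  rw [mem_boxEdges]
  intro y hy
  have h1 := mem_boxEdges.1 he x hxe
  have h2 := norm1_le_of_mem_edge hxf hy
  push_cast
  linarith

/-- A linear order on the edges, used to break ties. -/
instance edgeLinearOrder : LinearOrder (Edge d) := by
  classical
  exact linearOrderOfSTO WellOrderingRel

variable (d) in
/-- The end-vertices of the edges of a box. -/
def boxEnds (N : ℕ) : boxEdges d N → Sym2 (Fin d → ℤ) := fun e => e.1.1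

theorem ncard_edges_at_le (x : Fin d → ℤ) :
    {e : Edge d | x ∈ e.1}.ncard ≤ {w : Fin d → ℤ | norm1 w ≤ (1 : ℕ)}.ncard := by
  rw [← Set.ncard_image_of_injective _ Subtype.val_injective]
  refine le_trans (Set.ncard_le_ncard ?_ ((finite_ball 1).image fun w => s(x, x + w)))
    (Set.ncard_image_le (finite_ball 1))
  rintro _ ⟨e, he, rfl⟩
  obtain ⟨z, h, rfl⟩ := exists_edge_eq he
  refine ⟨z - x, ?_, by simp⟩
  have h1 : norm1 (z - x) = 1 := h.symm
  simp [h1]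

variable (d) in
/-- A bound on the number of edges adjacent to an edge. -/
def nbrBound : ℕ := 2 * {w : Fin d → ℤ | norm1 w ≤ (1 : ℕ)}.ncard

theorem one_le_nbrBound : 1 ≤ nbrBound d := by
  have : 0 < {w : Fin d → ℤ | norm1 w ≤ (1 : ℕ)}.ncard :=
    (Set.ncard_pos (finite_ball 1)).2 ⟨0, by simp [norm1_zero]⟩
  unfold nbrBound
  omega

theorem card_nbrs_box_le (N : ℕ) (e : boxEdges d N) :
    (nbrs (boxEnds d N) e).card ≤ nbrBound d := by
  refine card_nbrs_le (fun x => ?_) e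
  refine le_trans ?_ (ncard_edges_at_le x)
  rw [← Set.ncard_image_of_injective _ Subtype.val_injective]
  refine Set.ncard_le_ncard ?_ (finite_edges_at x)
  rintro _ ⟨e, he, rfl⟩
  exact he

end Boxes

/-! ### Discretisation of the labels -/

section Discretisation

variable {d : ℕ} (M : ℕ) [NeZero M]

/-- The label in `Fin M` of a number in the unit interval. -/
def discLabel (x : unitInterval) : Fin M :=
  -- The minimum matters only at `x = 1`.
  ⟨min ⌊(M : ℝ) * x⌋₊ (M - 1), by have := NeZero.pos M; omega⟩

variable {M}

theorem discLabel_mono {x y : unitInterval} (h : x ≤ y) : discLabel M x ≤ discLabel M y := by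
  have hxy : (x : ℝ) ≤ y := h
  rw [Fin.le_def]
  exact min_le_min_right _ (Nat.floor_mono (by gcongr))

theorem measurable_discLabel : Measurable (discLabel M) :=
  Monotone.measurable fun _ _ h => discLabel_mono h

theorem discLabel_eq_of_mem {x : unitInterval} {i : Fin M} (h1 : (i : ℝ) / M ≤ x)
    (h2 : (x : ℝ) < (i + 1) / M) : discLabel M x = i := by
  have hM : (0 : ℝ) < M := by exact_mod_cast NeZero.pos M
  have h3 : ⌊(M : ℝ) * x⌋₊ = i := by
    rw [Nat.floor_eq_iff (mul_nonneg hM.le x.2.1)]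
    rw [div_le_iff₀ hM] at h1
    rw [lt_div_iff₀ hM] at h2
    constructor <;> linarith
  refine Fin.ext ?_
  simp only [discLabel, h3]
  have := i.2
  omega

theorem mem_of_discLabel_eq {x : unitInterval} {i : Fin M} (h : discLabel M x = i) :
    (i : ℝ) / M ≤ x ∧ (x : ℝ) ≤ (i + 1) / M := by
  have hM : (0 : ℝ) < M := by exact_mod_cast NeZero.pos M
  have hv : min ⌊(M : ℝ) * x⌋₊ (M - 1) = i := congrArg Fin.val h
  have h0 : 0 ≤ (M : ℝ) * x := mul_nonneg hM.le x.2.1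
  rw [div_le_iff₀ hM, le_div_iff₀ hM]
  constructor
  · have h1 : (i : ℕ) ≤ ⌊(M : ℝ) * x⌋₊ := by omega
    have := (Nat.le_floor_iff h0).1 h1
    linarith
  · rcases le_total ⌊(M : ℝ) * x⌋₊ (M - 1) with h1 | h1
    · have h2 : ⌊(M : ℝ) * x⌋₊ = i := by omega
      have := Nat.lt_floor_add_one ((M : ℝ) * x)
      rw [h2] at this
      linarith
    · have h2 : (i : ℕ) + 1 = M := by
        have := NeZero.pos M
        omega
      have h3 : (i : ℝ) + 1 = M := by exact_mod_cast h2
      rw [h3]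
      nlinarith [x.2.2]

theorem volume_discLabel (i : Fin M) :
    (volume : Measure unitInterval) (discLabel M ⁻¹' {i}) = ENNReal.ofReal (1 / M) := by
  have hM : (0 : ℝ) < M := by exact_mod_cast NeZero.pos M
  have hi : ((i : ℕ) : ℝ) + 1 ≤ M := by exact_mod_cast i.2
  let a : unitInterval := ⟨(i : ℝ) / M, by positivity, by rw [div_le_one hM]; linarith⟩
  let b : unitInterval := ⟨((i : ℝ) + 1) / M, by positivity, by rw [div_le_one hM]; linarith⟩
  have hab : (b : ℝ) - a = 1 / M := by
    simp only [a, b]; rw [← sub_div]; congr 1; ring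
  refine le_antisymm ?_ ?_
  · rw [← hab, ← unitInterval.volume_Icc]
    exact measure_mono fun x hx => ⟨(mem_of_discLabel_eq hx).1, (mem_of_discLabel_eq hx).2⟩
  · rw [← hab, ← unitInterval.volume_Ico]
    exact measure_mono fun x hx => discLabel_eq_of_mem hx.1 hx.2

variable (M) in
/-- The discretised labels of the edges in `F`. -/
def disc (F : Finset (Edge d)) (U : Labels d) : F → Fin M := fun e => discLabel M (U e)

theorem P_disc_singleton (F : Finset (Edge d)) (u : F → Fin M) :
    P d (disc M F ⁻¹' {u}) = ENNReal.ofReal (1 / Fintype.card (F → Fin M)) := by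
  classical
  have hM : (0 : ℝ) < M := by exact_mod_cast NeZero.pos M
  let t : Edge d → Set unitInterval := fun e =>
    if h : e ∈ F then discLabel M ⁻¹' {u ⟨e, h⟩} else Set.univ
  have hset : disc M F ⁻¹' {u} = Set.pi F t := by
    ext U
    simp only [Set.mem_preimage, Set.mem_singleton_iff, funext_iff, Set.mem_pi, Finset.mem_coe]
    constructor
    · intro h e he
      simp only [t, he, dif_pos]
      exact h ⟨e, he⟩
    · rintro h ⟨e, he⟩
      have := h e he
      simp only [t, he, dif_pos] at this
      exact this
  rw [hset, P, Measure.infinitePi_pi]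
  · rw [← Finset.prod_attach]
    have : ∀ e ∈ F.attach, (volume : Measure unitInterval) (t e) = ENNReal.ofReal (1 / M) := by
      rintro ⟨e, he⟩ -
      simp only [t, he, dif_pos]
      exact volume_discLabel _
    rw [Finset.prod_congr rfl this, Finset.prod_const, Finset.card_attach,
      ← ENNReal.ofReal_pow (by positivity), Fintype.card_fun, Fintype.card_fin, Fintype.card_coe]
    congr 1
    push_cast
    rw [div_pow, one_pow]
  · intro e he
    simp only [t, he, dif_pos]
    exact measurable_discLabel (measurableSet_singleton _)

instance : IsProbabilityMeasure (P d) := by unfold P; infer_instance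

theorem measurable_disc (F : Finset (Edge d)) : Measurable (disc M F) :=
  measurable_pi_lambda _ fun e => measurable_discLabel.comp (measurable_pi_apply (e : Edge d))

/-- The discretised labels are uniformly distributed. -/
theorem P_disc (F : Finset (Edge d)) (A : Set (F → Fin M)) :
    (P d).real (disc M F ⁻¹' A) = A.ncard / Fintype.card (F → Fin M) := by
  classical
  have h1 : disc M F ⁻¹' A = ⋃ u ∈ A.toFinset, disc M F ⁻¹' {u} := by
    ext U; simp
  rw [h1, measureReal_biUnion_finset]
  · have h2 : ∀ u ∈ A.toFinset, (P d).real (disc M F ⁻¹' {u}) =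
        1 / Fintype.card (F → Fin M) := fun u _ => by
      rw [measureReal_def, P_disc_singleton, ENNReal.toReal_ofReal (by positivity)]
    rw [Finset.sum_congr rfl h2, Finset.sum_const, nsmul_eq_mul, Set.ncard_eq_toFinset_card']
    ring
  · intro u _ v _ huv
    refine Set.disjoint_left.2 fun U hU hU' => huv ?_
    exact hU.symm.trans hU'
  · exact fun u _ => measurable_disc F (measurableSet_singleton _)

end Discretisation

/-! ### Exceptional events -/

section Exceptional

variable {V E : Type*} [Fintype E] [LinearOrder E] {ends : E → Sym2 V}

theorem ncard_label_le (M : ℕ) (e : E) (b : ℕ) :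
    ({u : E → Fin M | (u e : ℕ) = b}.ncard : ℝ) ≤ 1 / M * Fintype.card (E → Fin M) := by
  have h1 := ncard_pattern ({e} : Finset E) (fun _ => {i : Fin M | (i : ℕ) = b})
  have h2 : {v : E → Fin M | ∀ f ∈ ({e} : Finset E), v f ∈ {i : Fin M | (i : ℕ) = b}} =
      {u : E → Fin M | (u e : ℕ) = b} := by
    ext u; simp
  rw [h2, Finset.prod_singleton, Fintype.card_fin] at h1
  rw [h1]
  have h3 : ({i : Fin M | (i : ℕ) = b}.ncard : ℝ) ≤ 1 := by
    have : {i : Fin M | (i : ℕ) = b}.ncard ≤ 1 :=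
      (Set.ncard_le_one (Set.toFinite _)).2 fun b hb b' hb' => Fin.ext (hb.trans hb'.symm)
    exact_mod_cast this
  gcongr

theorem ncard_tie_le (M : ℕ) [NeZero M] {e f : E} (hef : e ≠ f) :
    ({u : E → Fin M | u e = u f}.ncard : ℝ) ≤ 1 / M * Fintype.card (E → Fin M) := by
  have hM : (0 : ℝ) < M := by exact_mod_cast NeZero.pos M
  have h1 : ∀ b : Fin M, ({u : E → Fin M | u e = b ∧ u f = b}.ncard : ℝ) =
      1 / M ^ 2 * Fintype.card (E → Fin M) := by
    intro b
    have h1 := ncard_pattern ({e, f} : Finset E) (fun _ => {b})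
    have h2 : {v : E → Fin M | ∀ g ∈ ({e, f} : Finset E), v g ∈ ({b} : Set (Fin M))} =
        {u : E → Fin M | u e = b ∧ u f = b} := by
      ext u; simp
    rw [h2, Finset.prod_pair hef, Fintype.card_fin, Set.ncard_singleton] at h1
    rw [h1]
    push_cast
    ring
  have hsub : {u : E → Fin M | u e = u f} ⊆
      ⋃ b ∈ (Finset.univ : Finset (Fin M)), {u : E → Fin M | u e = b ∧ u f = b} := by
    intro u hu
    exact Set.mem_iUnion₂.2 ⟨u e, by simp, rfl, hu.symm⟩
  have h2 := (Set.ncard_le_ncard hsub (Set.toFinite _)).trans (Finset.set_ncard_biUnion_le _ _)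
  have h3 : ({u : E → Fin M | u e = u f}.ncard : ℝ) ≤
      ∑ b : Fin M, ({u : E → Fin M | u e = b ∧ u f = b}.ncard : ℝ) := by exact_mod_cast h2
  refine h3.trans (le_of_eq ?_)
  rw [Finset.sum_congr rfl fun b _ => h1 b, Finset.sum_const, Finset.card_univ, Fintype.card_fin,
    nsmul_eq_mul]
  field_simp

theorem ncard_not_injective_le (M : ℕ) [NeZero M] :
    ({u : E → Fin M | ¬ Function.Injective u}.ncard : ℝ) ≤
      (Fintype.card E : ℝ) ^ 2 / M * Fintype.card (E → Fin M) := by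
  classical
  have hsub : {u : E → Fin M | ¬ Function.Injective u} ⊆
      ⋃ p ∈ (Finset.univ : Finset (E × E)).filter (fun p => p.1 ≠ p.2),
        {u : E → Fin M | u p.1 = u p.2} := by
    intro u hu
    simp only [Function.Injective, Set.mem_ofPred_eq, not_forall] at hu
    obtain ⟨e, f, h1, h2⟩ := hu
    exact Set.mem_iUnion₂.2 ⟨(e, f), by simp [h2], h1⟩
  have h2 := (Set.ncard_le_ncard hsub (Set.toFinite _)).trans (Finset.set_ncard_biUnion_le _ _)
  have h3 : ({u : E → Fin M | ¬ Function.Injective u}.ncard : ℝ) ≤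
      ∑ p ∈ (Finset.univ : Finset (E × E)).filter (fun p => p.1 ≠ p.2),
        ({u : E → Fin M | u p.1 = u p.2}.ncard : ℝ) := by exact_mod_cast h2
  refine h3.trans ((Finset.sum_le_card_nsmul _ _ _ fun p hp =>
    ncard_tie_le M (Finset.mem_filter.1 hp).2).trans ?_)
  have h4 : (((Finset.univ : Finset (E × E)).filter (fun p => p.1 ≠ p.2)).card : ℝ) ≤
      (Fintype.card E : ℝ) ^ 2 := by
    have := Finset.card_le_univ ((Finset.univ : Finset (E × E)).filter (fun p => p.1 ≠ p.2))
    rw [Fintype.card_prod, ← pow_two] at this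
    exact_mod_cast this
  rw [nsmul_eq_mul, div_eq_mul_one_div ((Fintype.card E : ℝ) ^ 2), mul_assoc]
  gcongr

theorem ncard_near_threshold_le (M j : ℕ) :
    ({u : E → Fin M | ∃ e, (u e : ℕ) = j ∨ (u e : ℕ) + 1 = j}.ncard : ℝ) ≤
      2 * Fintype.card E / M * Fintype.card (E → Fin M) := by
  classical
  have hsub : {u : E → Fin M | ∃ e, (u e : ℕ) = j ∨ (u e : ℕ) + 1 = j} ⊆
      ⋃ e ∈ (Finset.univ : Finset E),
        ({u : E → Fin M | (u e : ℕ) = j} ∪ {u : E → Fin M | (u e : ℕ) = j - 1}) := by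
    rintro u ⟨e, he⟩
    refine Set.mem_iUnion₂.2 ⟨e, by simp, ?_⟩
    rcases he with he | he
    · exact Or.inl he
    · exact Or.inr (show (u e : ℕ) = j - 1 by omega)
  have h2 := (Set.ncard_le_ncard hsub (Set.toFinite _)).trans (Finset.set_ncard_biUnion_le _ _)
  have h3 : ({u : E → Fin M | ∃ e, (u e : ℕ) = j ∨ (u e : ℕ) + 1 = j}.ncard : ℝ) ≤
      ∑ e, (({u : E → Fin M | (u e : ℕ) = j} ∪
        {u : E → Fin M | (u e : ℕ) = j - 1}).ncard : ℝ) := by exact_mod_cast h2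
  refine h3.trans ((Finset.sum_le_card_nsmul _ _ ((2 / M * Fintype.card (E → Fin M) : ℝ))
    fun e _ => ?_).trans (le_of_eq ?_))
  · have h4 : (({u : E → Fin M | (u e : ℕ) = j} ∪ {u : E → Fin M | (u e : ℕ) = j - 1}).ncard : ℝ) ≤
        ({u : E → Fin M | (u e : ℕ) = j}.ncard : ℝ) +
          ({u : E → Fin M | (u e : ℕ) = j - 1}.ncard : ℝ) := by
      exact_mod_cast Set.ncard_union_le _ _
    have h5 := ncard_label_le M e j
    have h6 := ncard_label_le M e (j - 1)
    calc _ ≤ _ := h4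
      _ ≤ _ := add_le_add h5 h6
      _ = _ := by ring
  · rw [Finset.card_univ, nsmul_eq_mul]
    ring

variable (ends) in
/-- There is a monotone chain of `m + 1` edges that starts in `F₀`. -/
def longChain (M m : ℕ) (F₀ : Finset E) : Set (E → Fin M) :=
  {u | ∃ e ∈ F₀, ∃ l : List E, l.length = m ∧ (e :: l).IsChain (Adjacent ends) ∧
    (u ∈ increasing M (e :: l) ∨ u ∈ increasing M (e :: l).reverse)}

/-- `ncard_increasing_le_exp` at `Y = 2 * D` beats the `D ^ m` choices of a chain, leaving at most
`(1 / 2) ^ m`. -/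
theorem ncard_longChain_le {D : ℕ} (hD1 : 1 ≤ D) (hD : ∀ e, (nbrs ends e).card ≤ D) {M : ℕ}
    (hEM : Fintype.card E ≤ M) (m : ℕ) (F₀ : Finset E) :
    ((longChain ends M m F₀).ncard : ℝ) ≤
      2 * F₀.card * Real.exp (8 * D ^ 2) * (1 / 2) ^ m * Fintype.card (E → Fin M) := by
  classical
  have hD0 : (1 : ℝ) ≤ D := by exact_mod_cast hD1
  set N : ℝ := ((Fintype.card (E → Fin M) : ℕ) : ℝ) with hN
  have hN0 : 0 ≤ N := by positivity
  let B : E → List E → Set (E → Fin M) := fun e l =>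
    {u | l.length = m ∧ (u ∈ increasing M (e :: l) ∨ u ∈ increasing M (e :: l).reverse)}
  let A : E → Set (E → Fin M) := fun e =>
    {u | ∃ l : List E, l.length = m ∧ (e :: l).IsChain (Adjacent ends) ∧
      (u ∈ increasing M (e :: l) ∨ u ∈ increasing M (e :: l).reverse)}
  have hB : ∀ e l, ((B e l).ncard : ℝ) ≤
      if l.length = m then 2 * (Real.exp (8 * D ^ 2) * (1 / (2 * D)) ^ (2 * m) * N) else 0 := by
    intro e l
    split_ifs with hl
    · have h1 : ((B e l).ncard : ℝ) ≤ (increasing M (e :: l)).ncard +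
          (increasing M (e :: l).reverse).ncard := by
        have : B e l ⊆ increasing M (e :: l) ∪ increasing M (e :: l).reverse := fun u hu => hu.2
        exact_mod_cast (Set.ncard_le_ncard this (Set.toFinite _)).trans (Set.ncard_union_le _ _)
      have key : ∀ l' : List E, l'.length = m + 1 → ((increasing M l').ncard : ℝ) ≤
          Real.exp (8 * D ^ 2) * (1 / (2 * D)) ^ (2 * m) * N := by
        intro l' hl'
        refine (ncard_increasing_le_exp l' hEM (Y := 2 * D) (by positivity)).trans ?_
        rw [hl', show (2 : ℝ) * (2 * D) ^ 2 = 8 * D ^ 2 by ring]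
        have h3 : (1 / (2 * D) : ℝ) ≤ 1 := by
          rw [div_le_one (by positivity)]; linarith
        have := pow_le_pow_of_le_one (show 0 ≤ (1 / (2 * D) : ℝ) by positivity) h3
          (show 2 * m ≤ 2 * (m + 1) by omega)
        gcongr
      have h2 := key (e :: l) (by simp [hl])
      have h3 := key (e :: l).reverse (by simp [hl])
      linarith
    · have : B e l = ∅ := by
        ext u
        simp only [B, Set.mem_ofPred_eq, Set.mem_empty_iff_false, iff_false]
        exact fun h => hl h.1
      simp [this]
  have hA : ∀ e, ((A e).ncard : ℝ) ≤ 2 * Real.exp (8 * D ^ 2) * (1 / 2) ^ m * N := by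
    intro e
    have h1 := ncard_le_chainSum e (m + 1) (A e) (B e) (by
      rintro u ⟨l, hl, hc, hu⟩
      exact ⟨l, by omega, hc, hl, hu⟩)
    refine h1.trans ?_
    rw [Finset.sum_range_succ]
    have h2 : ∑ k ∈ Finset.range m, chainSum ends k e (fun l => ((B e l).ncard : ℝ)) ≤ 0 := by
      refine Finset.sum_nonpos fun k hk => ?_
      refine (chainSum_mono (Ψ := fun _ => 0) fun l hl => ?_).trans
        ((chainSum_const_le hD k e le_rfl).trans (by simp))
      have h3 := hB e l
      have hne : l.length ≠ m := by
        rw [hl]; exact (Finset.mem_range.1 hk).ne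
      rwa [if_neg hne] at h3
    have h3 : chainSum ends m e (fun l => ((B e l).ncard : ℝ)) ≤
        (D : ℝ) ^ m * (2 * (Real.exp (8 * D ^ 2) * (1 / (2 * D)) ^ (2 * m) * N)) := by
      refine (chainSum_mono (Ψ := fun _ => _) fun l hl => ?_).trans
        (chainSum_const_le hD m e (by positivity))
      have h3 := hB e l
      rwa [if_pos hl] at h3
    have h4 : (D : ℝ) ^ m * (1 / (2 * D)) ^ (2 * m) ≤ (1 / 2) ^ m := by
      rw [pow_mul, ← mul_pow]
      refine pow_le_pow_left₀ (by positivity) ?_ m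
      rw [div_pow, one_pow, mul_pow, mul_one_div, div_le_div_iff₀ (by positivity) (by positivity)]
      nlinarith
    calc _ ≤ (D : ℝ) ^ m * (2 * (Real.exp (8 * D ^ 2) * (1 / (2 * D)) ^ (2 * m) * N)) := by
          linarith
      _ = 2 * Real.exp (8 * D ^ 2) * ((D : ℝ) ^ m * (1 / (2 * D)) ^ (2 * m)) * N := by ring
      _ ≤ _ := by gcongr
  have hsub : longChain ends M m F₀ ⊆ ⋃ e ∈ F₀, A e := by
    rintro u ⟨e, he, h⟩
    exact Set.mem_iUnion₂.2 ⟨e, he, h⟩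
  have h2 := (Set.ncard_le_ncard hsub (Set.toFinite _)).trans (Finset.set_ncard_biUnion_le _ _)
  have h3 : ((longChain ends M m F₀).ncard : ℝ) ≤ ∑ e ∈ F₀, ((A e).ncard : ℝ) := by
    exact_mod_cast h2
  refine h3.trans ((Finset.sum_le_card_nsmul _ _ _ fun e _ => hA e).trans (le_of_eq ?_))
  rw [nsmul_eq_mul]
  ring

variable (ends) in
/-- The configurations where the discretisation or the restriction to a box may be inaccurate. -/
def badSet (M m j : ℕ) (F₀ : Finset E) : Set (E → Fin M) :=
  -- With a tie the discrete order may differ from the true one; a label `j` or `j - 1` may leave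
  -- open whether the attempt comes by time `p`; a long monotone chain may bring influence from
  -- outside the box.
  {u | ¬ Function.Injective u} ∪ {u | ∃ e, (u e : ℕ) = j ∨ (u e : ℕ) + 1 = j} ∪
    longChain ends M m F₀

theorem ncard_badSet_le {D : ℕ} (hD1 : 1 ≤ D) (hD : ∀ e, (nbrs ends e).card ≤ D) {M : ℕ} [NeZero M]
    (hEM : Fintype.card E ≤ M) (m j : ℕ) (F₀ : Finset E) :
    ((badSet ends M m j F₀).ncard : ℝ) ≤
      (3 * (Fintype.card E : ℝ) ^ 2 / M + 2 * F₀.card * Real.exp (8 * D ^ 2) * (1 / 2) ^ m) *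
        Fintype.card (E → Fin M) := by
  have h1 := ncard_not_injective_le (E := E) M
  have h2 := ncard_near_threshold_le (E := E) M j
  have h3 := ncard_longChain_le hD1 hD hEM m F₀
  have h4 : ((badSet ends M m j F₀).ncard : ℝ) ≤
      ({u : E → Fin M | ¬ Function.Injective u}.ncard : ℝ) +
      ({u : E → Fin M | ∃ e, (u e : ℕ) = j ∨ (u e : ℕ) + 1 = j}.ncard : ℝ) +
        (longChain ends M m F₀).ncard := by
    exact_mod_cast (Set.ncard_union_le _ _).trans (Nat.add_le_add_right (Set.ncard_union_le _ _) _)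
  have h5 : (Fintype.card E : ℝ) ≤ (Fintype.card E : ℝ) ^ 2 := by
    exact_mod_cast Nat.le_self_pow two_ne_zero _
  have h6 : 2 * (Fintype.card E : ℝ) / M * Fintype.card (E → Fin M) ≤
      2 * (Fintype.card E : ℝ) ^ 2 / M * Fintype.card (E → Fin M) := by gcongr
  calc _ ≤ _ := h4
    _ ≤ (Fintype.card E : ℝ) ^ 2 / M * Fintype.card (E → Fin M) +
        2 * (Fintype.card E : ℝ) ^ 2 / M * Fintype.card (E → Fin M) +
        2 * F₀.card * Real.exp (8 * D ^ 2) * (1 / 2) ^ m * Fintype.card (E → Fin M) := by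
        linarith
    _ = _ := by ring

end Exceptional

/-! ### Comparison of the model with its discretisation in a box -/

section Comparison

variable {d : ℕ} {M : ℕ} [NeZero M]

theorem lt_disc_iff {F : Finset (Edge d)} {U : Labels d} (hinj : Function.Injective (disc M F U))
    (f e : F) : Lt (disc M F U) f e ↔ U f < U e := by
  constructor
  · rintro (h | ⟨h, hlt⟩)
    · by_contra hn
      exact absurd (discLabel_mono (not_lt.1 hn)) (not_le.2 h)
    · obtain rfl := hinj h
      exact absurd (Or.inr ⟨h, hlt⟩ : Lt (disc M F U) f f) (Lt.irrefl _ _)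
  · intro h
    refine Or.inl (lt_of_le_of_ne (discLabel_mono h.le) fun heq => ?_)
    rw [hinj heq] at h
    exact lt_irrefl _ h

/-- The hypotheses say that `j` is `p * M` rounded up. Only the cells of the labels `j - 1` and `j`
can then contain points on either side of `p` that the comparison with `j` misplaces. -/
theorem disc_lt_iff {F : Finset (Edge d)} {U : Labels d} {e : F} {p : ℝ} {j : ℕ}
    (hj : p * M ≤ j) (hj' : (j : ℝ) < p * M + 1) (h1 : (disc M F U e : ℕ) ≠ j)
    (h2 : (disc M F U e : ℕ) + 1 ≠ j) : (disc M F U e : ℕ) < j ↔ (U e : ℝ) ≤ p := by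
  have hM : (0 : ℝ) < M := by exact_mod_cast NeZero.pos M
  obtain ⟨h3, h4⟩ := mem_of_discLabel_eq (x := U e) (i := disc M F U e) rfl
  rw [div_le_iff₀ hM] at h3
  rw [le_div_iff₀ hM] at h4
  constructor
  · intro h
    have h5 : (disc M F U e : ℕ) + 2 ≤ j := by omega
    have h6 : ((disc M F U e : ℕ) : ℝ) + 2 ≤ j := by exact_mod_cast h5
    have h7 : (U e : ℝ) * M ≤ p * M := by linarith
    exact le_of_mul_le_mul_right h7 hM
  · intro h
    by_contra hn
    have h5 : j + 1 ≤ (disc M F U e : ℕ) := by omega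
    have h6 : (j : ℝ) + 1 ≤ ((disc M F U e : ℕ) : ℝ) := by exact_mod_cast h5
    have h7 : (U e : ℝ) * M ≤ p * M := by gcongr
    linarith

/-- The edges of the small box within the large one. -/
def innerEdges (d N n : ℕ) : Finset (boxEdges d N) :=
  Finset.univ.filter fun e => e.1 ∈ boxEdges d n

theorem mem_innerEdges {N n : ℕ} {e : boxEdges d N} :
    e ∈ innerEdges d N n ↔ e.1 ∈ boxEdges d n := by simp [innerEdges]

theorem card_innerEdges_le (N n : ℕ) : (innerEdges d N n).card ≤ (boxEdges d n).card :=
  Finset.card_le_card_of_injOn Subtype.val (fun e he => by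
    have := mem_innerEdges.1 (Finset.mem_coe.1 he)
    exact this) Subtype.val_injective.injOn

theorem longChain_of_precedes {N n m : ℕ} {U : Labels d}
    (hinj : Function.Injective (disc M (boxEdges d N) U)) {e : Edge d} {L : List (Edge d)}
    (hL : (e :: L).IsChain (Precedes U)) (hlast : (e :: L).getLast (by simp) ∈ boxEdges d n)
    (hmem : ∀ f ∈ e :: L, f ∈ boxEdges d N) (hlen : L.length = m) :
    disc M (boxEdges d N) U ∈ longChain (boxEnds d N) M m (innerEdges d N n) := by
  obtain ⟨L', hL'⟩ : ∃ L' : List (boxEdges d N), L'.map Subtype.val = e :: L :=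
    ⟨(e :: L).pmap Subtype.mk hmem, by simp [List.map_pmap]⟩
  have hlen' : L'.length = m + 1 := by
    rw [← List.length_map Subtype.val, hL']; simp [hlen]
  rw [← hL', List.isChain_map] at hL
  have hne : L'.reverse ≠ [] := by
    intro h
    rw [List.reverse_eq_nil_iff.1 h] at hlen'
    simp at hlen'
  obtain ⟨e₀, l, hrev⟩ := List.exists_cons_of_ne_nil hne
  have hL'rev : L' = (e₀ :: l).reverse := by rw [← hrev, List.reverse_reverse]
  refine ⟨e₀, ?_, l, ?_, ?_, Or.inr ?_⟩
  · rw [mem_innerEdges]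
    have h1 : (L'.map Subtype.val).getLast? = some e₀.1 := by
      rw [hL'rev]; simp
    rw [hL', List.getLast?_eq_some_getLast (by simp)] at h1
    rwa [Option.some.inj h1] at hlast
  · have : L'.reverse.length = m + 1 := by simpa using hlen'
    rw [hrev] at this
    simpa using this
  · rw [← hrev, List.isChain_reverse]
    exact hL.imp fun f g h => by
      obtain ⟨-, x, hx, hx'⟩ := h
      exact ⟨x, hx, hx'⟩
  · rw [← hL'rev]
    exact hL.imp fun f g h => (lt_disc_iff hinj f g).2 h.1

/-- Going back in time, a chain leaves the small box by at most one unit per step. The induction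
carries `L.length < m`: a first violation would be a monotone chain of `m + 1` edges, still inside
the large box and ending in the small one, which `badSet` excludes. -/
theorem chain_in_box {n m : ℕ} {j : ℕ} {U : Labels d}
    (hgood : disc M (boxEdges d (n + m)) U ∉
      badSet (boxEnds d (n + m)) M m j (innerEdges d (n + m) n)) {e : Edge d} {L : List (Edge d)}
    (hL : (e :: L).IsChain (Precedes U)) (hlast : (e :: L).getLast (by simp) ∈ boxEdges d n) :
    e ∈ boxEdges d (n + m) := by
  have hinj : Function.Injective (disc M (boxEdges d (n + m)) U) := by
    by_contra h
    exact hgood (Or.inl (Or.inl h))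
  suffices H : L.length < m ∧ e ∈ boxEdges d (n + L.length) ∧
      ∀ f ∈ e :: L, f ∈ boxEdges d (n + m) from H.2.2 e (by simp)
  induction L generalizing e with
  | nil =>
    have he : e ∈ boxEdges d n := by simpa using hlast
    have hmem : ∀ f ∈ [e], f ∈ boxEdges d (n + m) := by
      simpa using boxEdges_mono (Nat.le_add_right n m) he
    refine ⟨?_, by simpa using he, hmem⟩
    by_contra hm
    refine hgood (Or.inr (longChain_of_precedes hinj hL hlast hmem ?_))
    simp only [List.length_nil] at hm ⊢
    omega
  | cons f L ih =>
    obtain ⟨hef, hL'⟩ := List.isChain_cons_cons.1 hL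
    obtain ⟨h1, h2, h3⟩ := ih hL' (by rwa [List.getLast_cons_cons] at hlast)
    obtain ⟨-, x, hx, hx'⟩ := hef
    have h4 : e ∈ boxEdges d (n + (f :: L).length) := mem_boxEdges_succ h2 hx hx'
    have hmem : ∀ g ∈ e :: f :: L, g ∈ boxEdges d (n + m) := by
      intro g hg
      rcases List.mem_cons.1 hg with rfl | hg
      · exact boxEdges_mono (by simp only [List.length_cons]; omega) h4
      · exact h3 g hg
    refine ⟨?_, h4, hmem⟩
    by_contra hm
    refine hgood (Or.inr (longChain_of_precedes hinj hL hlast hmem ?_))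
    simp only [List.length_cons] at hm ⊢
    omega

/-- Both recursions run over the same edges, because by `chain_in_box` every earlier edge they call
upon lies in the large box. `L` records how `e` was reached from the small box. -/
theorem succeeds_iff_succ {κ n m j : ℕ} {U : Labels d} (hU : U ∈ Omega d)
    (hgood : disc M (boxEdges d (n + m)) U ∉
      badSet (boxEnds d (n + m)) M m j (innerEdges d (n + m) n)) (e : Edge d) :
    ∀ (L : List (Edge d)), (e :: L).IsChain (Precedes U) →
      (e :: L).getLast (by simp) ∈ boxEdges d n → ∀ h : e ∈ boxEdges d (n + m),
      (Succeeds κ U hU e ↔ Succ (boxEnds d (n + m)) κ (disc M (boxEdges d (n + m)) U) ⟨e, h⟩) := by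
  have hinj : Function.Injective (disc M (boxEdges d (n + m)) U) := by
    by_contra h
    exact hgood (Or.inl (Or.inl h))
  induction e using (precedes_wellFounded hU).induction with
  | _ e ih =>
  intro L hL hlast he
  rw [succeeds_iff, succ_iff]
  refine forall₂_congr fun x hx => ?_
  have : {f : Edge d | x ∈ f.1 ∧ U f < U e ∧ Succeeds κ U hU f} = Subtype.val ''
      {f : boxEdges d (n + m) | x ∈ boxEnds d (n + m) f ∧
        Lt (disc M (boxEdges d (n + m)) U) f ⟨e, he⟩ ∧
        Succ (boxEnds d (n + m)) κ (disc M (boxEdges d (n + m)) U) f} := by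
    ext f
    constructor
    · rintro ⟨hxf, hlt, hs⟩
      have hpre : Precedes U f e := ⟨hlt, x, hx, hxf⟩
      have hL' : (f :: e :: L).IsChain (Precedes U) := List.isChain_cons_cons.2 ⟨hpre, hL⟩
      have hlast' : (f :: e :: L).getLast (by simp) ∈ boxEdges d n := by
        rwa [List.getLast_cons_cons]
      have hf := chain_in_box hgood hL' hlast'
      exact ⟨⟨f, hf⟩, ⟨hxf, (lt_disc_iff hinj _ _).2 hlt, (ih f hpre _ hL' hlast' hf).1 hs⟩, rfl⟩
    · rintro ⟨⟨f, hf⟩, ⟨hxf, hlt, hs⟩, rfl⟩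
      have hlt' := (lt_disc_iff hinj _ _).1 hlt
      have hpre : Precedes U f e := ⟨hlt', x, hx, hxf⟩
      have hL' : (f :: e :: L).IsChain (Precedes U) := List.isChain_cons_cons.2 ⟨hpre, hL⟩
      have hlast' : (f :: e :: L).getLast (by simp) ∈ boxEdges d n := by
        rwa [List.getLast_cons_cons]
      exact ⟨hxf, hlt', (ih f hpre _ hL' hlast' hf).2 hs⟩
  rw [this, Set.ncard_image_of_injective _ Subtype.val_injective]

theorem edgeOpen_iff_mem_openSet {κ n m j : ℕ} {p : ℝ}
    (hj : p * M ≤ j) (hj' : (j : ℝ) < p * M + 1)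
    {U : Labels d} (hU : U ∈ Omega d) (hgood : disc M (boxEdges d (n + m)) U ∉
      badSet (boxEnds d (n + m)) M m j (innerEdges d (n + m) n)) (e : boxEdges d (n + m))
    (he : e.1 ∈ boxEdges d n) :
    EdgeOpen κ p U hU e.1 ↔
      e ∈ openSet (boxEnds d (n + m)) κ j (disc M (boxEdges d (n + m)) U) := by
  have h1 := succeeds_iff_succ (κ := κ) hU hgood e.1 [] (by simp) (by simpa using he) e.2
  have h2 : (disc M (boxEdges d (n + m)) U e : ℕ) ≠ j ∧
      (disc M (boxEdges d (n + m)) U e : ℕ) + 1 ≠ j := by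
    refine ⟨fun h => hgood (Or.inl (Or.inr ⟨e, Or.inl h⟩)),
      fun h => hgood (Or.inl (Or.inr ⟨e, Or.inr h⟩))⟩
  exact and_congr (disc_lt_iff hj hj' h2.1 h2.2).symm h1

/-! ### Paths and spheres -/

/-- A discrete intermediate value property: `f` grows by at most one per step, so it hits `k` and
does not exceed it before. -/
theorem exists_hit_of_reflTransGen {α : Type*} {r : α → α → Prop} {f : α → ℤ}
    (hf : ∀ x y, r x y → f y ≤ f x + 1) {x y : α} (h : Relation.ReflTransGen r x y) {k : ℤ}
    (hx : f x ≤ k) (hy : k ≤ f y) :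
    ∃ w, f w = k ∧ Relation.ReflTransGen (fun a b => r a b ∧ f a ≤ k ∧ f b ≤ k) x w ∧
      Relation.ReflTransGen r w y := by
  suffices H : (f y < k ∧ Relation.ReflTransGen (fun a b => r a b ∧ f a ≤ k ∧ f b ≤ k) x y) ∨
      ∃ w, f w = k ∧ Relation.ReflTransGen (fun a b => r a b ∧ f a ≤ k ∧ f b ≤ k) x w ∧
      Relation.ReflTransGen r w y from H.resolve_left fun h => absurd h.1 (not_lt.2 hy)
  clear hy
  induction h with
  | refl =>
    rcases hx.lt_or_eq with h | h
    · exact Or.inl ⟨h, .refl⟩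
    · exact Or.inr ⟨x, h, .refl, .refl⟩
  | @tail b c _ hbc ih =>
    rcases ih with ⟨hb, hr⟩ | ⟨w, hw, h1, h2⟩
    · have hc : f c ≤ k := by linarith [hf b c hbc]
      have hr' := hr.tail ⟨hbc, hb.le, hc⟩
      rcases hc.lt_or_eq with h | h
      · exact Or.inl ⟨h, hr'⟩
      · exact Or.inr ⟨c, h, hr', .refl⟩
    · exact Or.inr ⟨w, hw, h1, h2.tail hbc⟩

/-- The sphere of radius `k`. -/
def sphere (d k : ℕ) : Set (Fin d → ℤ) := {x | norm1 x = k}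

theorem norm1_le_of_boxEnds {N : ℕ} {e : boxEdges d N} {x y : Fin d → ℤ}
    (h : boxEnds d N e = s(x, y)) : norm1 y ≤ norm1 x + 1 :=
  norm1_le_of_mem_edge (e := e.1) (x := x) (y := y) (by change x ∈ boxEnds d N e; simp [h])
    (by change y ∈ boxEnds d N e; simp [h])

theorem mem_innerEdges_of_boxEnds {N n : ℕ} {e : boxEdges d N} {x y : Fin d → ℤ}
    (h : boxEnds d N e = s(x, y)) (hx : norm1 x ≤ n) (hy : norm1 y ≤ n) :
    e ∈ innerEdges d N n := by
  rw [mem_innerEdges, mem_boxEdges]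
  intro z hz
  have : z ∈ boxEnds d N e := hz
  rw [h, Sym2.mem_iff] at this
  rcases this with rfl | rfl <;> assumption

theorem box_sep (N n : ℕ) (ω : Set (boxEdges d N)) : ∀ t ∈ sphere d n,
    Reach (boxEnds d N) ω 0 t →
      ∃ t' ∈ sphere d n, Reach (boxEnds d N) (ω ∩ innerEdges d N n) 0 t' := by
  intro t ht hr
  obtain ⟨w, hw, hr', -⟩ := exists_hit_of_reflTransGen (f := norm1) (k := n)
    (fun x y ⟨e, _, he⟩ => norm1_le_of_boxEnds he) hr (by rw [norm1_zero]; positivity)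
    (le_of_eq (show norm1 t = n from ht).symm)
  refine ⟨w, hw, Relation.ReflTransGen.mono ?_ _ _ hr'⟩
  rintro x y ⟨⟨e, he, hxy⟩, hx, hy⟩
  exact ⟨e, ⟨he, mem_innerEdges_of_boxEnds hxy hx hy⟩, hxy⟩

theorem box_thru {N n k : ℕ} (hk : k ≤ n) (ω : Set (boxEdges d N)) : ∀ t ∈ sphere d n,
    Reach (boxEnds d N) ω 0 t → ∃ w ∈ sphere d k, Reach (boxEnds d N) ω 0 w ∧
      Reach (boxEnds d N) ω w t := by
  intro t ht hr
  obtain ⟨w, hw, h1, h2⟩ := exists_hit_of_reflTransGen (f := norm1) (k := k)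
    (fun x y ⟨e, _, he⟩ => norm1_le_of_boxEnds he) hr (by rw [norm1_zero]; positivity)
    (by rw [show norm1 t = n from ht]; exact_mod_cast hk)
  exact ⟨w, hw, Relation.ReflTransGen.mono (fun x y h => h.1) _ _ h1, h2⟩

/-- The event that `z` is connected to the sphere of radius `k` around the origin. -/
def armEvent (κ : ℕ) (p : ℝ) (z : Fin d → ℤ) (k : ℕ) : Set (Labels d) :=
  ⋃ x ∈ sphere d k, connEvent κ p z x

theorem thetaN_eq (κ n : ℕ) (p : ℝ) : thetaN d κ n p = (P d).real (armEvent κ p 0 n) := rfl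

theorem disc_mem_cross_of_mem_armEvent {κ n m j : ℕ} {p : ℝ}
    (hj : p * M ≤ j) (hj' : (j : ℝ) < p * M + 1)
    {U : Labels d}
    (hgood : disc M (boxEdges d (n + m)) U ∉
      badSet (boxEnds d (n + m)) M m j (innerEdges d (n + m) n))
    (h : U ∈ armEvent κ p 0 n) :
    disc M (boxEdges d (n + m)) U ∈ cross (boxEnds d (n + m)) κ M 0 (sphere d n) j := by
  obtain ⟨t, ht, hU, hr⟩ := Set.mem_iUnion₂.1 h
  rw [SimpleGraph.reachable_iff_reflTransGen] at hr
  obtain ⟨w, hw, hr', -⟩ := exists_hit_of_reflTransGen (f := norm1) (k := n)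
    (fun x y h => norm1_le_of_adj h.1) hr (by rw [norm1_zero]; positivity)
    (le_of_eq (show norm1 t = n from ht).symm)
  refine ⟨w, hw, Relation.ReflTransGen.mono ?_ _ _ hr'⟩
  rintro x y ⟨⟨hxy, ho⟩, hx, hy⟩
  have he : edge hxy ∈ boxEdges d n := edge_mem_boxEdges hxy hx hy
  have he' := boxEdges_mono (Nat.le_add_right n m) he
  exact ⟨⟨edge hxy, he'⟩, (edgeOpen_iff_mem_openSet hj hj' hU hgood ⟨edge hxy, he'⟩ he).1 ho, rfl⟩

theorem mem_connEvent_of_reach {κ n m j : ℕ} {p : ℝ}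
    (hj : p * M ≤ j) (hj' : (j : ℝ) < p * M + 1)
    {U : Labels d} (hU : U ∈ Omega d)
    (hgood : disc M (boxEdges d (n + m)) U ∉
      badSet (boxEnds d (n + m)) M m j (innerEdges d (n + m) n))
    {x y : Fin d → ℤ}
    (h : Reach (boxEnds d (n + m)) (openSet (boxEnds d (n + m)) κ j
      (disc M (boxEdges d (n + m)) U) ∩ innerEdges d (n + m) n) x y) :
    U ∈ connEvent κ p x y := by
  refine ⟨hU, ?_⟩
  rw [SimpleGraph.reachable_iff_reflTransGen]
  refine Relation.ReflTransGen.mono ?_ _ _ h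
  rintro x y ⟨e, ⟨he, hin⟩, hxy⟩
  have hin' := mem_innerEdges.1 (Finset.mem_coe.1 hin)
  have ho := (edgeOpen_iff_mem_openSet (κ := κ) hj hj' hU hgood e hin').2 he
  have hadj : (lattice d).Adj x y := by
    have h1 : e.1.1 = s(x, y) := hxy
    have h2 := e.1.2
    rwa [h1] at h2
  have heq : e.1 = edge hadj := Subtype.ext hxy
  exact ⟨hadj, heq ▸ ho⟩

theorem mem_armEvent_of_disc_mem_cross {κ n m j : ℕ} {p : ℝ}
    (hj : p * M ≤ j) (hj' : (j : ℝ) < p * M + 1)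
    {U : Labels d} (hU : U ∈ Omega d)
    (hgood : disc M (boxEdges d (n + m)) U ∉
      badSet (boxEnds d (n + m)) M m j (innerEdges d (n + m) n))
    (h : disc M (boxEdges d (n + m)) U ∈ cross (boxEnds d (n + m)) κ M 0 (sphere d n) j) :
    U ∈ armEvent κ p 0 n := by
  obtain ⟨t, ht, hr⟩ := h
  obtain ⟨t', ht', hr'⟩ := box_sep (n + m) n _ t ht hr
  exact Set.mem_iUnion₂.2 ⟨t', ht', mem_connEvent_of_reach hj hj' hU hgood hr'⟩

theorem exists_mem_armEvent_of_disc_mem_touched {κ n m j : ℕ} {p : ℝ}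
    (hj : p * M ≤ j) (hj' : (j : ℝ) < p * M + 1)
    {U : Labels d} (hU : U ∈ Omega d)
    (hgood : disc M (boxEdges d (n + m)) U ∉
      badSet (boxEnds d (n + m)) M m j (innerEdges d (n + m) n))
    {k : ℕ} {e : boxEdges d (n + m)}
    (h : disc M (boxEdges d (n + m)) U ∈ touched (boxEnds d (n + m)) κ M
      (innerEdges d (n + m) n : Set (boxEdges d (n + m))) (sphere d k) j e) :
    ∃ z ∈ e.1.1, U ∈ armEvent κ p z k := by
  obtain ⟨z, hz, t, ht, hr⟩ := h
  exact ⟨z, hz, Set.mem_iUnion₂.2 ⟨t, ht, mem_connEvent_of_reach hj hj' hU hgood hr.symm⟩⟩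

end Comparison

/-! ### Almost sure properties of the labels -/

section AlmostSure

variable {d : ℕ}

theorem card_discLabels {M : ℕ} {F : Finset (Edge d)} {inst : Fintype (F → Fin M)} :
    (@Fintype.card (F → Fin M) inst : ℝ) = (M : ℝ) ^ F.card := by
  rw [← Nat.card_eq_fintype_card, Nat.card_fun, Nat.card_fin, Nat.card_eq_fintype_card,
    Fintype.card_coe]
  push_cast
  rfl

theorem ncard_eq_P_disc {M : ℕ} [NeZero M] {F : Finset (Edge d)} (A : Set (F → Fin M)) :
    (A.ncard : ℝ) = (P d).real (disc M F ⁻¹' A) * (M : ℝ) ^ F.card := by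
  have hM : (M : ℝ) ≠ 0 := by exact_mod_cast NeZero.ne M
  rw [P_disc, card_discLabels, div_mul_cancel₀ _ (pow_ne_zero _ hM)]

theorem P_badSet_le {M : ℕ} [NeZero M] {n m : ℕ}
    (hM : Fintype.card (boxEdges d (n + m)) ≤ M) (j : ℕ) :
    (P d).real (disc M (boxEdges d (n + m)) ⁻¹'
        badSet (boxEnds d (n + m)) M m j (innerEdges d (n + m) n)) ≤
      3 * (Fintype.card (boxEdges d (n + m)) : ℝ) ^ 2 / M +
        2 * (boxEdges d n).card * Real.exp (8 * nbrBound d ^ 2) * (1 / 2) ^ m := by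
  have h1 := ncard_badSet_le one_le_nbrBound (card_nbrs_box_le (d := d) (n + m)) hM m j
    (innerEdges d (n + m) n)
  have hM0 : (0 : ℝ) < M := by exact_mod_cast NeZero.pos M
  rw [ncard_eq_P_disc, card_discLabels] at h1
  refine (le_of_mul_le_mul_right h1 (by positivity)).trans ?_
  have : ((innerEdges d (n + m) n).card : ℝ) ≤ (boxEdges d n).card := by
    exact_mod_cast card_innerEdges_le _ _
  gcongr

/-- The probability that the discretisation is inaccurate is small. -/
theorem exists_P_badSet_le (n : ℕ) {ε : ℝ} (hε : 0 < ε) :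
    ∃ m M₀ : ℕ, ∀ M ≥ M₀, ∀ [NeZero M], ∀ j : ℕ,
      (P d).real (disc M (boxEdges d (n + m)) ⁻¹'
        badSet (boxEnds d (n + m)) M m j (innerEdges d (n + m) n)) ≤ ε := by
  -- The margin `m` is fixed before `M`, since the number of edges of the large box, and hence the
  -- required fineness, depends on it.
  obtain ⟨m, hm⟩ : ∃ m : ℕ,
      2 * (boxEdges d n).card * Real.exp (8 * nbrBound d ^ 2) * (1 / 2) ^ m < ε / 2 := by
    have h1 := (tendsto_pow_atTop_nhds_zero_of_lt_one (r := (1 / 2 : ℝ)) (by norm_num)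
      (by norm_num)).const_mul (2 * (boxEdges d n).card * Real.exp (8 * nbrBound d ^ 2))
    rw [mul_zero] at h1
    exact (h1.eventually (gt_mem_nhds (half_pos hε))).exists
  obtain ⟨M₁, hM₁⟩ :=
    exists_nat_ge (3 * (Fintype.card (boxEdges d (n + m)) : ℝ) ^ 2 / (ε / 2))
  refine ⟨m, max (Fintype.card (boxEdges d (n + m))) M₁, fun M hM _ j => ?_⟩
  have hM0 : (0 : ℝ) < M := by exact_mod_cast NeZero.pos M
  refine (P_badSet_le ((le_max_left _ _).trans hM) j).trans ?_
  have h2 : 3 * (Fintype.card (boxEdges d (n + m)) : ℝ) ^ 2 / M ≤ ε / 2 := by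
    rw [div_le_iff₀ hM0, mul_comm (ε / 2), ← div_le_iff₀ (half_pos hε)]
    exact hM₁.trans (by exact_mod_cast (le_max_right _ _).trans hM)
  linarith

theorem exists_chain_of_seq {α : Type*} {R : α → α → Prop} (m : ℕ) :
    ∀ s : ℕ → α, (∀ i < m, R (s i) (s (i + 1))) → ∃ l : List α, l.length = m ∧
      (s 0 :: l).IsChain R := by
  induction m with
  | zero => exact fun s _ => ⟨[], rfl, by simp⟩
  | succ m ih =>
    intro s hs
    obtain ⟨l, hl, hc⟩ := ih (fun i => s (i + 1)) fun i hi => hs (i + 1) (by omega)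
    exact ⟨s 1 :: l, by simp [hl], List.isChain_cons_cons.2 ⟨hs 0 (by omega), hc⟩⟩

theorem disc_mem_longChain_of_walk {M : ℕ} [NeZero M] {n m : ℕ} {U : Labels d}
    (hinj : Function.Injective (disc M (boxEdges d (n + m)) U)) {x : ℕ → Fin d → ℤ}
    (h : ∀ i, (lattice d).Adj (x i) (x (i + 1)))
    (hmono : StrictMono (fun i => U (edge (h i))) ∨ StrictAnti (fun i => U (edge (h i))))
    (h0 : norm1 (x 0) + 1 ≤ n) :
    disc M (boxEdges d (n + m)) U ∈
      longChain (boxEnds d (n + m)) M m (innerEdges d (n + m) n) := by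
  have hx : ∀ i, norm1 (x i) + 1 ≤ n + i := by
    intro i
    induction i with
    | zero => simpa using h0
    | succ i ih =>
      have := norm1_le_of_adj (h i)
      push_cast
      linarith
  have hmem : ∀ i, edge (h i) ∈ boxEdges d (n + i) := fun i =>
    edge_mem_boxEdges _ (by push_cast; linarith [hx i])
      (by push_cast; linarith [hx i, norm1_le_of_adj (h i)])
  let s : ℕ → boxEdges d (n + m) := fun i =>
    ⟨edge (h (min i m)), boxEdges_mono (by omega) (hmem _)⟩
  have hs : ∀ i ≤ m, (s i).1 = edge (h i) := fun i hi => by simp only [s, min_eq_left hi]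
  have hadj : ∀ i < m, Adjacent (boxEnds d (n + m)) (s i) (s (i + 1)) := by
    intro i hi
    refine ⟨x (i + 1), ?_, ?_⟩
    · change x (i + 1) ∈ (s i).1.1
      rw [hs i hi.le]
      simp
    · change x (i + 1) ∈ (s (i + 1)).1.1
      rw [hs (i + 1) hi]
      simp
  have h0' : s 0 ∈ innerEdges d (n + m) n := by
    rw [mem_innerEdges, hs 0 (Nat.zero_le _)]
    exact hmem 0
  rcases hmono with hmono | hmono
  · obtain ⟨l, hl, hc⟩ := exists_chain_of_seq (R := fun f g => Adjacent (boxEnds d (n + m)) f g ∧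
      Lt (disc M (boxEdges d (n + m)) U) f g) m s fun i hi => ⟨hadj i hi, by
        rw [lt_disc_iff hinj, hs i hi.le, hs (i + 1) hi]
        exact hmono (Nat.lt_succ_self i)⟩
    exact ⟨s 0, h0', l, hl, hc.imp fun _ _ h => h.1, Or.inl (hc.imp fun _ _ h => h.2)⟩
  · obtain ⟨l, hl, hc⟩ := exists_chain_of_seq (R := fun f g => Adjacent (boxEnds d (n + m)) f g ∧
      Lt (disc M (boxEdges d (n + m)) U) g f) m s fun i hi => ⟨hadj i hi, by
        rw [lt_disc_iff hinj, hs i hi.le, hs (i + 1) hi]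
        exact hmono (Nat.lt_succ_self i)⟩
    exact ⟨s 0, h0', l, hl, hc.imp fun _ _ h => h.1, Or.inr
      (List.isChain_reverse.2 (hc.imp fun _ _ h => h.2))⟩

/-- Almost surely, the labels are distinct and there is no infinite monotone walk. -/
theorem P_compl_Omega : P d (Omega d)ᶜ = 0 := by
  let A : ℕ → Set (Labels d) := fun n => {U | (∃ e ∈ boxEdges d n, ∃ f ∈ boxEdges d n, e ≠ f ∧
      U e = U f) ∨ ∃ (x : ℕ → Fin d → ℤ) (h : ∀ i, (lattice d).Adj (x i) (x (i + 1))),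
      norm1 (x 0) + 1 ≤ n ∧
      (StrictMono (fun i => U (edge (h i))) ∨ StrictAnti (fun i => U (edge (h i))))}
  have hsub : (Omega d)ᶜ ⊆ ⋃ n, A n := by
    intro U hU
    rw [Set.mem_compl_iff, Omega, Set.mem_ofPred_eq, not_and_or, not_not] at hU
    rcases hU with hU | ⟨x, h, hU⟩
    · simp only [Function.Injective, not_forall] at hU
      obtain ⟨e, f, hef, hne⟩ := hU
      have hex : ∀ e : Edge d, ∃ n, e ∈ boxEdges d n := by
        intro e
        obtain ⟨x, hx⟩ : ∃ x, x ∈ e.1 := ⟨_, Sym2.out_fst_mem _⟩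
        refine ⟨(norm1 x + 1).toNat, mem_boxEdges.2 fun y hy => ?_⟩
        have := norm1_le_of_mem_edge hx hy
        omega
      obtain ⟨n, hn⟩ := hex e
      obtain ⟨n', hn'⟩ := hex f
      exact Set.mem_iUnion.2 ⟨max n n', Or.inl ⟨e, boxEdges_mono (le_max_left _ _) hn, f,
        boxEdges_mono (le_max_right _ _) hn', hne, hef⟩⟩
    · exact Set.mem_iUnion.2 ⟨(norm1 (x 0) + 1).toNat, Or.inr ⟨x, h, by omega, hU⟩⟩
  refine measure_mono_null hsub (measure_iUnion_null fun n => ?_)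
  rw [← measureReal_eq_zero_iff]
  refine le_antisymm (le_of_forall_pos_le_add fun ε hε => ?_) measureReal_nonneg
  obtain ⟨m, M₀, hM⟩ := exists_P_badSet_le (d := d) n hε
  rw [zero_add]
  -- Two equal labels in the small box, or an infinite monotone walk starting there, force the
  -- discretised labels into `badSet`. The threshold plays no role here, so `j = 0` serves as well
  -- as any.
  refine le_trans (measureReal_mono fun U hU => ?_) (hM (M₀ + 1) (by omega) 0)
  by_cases hinj : Function.Injective (disc (M₀ + 1) (boxEdges d (n + m)) U)
  · rcases hU with ⟨e, he, f, hf, hne, hef⟩ | ⟨x, h, h0, hU⟩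
    · refine absurd (@hinj ⟨e, boxEdges_mono (Nat.le_add_right _ _) he⟩
        ⟨f, boxEdges_mono (Nat.le_add_right _ _) hf⟩ ?_) fun h => hne (congrArg Subtype.val h)
      simp only [disc, hef]
    · exact Or.inr (disc_mem_longChain_of_walk hinj h hU h0)
  · exact Or.inl (Or.inl hinj)

end AlmostSure

/-! ### Translations -/

section Translation

variable {d : ℕ}

theorem lattice_adj_add {x y : Fin d → ℤ} (z : Fin d → ℤ) :
    (lattice d).Adj (x + z) (y + z) ↔ (lattice d).Adj x y := by
  change norm1 _ = 1 ↔ norm1 _ = 1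
  rw [add_sub_add_right_eq_sub]

/-- The translation of edges by `z`. -/
def shiftEdge (z : Fin d → ℤ) : Edge d ≃ Edge d where
  toFun e := ⟨e.1.map (· + z), by
    obtain ⟨e, he⟩ := e
    induction e with
    | _ x y => exact (lattice_adj_add z).2 he⟩
  invFun e := ⟨e.1.map (· - z), by
    obtain ⟨e, he⟩ := e
    induction e with
    | _ x y =>
      rw [SimpleGraph.mem_edgeSet] at he
      simp only [sub_eq_add_neg]
      exact (lattice_adj_add (-z)).2 he⟩
  left_inv e := Subtype.ext (by simp [Sym2.map_map])
  right_inv e := Subtype.ext (by simp [Sym2.map_map])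

theorem add_mem_shiftEdge {z x : Fin d → ℤ} {e : Edge d} :
    x + z ∈ (shiftEdge z e).1 ↔ x ∈ e.1 := by
  change x + z ∈ e.1.map (· + z) ↔ _
  simp [Sym2.mem_map]

theorem mem_shiftEdge {z x : Fin d → ℤ} {e : Edge d} :
    x ∈ (shiftEdge z e).1 ↔ x - z ∈ e.1 := by
  rw [← add_mem_shiftEdge (z := z) (x := x - z), sub_add_cancel]

theorem shiftEdge_edge (z : Fin d → ℤ) {x y : Fin d → ℤ} (h : (lattice d).Adj x y) :
    shiftEdge z (edge h) = edge ((lattice_adj_add z).2 h) := rfl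

/-- The translated labels. -/
def shiftLabels (z : Fin d → ℤ) (U : Labels d) : Labels d := fun e => U (shiftEdge z e)

theorem measurable_shiftLabels (z : Fin d → ℤ) : Measurable (shiftLabels z) :=
  measurable_pi_lambda _ fun e => measurable_pi_apply (shiftEdge z e)

theorem map_shiftLabels (z : Fin d → ℤ) : (P d).map (shiftLabels z) = P d := by
  refine Measure.eq_infinitePi _ fun s t ht => ?_
  rw [Measure.map_apply (measurable_shiftLabels z)
    (MeasurableSet.pi s.countable_toSet fun i _ => ht i)]
  have h1 : shiftLabels z ⁻¹' (Set.pi s t) =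
      Set.pi (s.map (shiftEdge z).toEmbedding) (fun e => t ((shiftEdge z).symm e)) := by
    ext U
    simp only [Set.mem_preimage, Set.mem_pi, Finset.coe_map, Set.forall_mem_image]
    simp [shiftLabels]
  rw [h1, P, Measure.infinitePi_pi _ fun i _ => ht _, Finset.prod_map]
  simp

theorem shiftLabels_mem_Omega {z : Fin d → ℤ} {U : Labels d} (hU : U ∈ Omega d) :
    shiftLabels z U ∈ Omega d := by
  refine ⟨hU.1.comp (shiftEdge z).injective, ?_⟩
  rintro ⟨x, h, hm⟩
  exact hU.2 ⟨fun i => x i + z, fun i => (lattice_adj_add z).2 (h i), hm⟩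

theorem succeeds_shiftLabels {κ : ℕ} {z : Fin d → ℤ} {U : Labels d} (hU : U ∈ Omega d)
    (e : Edge d) : Succeeds κ (shiftLabels z U) (shiftLabels_mem_Omega hU) e ↔
      Succeeds κ U hU (shiftEdge z e) := by
  induction e using (precedes_wellFounded (shiftLabels_mem_Omega (z := z) hU)).induction with
  | _ e ih =>
  rw [succeeds_iff, succeeds_iff]
  have key : ∀ x ∈ e.1,
      {f : Edge d | x + z ∈ f.1 ∧ U f < U (shiftEdge z e) ∧ Succeeds κ U hU f} =
      shiftEdge z '' {f : Edge d | x ∈ f.1 ∧ shiftLabels z U f < shiftLabels z U e ∧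
        Succeeds κ (shiftLabels z U) (shiftLabels_mem_Omega hU) f} := by
    intro x hx
    ext f
    obtain ⟨f, rfl⟩ := (shiftEdge z).surjective f
    rw [(shiftEdge z).injective.mem_set_image]
    constructor
    · rintro ⟨h1, h2, h3⟩
      have h1' := add_mem_shiftEdge.1 h1
      exact ⟨h1', h2, (ih f ⟨h2, x, hx, h1'⟩).2 h3⟩
    · rintro ⟨h1, h2, h3⟩
      exact ⟨add_mem_shiftEdge.2 h1, h2, (ih f ⟨h2, x, hx, h1⟩).1 h3⟩
  constructor
  · intro h x hx
    have hx' := mem_shiftEdge.1 hx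
    have := h _ hx'
    rw [← Set.ncard_image_of_injective _ (shiftEdge z).injective, ← key _ hx',
      sub_add_cancel] at this
    exact this
  · intro h x hx
    have := h _ (add_mem_shiftEdge.2 hx)
    rwa [key x hx, Set.ncard_image_of_injective _ (shiftEdge z).injective] at this

theorem shiftLabels_mem_connEvent {κ : ℕ} {p : ℝ} {z x y : Fin d → ℤ} {U : Labels d}
    (h : U ∈ connEvent κ p x y) : shiftLabels z U ∈ connEvent κ p (x - z) (y - z) := by
  obtain ⟨hU, hr⟩ := h
  refine ⟨shiftLabels_mem_Omega hU, ?_⟩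
  rw [SimpleGraph.reachable_iff_reflTransGen] at hr ⊢
  refine hr.lift (fun v => v - z) ?_
  rintro a b ⟨hab, ho⟩
  have hab' : (lattice d).Adj (a - z) (b - z) := by
    rw [sub_eq_add_neg, sub_eq_add_neg]
    exact (lattice_adj_add (-z)).2 hab
  have he : shiftEdge z (edge hab') = edge hab := by
    rw [shiftEdge_edge]
    exact Subtype.ext (by simp)
  refine ⟨hab', ?_, ?_⟩
  · change (U (shiftEdge z (edge hab')) : ℝ) ≤ p
    rw [he]
    exact ho.1
  · rw [succeeds_shiftLabels, he]
    exact ho.2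

theorem connEvent_subset_armEvent {κ k : ℕ} {p : ℝ} {y : Fin d → ℤ} (hk : (k : ℤ) ≤ norm1 y) :
    connEvent κ p 0 y ⊆ armEvent κ p 0 k := by
  rintro U ⟨hU, hr⟩
  rw [SimpleGraph.reachable_iff_reflTransGen] at hr
  obtain ⟨w, hw, hr', -⟩ := exists_hit_of_reflTransGen (f := norm1) (k := k)
    (fun x y h => norm1_le_of_adj h.1) hr (by rw [norm1_zero]; positivity) hk
  refine Set.mem_iUnion₂.2 ⟨w, hw, hU, ?_⟩
  rw [SimpleGraph.reachable_iff_reflTransGen]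
  exact Relation.ReflTransGen.mono (fun x y h => h.1) _ _ hr'

theorem armEvent_anti {κ k n : ℕ} {p : ℝ} (h : k ≤ n) :
    armEvent κ p (0 : Fin d → ℤ) n ⊆ armEvent κ p 0 k :=
  Set.iUnion₂_subset fun y hy => connEvent_subset_armEvent (by
    rw [show norm1 y = n from hy]; exact_mod_cast h)

/-- `A` is not assumed measurable, so only this inequality is at hand; it is the direction that is
needed. -/
theorem P_real_preimage_shiftLabels_le (z : Fin d → ℤ) (A : Set (Labels d)) :
    (P d).real (shiftLabels z ⁻¹' A) ≤ (P d).real A := by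
  have h1 := Measure.le_map_apply (measurable_shiftLabels z).aemeasurable (μ := P d) A
  rw [map_shiftLabels] at h1
  exact ENNReal.toReal_mono (measure_ne_top _ _) h1

/-- The connection from `z` to a sphere is not more likely than that of the origin to the sphere
with the radius given by the distance. -/
theorem P_armEvent_le (κ : ℕ) (p : ℝ) (z : Fin d → ℤ) (k : ℕ) :
    (P d).real (armEvent κ p z k) ≤ thetaN d κ ((k : ℤ) - norm1 z).natAbs p := by
  rw [thetaN_eq]
  refine le_trans (measureReal_mono ?_) (P_real_preimage_shiftLabels_le z _)
  refine Set.iUnion₂_subset fun y hy U hU => ?_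
  have h1 := shiftLabels_mem_connEvent (z := z) hU
  rw [sub_self] at h1
  refine connEvent_subset_armEvent ?_ h1
  have hy' : norm1 y = k := hy
  have h2 := norm1_add_le (y - z) z
  have h3 := norm1_add_le y (-(y - z))
  rw [norm1_neg] at h3
  simp only [sub_add_cancel, neg_sub, add_sub_cancel] at h2 h3
  omega

end Translation

/-! ### Basic properties of the one-arm probabilities -/

section OneArm

variable {d κ : ℕ}

theorem thetaN_nonneg (n : ℕ) (p : ℝ) : 0 ≤ thetaN d κ n p := measureReal_nonneg

theorem thetaN_le_one (n : ℕ) (p : ℝ) : thetaN d κ n p ≤ 1 := measureReal_le_one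

theorem thetaN_anti (p : ℝ) : Antitone fun n => thetaN d κ n p := fun _ _ h =>
  measureReal_mono (armEvent_anti h) (measure_ne_top _ _)

theorem openGraph_mono {p q : ℝ} (h : p ≤ q) {U : Labels d} (hU : U ∈ Omega d) :
    openGraph κ p U hU ≤ openGraph κ q U hU := fun _ _ ⟨hxy, ho⟩ => ⟨hxy, ho.1.trans h, ho.2⟩

theorem connEvent_mono {p q : ℝ} (h : p ≤ q) (x y : Fin d → ℤ) :
    connEvent κ p x y ⊆ connEvent κ q x y := fun _ ⟨hU, hr⟩ => ⟨hU, hr.mono (openGraph_mono h hU)⟩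

theorem thetaN_mono (n : ℕ) : Monotone (thetaN d κ n) := fun _ _ h =>
  measureReal_mono (Set.iUnion₂_mono fun _ _ => connEvent_mono h _ _) (measure_ne_top _ _)

theorem P_real_Omega : (P d).real (Omega d) = 1 := by
  have h : P d (Omega d) = 1 := by
    rw [← measure_univ (μ := P d)]
    exact measure_congr (Filter.eventuallyEq_univ.2 (mem_ae_iff.2 P_compl_Omega))
  rw [measureReal_def, h, ENNReal.toReal_one]

theorem thetaN_zero (p : ℝ) : thetaN d κ 0 p = 1 := by
  refine le_antisymm (thetaN_le_one _ _) ?_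
  rw [← P_real_Omega (d := d)]
  exact measureReal_mono (fun U hU => Set.mem_iUnion₂.2 ⟨0, by
    simp [norm1_zero], hU, SimpleGraph.Reachable.refl _⟩) (measure_ne_top _ _)

/-- If every edge at the origin has a label above `p`, none of them is open at time `p`. -/
theorem thetaN_one_le {p : ℝ} (hp0 : 0 ≤ p) (hp : p ≤ 1) :
    thetaN d κ 1 p ≤ 1 - (1 - p) ^ (finite_edges_at (0 : Fin d → ℤ)).toFinset.card := by
  let q : unitInterval := ⟨p, hp0, hp⟩
  let F : Finset (Edge d) := (finite_edges_at (0 : Fin d → ℤ)).toFinset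
  let A : Set (Labels d) := Set.pi F fun _ => Set.Ioi q
  have hA : MeasurableSet A := MeasurableSet.pi F.countable_toSet fun _ _ => measurableSet_Ioi
  have hPA : (P d).real A = (1 - p) ^ F.card := by
    have : P d A = ENNReal.ofReal (1 - p) ^ F.card := by
      rw [P, Measure.infinitePi_pi _ fun _ _ => measurableSet_Ioi]
      simp [q]
    rw [measureReal_def, this, ENNReal.toReal_pow, ENNReal.toReal_ofReal (by linarith)]
  have hsub : armEvent κ p (0 : Fin d → ℤ) 1 ⊆ Aᶜ := by
    intro U hU hUA
    obtain ⟨y, hy, hU, hr⟩ := Set.mem_iUnion₂.1 hU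
    rw [SimpleGraph.reachable_iff_reflTransGen] at hr
    rcases hr.cases_head with h | ⟨w, ⟨hw, ho⟩, -⟩
    · rw [← h] at hy
      have : norm1 (0 : Fin d → ℤ) = (1 : ℕ) := hy
      simp [norm1_zero] at this
    · have h1 : edge hw ∈ F := by simp [F]
      have h2 : q < U (edge hw) := hUA _ (Finset.mem_coe.2 h1)
      exact absurd ho.1 (not_le.2 h2)
  have h1 : thetaN d κ 1 p ≤ (P d).real Aᶜ := measureReal_mono hsub
  rwa [probReal_compl_eq_one_sub hA, hPA] at h1

/-- With positive probability, no edge at the origin is open. -/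
theorem thetaN_one_lt_one {p : ℝ} (hp0 : 0 ≤ p) (hp : p < 1) : thetaN d κ 1 p < 1 := by
  have h1 := thetaN_one_le (d := d) (κ := κ) hp0 hp.le
  have h2 : 0 < (1 - p) ^ (finite_edges_at (0 : Fin d → ℤ)).toFinset.card :=
    pow_pos (by linarith) _
  linarith

theorem thetaN_at_zero {n : ℕ} (hn : 1 ≤ n) : thetaN d κ n 0 = 0 := by
  refine le_antisymm ((thetaN_anti 0 hn).trans ?_) (thetaN_nonneg _ _)
  simpa using thetaN_one_le (d := d) (κ := κ) (p := 0) le_rfl zero_le_one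

end OneArm

/-! ### The differential inequality -/

section Transfer

variable {d κ M : ℕ} [NeZero M] {n m j : ℕ} {p : ℝ}

variable (d M n m j) in
/-- The probability that the discretisation is inaccurate. -/
def badProb : ℝ := (P d).real (disc M (boxEdges d (n + m)) ⁻¹'
  badSet (boxEnds d (n + m)) M m j (innerEdges d (n + m) n))

variable (d κ M n m j) in
/-- The probability of the discretised one-arm event. -/
def crossProb : ℝ := (P d).real (disc M (boxEdges d (n + m)) ⁻¹'
  cross (boxEnds d (n + m)) κ M 0 (sphere d n) j)

theorem P_real_le_add_badProb {A B : Set (Labels d)}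
    (h : ∀ U ∈ A, U ∈ Omega d → disc M (boxEdges d (n + m)) U ∉
      badSet (boxEnds d (n + m)) M m j (innerEdges d (n + m) n) → U ∈ B) :
    (P d).real A ≤ (P d).real B + badProb d M n m j := by
  set C := disc M (boxEdges d (n + m)) ⁻¹'
    badSet (boxEnds d (n + m)) M m j (innerEdges d (n + m) n) with hC
  have hsub : A ⊆ (B ∪ C) ∪ (Omega d)ᶜ := by
    intro U hU
    by_cases h1 : U ∈ Omega d
    · by_cases h2 : U ∈ C
      · exact Or.inl (Or.inr h2)
      · exact Or.inl (Or.inl (h U hU h1 h2))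
    · exact Or.inr h1
  have h0 : (P d).real (Omega d)ᶜ = 0 := by rw [measureReal_def, P_compl_Omega, ENNReal.toReal_zero]
  have h1 := measureReal_mono hsub (measure_ne_top (P d) _)
  have h2 := measureReal_union_le (μ := P d) (B ∪ C) (Omega d)ᶜ
  have h3 := measureReal_union_le (μ := P d) B C
  have h4 : (P d).real C = badProb d M n m j := rfl
  linarith

theorem abs_crossProb_sub_le (hj : p * M ≤ j) (hj' : (j : ℝ) < p * M + 1) :
    |crossProb d κ M n m j - thetaN d κ n p| ≤ badProb d M n m j := by
  rw [abs_le]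
  constructor
  · have : thetaN d κ n p ≤ crossProb d κ M n m j + badProb d M n m j :=
      P_real_le_add_badProb fun U hU _ hg => disc_mem_cross_of_mem_armEvent hj hj' hg hU
    linarith
  · have : crossProb d κ M n m j ≤ thetaN d κ n p + badProb d M n m j :=
      P_real_le_add_badProb fun U hU hO hg => mem_armEvent_of_disc_mem_cross hj hj' hO hg hU
    linarith

theorem P_touched_le (hj : p * M ≤ j) (hj' : (j : ℝ) < p * M + 1) (k : ℕ)
    {e : boxEdges d (n + m)} {x y : Fin d → ℤ} (he : e.1.1 = s(x, y)) :
    (P d).real (disc M (boxEdges d (n + m)) ⁻¹' touched (boxEnds d (n + m)) κ M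
      (innerEdges d (n + m) n : Set (boxEdges d (n + m))) (sphere d k) j e) ≤
      thetaN d κ ((k : ℤ) - norm1 x).natAbs p + thetaN d κ ((k : ℤ) - norm1 y).natAbs p +
        badProb d M n m j := by
  have h1 := P_real_le_add_badProb (M := M) (n := n) (m := m) (j := j)
    (A := disc M (boxEdges d (n + m)) ⁻¹' touched (boxEnds d (n + m)) κ M
      (innerEdges d (n + m) n : Set (boxEdges d (n + m))) (sphere d k) j e)
    (B := armEvent κ p x k ∪ armEvent κ p y k) fun U hU hO hg => by
      obtain ⟨z, hz, h⟩ := exists_mem_armEvent_of_disc_mem_touched hj hj' hO hg hU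
      rw [he, Sym2.mem_iff] at hz
      rcases hz with rfl | rfl
      · exact Or.inl h
      · exact Or.inr h
  have h2 := measureReal_union_le (μ := P d) (armEvent κ p x k) (armEvent κ p y k)
  linarith [P_armEvent_le κ p x k, P_armEvent_le κ p y k]

theorem cross_mono {V E : Type*} [Fintype E] [LinearOrder E] {ends : E → Sym2 V} {κ M : ℕ} {a : V}
    {T : Set V} {i j : ℕ} (h : i ≤ j) : cross ends κ M a T i ⊆ cross ends κ M a T j :=
  fun u ⟨t, ht, hr⟩ => ⟨t, ht, hr.mono (openSet_mono h u)⟩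

theorem touched_mono {V E : Type*} [Fintype E] [LinearOrder E] {ends : E → Sym2 V} {κ M : ℕ}
    {E₀ : Set E} {T : Set V} {i j : ℕ} (h : i ≤ j) (e : E) :
    touched ends κ M E₀ T i e ⊆ touched ends κ M E₀ T j e :=
  fun u ⟨x, hx, t, ht, hr⟩ => ⟨x, hx, t, ht,
    hr.mono (Set.inter_subset_inter_left _ (openSet_mono h u))⟩

theorem crossProb_mono {i j : ℕ} (h : i ≤ j) : crossProb d κ M n m i ≤ crossProb d κ M n m j :=
  measureReal_mono (Set.preimage_mono (cross_mono h)) (measure_ne_top _ _)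

end Transfer

/-- The radii `k ≥ a` and `k < a` are treated separately: on each side the distances to `a` are
distinct, and as `g` is antitone, each part is at most the sum over the smallest distances. -/
theorem sum_natAbs_sub_le {g : ℕ → ℝ} (hg : Antitone g) (hg0 : ∀ i, 0 ≤ g i) (n : ℕ) {a : ℤ}
    (ha : 0 ≤ a) :
    ∑ k ∈ Finset.range n, g ((k : ℤ) - a).natAbs ≤ 2 * ∑ k ∈ Finset.range n, g k := by
  lift a to ℕ using ha
  have hsub : ∀ r ≤ n, ∑ k ∈ Finset.range r, g k ≤ ∑ k ∈ Finset.range n, g k := fun r hr =>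
    Finset.sum_le_sum_of_subset_of_nonneg (Finset.range_mono hr) fun i _ _ => hg0 i
  have h1 : ∑ k ∈ Finset.range (min a n), g ((k : ℤ) - a).natAbs ≤ ∑ k ∈ Finset.range n, g k := by
    refine le_trans ?_ (hsub (min a n) (min_le_right _ _))
    rw [← Finset.sum_range_reflect]
    refine Finset.sum_le_sum fun k hk => hg ?_
    have := Finset.mem_range.1 hk
    omega
  have h2 : ∑ k ∈ Finset.Ico (min a n) n, g ((k : ℤ) - a).natAbs ≤ ∑ k ∈ Finset.range n, g k := by
    rw [Finset.sum_Ico_eq_sum_range]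
    refine le_trans ?_ (hsub (n - min a n) (by omega))
    refine Finset.sum_le_sum fun k hk => hg ?_
    have := Finset.mem_range.1 hk
    omega
  have h3 := Finset.sum_range_add_sum_Ico (fun k : ℕ => g ((k : ℤ) - a).natAbs) (min_le_right a n)
  linarith

section Inequality

variable {d κ : ℕ}

variable (d κ) in
/-- The partial sums of the one-arm probabilities. -/
def armSum (n : ℕ) (p : ℝ) : ℝ := ∑ k ∈ Finset.range n, thetaN d κ k p

theorem armSum_nonneg (n : ℕ) (p : ℝ) : 0 ≤ armSum d κ n p :=
  Finset.sum_nonneg fun _ _ => thetaN_nonneg _ _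

/-- An edge has two ends, and for each the sum over the radii is at most twice `armSum`, whence the
factor 4. The touching events at level `i` are enlarged to level `j`, so that the bound is the same
for all `i ≤ j`. -/
theorem crossProb_step {M : ℕ} [NeZero M] {n m j i : ℕ} {p c : ℝ} (hκ : 2 ≤ κ) (hc : 0 < c)
    (hc1 : c ≤ 1) (hM : Fintype.card (boxEdges d (n + m)) ≤ M) (hi : c * M ≤ i)
    (hi1 : (i : ℝ) + 1 + c * M ≤ M) (hij : i ≤ j) (hj : p * M ≤ j) (hj' : (j : ℝ) < p * M + 1) :
    n * (crossProb d κ M n m i * (1 - crossProb d κ M n m i)) ≤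
      16 * chainConst (nbrBound d) c ^ 2 * (4 * armSum d κ n p + n * badProb d M n m j) * M *
        (crossProb d κ M n m (i + 1) - crossProb d κ M n m i +
          (Fintype.card (boxEdges d (n + m)) : ℝ) ^ 2 / M ^ 2) := by
  have hM0 : (0 : ℝ) < M := by exact_mod_cast NeZero.pos M
  have hN : (0 : ℝ) < (M : ℝ) ^ (boxEdges d (n + m)).card := by positivity
  have hβ : 0 ≤ badProb d M n m j := measureReal_nonneg
  have h1 := finite_differential_inequality (κ := κ) (Finset.range n) hκ one_le_nbrBound
    (card_nbrs_box_le (d := d) (n + m)) hc hc1 (NeZero.pos M) hM hi hi1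
    (innerEdges d (n + m) n : Set (boxEdges d (n + m))) 0 (sphere d n) (fun k => sphere d k)
    (fun ω => box_sep (n + m) n ω)
    (fun k hk ω => box_thru (Finset.mem_range.1 hk).le _)
    (χ := 4 * armSum d κ n p + n * badProb d M n m j)
    (by have := armSum_nonneg (d := d) (κ := κ) n p; positivity)
    (by
      intro e
      rw [card_discLabels]
      obtain ⟨x, y, hxy⟩ : ∃ x y, e.1.1 = s(x, y) := by
        induction h : e.1.1 with
        | _ x y => exact ⟨x, y, rfl⟩
      have h2 : ∀ k ∈ Finset.range n, ((touched (boxEnds d (n + m)) κ M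
          (innerEdges d (n + m) n : Set (boxEdges d (n + m))) (sphere d k) i e).ncard : ℝ) ≤
          (thetaN d κ ((k : ℤ) - norm1 x).natAbs p + thetaN d κ ((k : ℤ) - norm1 y).natAbs p +
        badProb d M n m j) * (M : ℝ) ^ (boxEdges d (n + m)).card := by
        intro k _
        rw [ncard_eq_P_disc]
        refine mul_le_mul_of_nonneg_right (le_trans ?_ (P_touched_le hj hj' k hxy)) hN.le
        exact measureReal_mono (Set.preimage_mono (touched_mono hij e)) (measure_ne_top _ _)
      refine (Finset.sum_le_sum h2).trans ?_
      rw [← Finset.sum_mul]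
      refine mul_le_mul_of_nonneg_right ?_ hN.le
      rw [Finset.sum_add_distrib, Finset.sum_add_distrib, Finset.sum_const, Finset.card_range,
        nsmul_eq_mul]
      have h3 := sum_natAbs_sub_le (thetaN_anti (d := d) (κ := κ) p)
        (fun i => thetaN_nonneg i p) n (norm1_nonneg x)
      have h4 := sum_natAbs_sub_le (thetaN_anti (d := d) (κ := κ) p)
        (fun i => thetaN_nonneg i p) n (norm1_nonneg y)
      simp only [armSum]
      linarith)
  rw [card_discLabels, ncard_eq_P_disc, ncard_eq_P_disc, Finset.card_range] at h1
  refine le_of_mul_le_mul_right ?_ (mul_pos hN hN)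
  simp only [crossProb]
  refine le_trans (le_of_eq ?_) (h1.trans (le_of_eq ?_)) <;> ring

/-- The discrete derivatives telescope from `ja` to `jb`, and monotonicity bounds each left-hand
side from below by its value at the extreme levels. At most `M` tie errors of order `1 / M ^ 2` add
up to order `1 / M`. -/
theorem crossProb_sum {M : ℕ} [NeZero M] {n m ja jb : ℕ} {p c : ℝ} (hκ : 2 ≤ κ) (hc : 0 < c)
    (hc1 : c ≤ 1) (hM : Fintype.card (boxEdges d (n + m)) ≤ M) (hja : c * M ≤ ja)
    (hjb : (jb : ℝ) + c * M ≤ M) (hab : ja ≤ jb) (hj : p * M ≤ jb) (hj' : (jb : ℝ) < p * M + 1) :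
    ((jb : ℝ) - ja) / M *
        (n * (crossProb d κ M n m ja * (1 - crossProb d κ M n m jb))) ≤
      16 * chainConst (nbrBound d) c ^ 2 * (4 * armSum d κ n p + n * badProb d M n m jb) *
        (crossProb d κ M n m jb - crossProb d κ M n m ja +
          (Fintype.card (boxEdges d (n + m)) : ℝ) ^ 2 / M) := by
  have hM0 : (0 : ℝ) < M := by exact_mod_cast NeZero.pos M
  have hβ : 0 ≤ badProb d M n m jb := measureReal_nonneg
  have hS := armSum_nonneg (d := d) (κ := κ) n p
  set K : ℝ := 16 * chainConst (nbrBound d) c ^ 2 * (4 * armSum d κ n p + n * badProb d M n m jb)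
  have hK : 0 ≤ K := by positivity
  set q : ℕ → ℝ := crossProb d κ M n m with hq
  set ε : ℝ := (Fintype.card (boxEdges d (n + m)) : ℝ) ^ 2 with hε
  have hstep : ∀ i ∈ Finset.Ico ja jb, n * (q ja * (1 - q jb)) ≤
      K * M * (q (i + 1) - q i + ε / M ^ 2) := by
    intro i hi
    obtain ⟨h1, h2⟩ := Finset.mem_Ico.1 hi
    have h1' : (ja : ℝ) ≤ i := by exact_mod_cast h1
    have h2' : (i : ℝ) + 1 ≤ jb := by exact_mod_cast h2
    refine le_trans ?_ (crossProb_step hκ hc hc1 hM (by linarith) (by linarith) h2.le hj hj')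
    have h3 : q ja ≤ q i := crossProb_mono h1
    have h4 : q i ≤ q jb := crossProb_mono h2.le
    have h5 : q jb ≤ 1 := measureReal_le_one
    have h6 : 0 ≤ q ja := measureReal_nonneg
    have h7 : q ja * (1 - q jb) ≤ q i * (1 - q i) :=
      mul_le_mul h3 (by linarith) (by linarith) (by linarith)
    exact mul_le_mul_of_nonneg_left h7 (by positivity)
  have h1 := Finset.sum_le_sum hstep
  rw [Finset.sum_const, Nat.card_Ico, nsmul_eq_mul, Nat.cast_sub hab, ← Finset.mul_sum,
    Finset.sum_add_distrib, Finset.sum_Ico_sub q hab, Finset.sum_const, Nat.card_Ico, nsmul_eq_mul,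
    Nat.cast_sub hab] at h1
  have hja0 : (0 : ℝ) ≤ ja := by positivity
  have hjbM : (jb : ℝ) ≤ M := by nlinarith
  have h2 : ((jb : ℝ) - ja) * (ε / M ^ 2) ≤ ε / M := by
    have : ε / M = M * (ε / M ^ 2) := by field_simp
    rw [this]
    refine mul_le_mul_of_nonneg_right (by linarith) (by positivity)
  rw [div_mul_eq_mul_div, div_le_iff₀ hM0]
  calc _ ≤ K * M * (q jb - q ja + ((jb : ℝ) - ja) * (ε / M ^ 2)) := h1
    _ ≤ K * M * (q jb - q ja + ε / M) := by gcongr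
    _ = _ := by ring

theorem approximate_differential_inequality (hκ : 2 ≤ κ) {c a b : ℝ} (hc : 0 < c) (hc1 : c ≤ 1)
    (ha : c ≤ a) (hab : a ≤ b) (hb : b + 2 * c ≤ 1) (n : ℕ) {ε : ℝ} (hε : 0 < ε) :
    ∃ x y : ℝ, |x - thetaN d κ n a| ≤ ε ∧ |y - thetaN d κ n b| ≤ ε ∧
      (b - a - ε) * (n * (x * (1 - y))) ≤
        16 * chainConst (nbrBound d) c ^ 2 * (4 * armSum d κ n b + n * ε) * (y - x + ε) := by
  obtain ⟨m, M₀, hbad⟩ := exists_P_badSet_le (d := d) n hε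
  obtain ⟨M₁, hM₁⟩ := exists_nat_ge ((Fintype.card (boxEdges d (n + m)) : ℝ) ^ 2 / ε)
  obtain ⟨M₂, hM₂⟩ := exists_nat_ge (1 / c)
  obtain ⟨M₃, hM₃⟩ := exists_nat_ge (1 / ε)
  set M : ℕ := Fintype.card (boxEdges d (n + m)) + M₀ + M₁ + M₂ + M₃ + 1 with hM
  have : NeZero M := ⟨by omega⟩
  have hM0 : (0 : ℝ) < M := by exact_mod_cast NeZero.pos M
  -- Rounding `b * M` up may add one unit; this is at most `c * M`, which explains `2 * c` in the
  -- hypothesis on `b`.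
  have hcM : 1 ≤ c * M := by
    rw [div_le_iff₀ hc] at hM₂
    have : (M₂ : ℝ) ≤ M := by exact_mod_cast (by omega : M₂ ≤ M)
    nlinarith
  have hεM : 1 / M ≤ ε := by
    rw [div_le_iff₀ hM0]
    rw [div_le_iff₀ hε] at hM₃
    have : (M₃ : ℝ) ≤ M := by exact_mod_cast (by omega : M₃ ≤ M)
    nlinarith
  have hEM : (Fintype.card (boxEdges d (n + m)) : ℝ) ^ 2 / M ≤ ε := by
    rw [div_le_iff₀ hM0]
    rw [div_le_iff₀ hε] at hM₁
    have : (M₁ : ℝ) ≤ M := by exact_mod_cast (by omega : M₁ ≤ M)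
    nlinarith
  have haM : 0 ≤ a * M := by nlinarith
  have hbM : 0 ≤ b * M := by nlinarith
  have h1 : a * M ≤ ⌈a * M⌉₊ := Nat.le_ceil _
  have h1' : (⌈a * M⌉₊ : ℝ) < a * M + 1 := Nat.ceil_lt_add_one haM
  have h2 : b * M ≤ ⌈b * M⌉₊ := Nat.le_ceil _
  have h2' : (⌈b * M⌉₊ : ℝ) < b * M + 1 := Nat.ceil_lt_add_one hbM
  have hba : badProb d M n m ⌈a * M⌉₊ ≤ ε := hbad M (by omega) _
  have hbb : badProb d M n m ⌈b * M⌉₊ ≤ ε := hbad M (by omega) _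
  refine ⟨crossProb d κ M n m ⌈a * M⌉₊, crossProb d κ M n m ⌈b * M⌉₊,
    (abs_crossProb_sub_le h1 h1').trans hba, (abs_crossProb_sub_le h2 h2').trans hbb, ?_⟩
  have hle : ⌈a * M⌉₊ ≤ ⌈b * M⌉₊ := Nat.ceil_mono (by gcongr)
  have h3 := crossProb_sum (d := d) (κ := κ) (n := n) (m := m) (M := M) (p := b) hκ hc hc1
    (by omega) (ja := ⌈a * M⌉₊) (jb := ⌈b * M⌉₊) (by nlinarith) (by nlinarith) hle h2 h2'
  have hx0 : 0 ≤ crossProb d κ M n m ⌈a * M⌉₊ := measureReal_nonneg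
  have hy1 : crossProb d κ M n m ⌈b * M⌉₊ ≤ 1 := measureReal_le_one
  have hxy : crossProb d κ M n m ⌈a * M⌉₊ ≤ crossProb d κ M n m ⌈b * M⌉₊ := crossProb_mono hle
  have hβ : 0 ≤ badProb d M n m ⌈b * M⌉₊ := measureReal_nonneg
  have hS := armSum_nonneg (d := d) (κ := κ) n b
  refine le_trans (mul_le_mul_of_nonneg_right ?_
    (mul_nonneg (Nat.cast_nonneg n) (mul_nonneg hx0 (by linarith)))) (h3.trans ?_)
  · rw [le_div_iff₀ hM0]
    rw [div_le_iff₀ hM0] at hεM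
    nlinarith
  · have hy : 0 ≤ crossProb d κ M n m ⌈b * M⌉₊ - crossProb d κ M n m ⌈a * M⌉₊ := by linarith
    gcongr

/-- The integrated form of the differential inequality. -/
theorem differential_inequality (hκ : 2 ≤ κ) {c a b : ℝ} (hc : 0 < c) (hc1 : c ≤ 1)
    (ha : c ≤ a) (hab : a ≤ b) (hb : b + 2 * c ≤ 1) (n : ℕ) :
    (b - a) * (n * (thetaN d κ n a * (1 - thetaN d κ n b))) ≤
      64 * chainConst (nbrBound d) c ^ 2 * armSum d κ n b *
        (thetaN d κ n b - thetaN d κ n a) := by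
  have hpos : ∀ i : ℕ, (0 : ℝ) < 1 / ((i : ℝ) + 1) := fun i => by positivity
  choose x y hx hy h using fun i : ℕ =>
    approximate_differential_inequality (d := d) (κ := κ) hκ hc hc1 ha hab hb n (hpos i)
  have hε : Filter.Tendsto (fun i : ℕ => 1 / ((i : ℝ) + 1)) Filter.atTop (nhds 0) :=
    tendsto_one_div_add_atTop_nhds_zero_nat
  have hx' : Filter.Tendsto x Filter.atTop (nhds (thetaN d κ n a)) := by
    rw [tendsto_iff_norm_sub_tendsto_zero]
    exact squeeze_zero (fun _ => norm_nonneg _) hx hε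
  have hy' : Filter.Tendsto y Filter.atTop (nhds (thetaN d κ n b)) := by
    rw [tendsto_iff_norm_sub_tendsto_zero]
    exact squeeze_zero (fun _ => norm_nonneg _) hy hε
  have hl := ((tendsto_const_nhds (x := b - a)).sub hε).mul
    ((tendsto_const_nhds (x := (n : ℝ))).mul
      (hx'.mul ((tendsto_const_nhds (x := (1 : ℝ))).sub hy')))
  have hr := ((((hε.const_mul (n : ℝ)).const_add (4 * armSum d κ n b))).const_mul
    (16 * chainConst (nbrBound d) c ^ 2)).mul ((hy'.sub hx').add hε)
  have h1 := le_of_tendsto_of_tendsto' hl hr h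
  simp only [sub_zero, mul_zero, add_zero] at h1
  exact h1.trans (le_of_eq (by ring))

end Inequality

/-! ### Sharpness from the differential inequality -/

section Sharpness

variable {d κ : ℕ} {a₀ b₀ K : ℝ}

theorem armSum_succ (n : ℕ) (p : ℝ) :
    armSum d κ (n + 1) p = armSum d κ n p + thetaN d κ n p := Finset.sum_range_succ _ _

theorem armSum_one (p : ℝ) : armSum d κ 1 p = 1 := by simp [armSum, thetaN_zero]

theorem armSum_le_armSum_succ (n : ℕ) (p : ℝ) : armSum d κ n p ≤ armSum d κ (n + 1) p := by
  rw [armSum_succ]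
  linarith [thetaN_nonneg (d := d) (κ := κ) n p]

theorem one_le_armSum {n : ℕ} (hn : 1 ≤ n) (p : ℝ) : 1 ≤ armSum d κ n p := by
  induction n, hn using Nat.le_induction with
  | base => exact (armSum_one p).ge
  | succ n _ ih => exact ih.trans (armSum_le_armSum_succ n p)

theorem armSum_mono (n : ℕ) : Monotone (armSum d κ n) := fun _ _ h =>
  Finset.sum_le_sum fun k _ => thetaN_mono k h

variable (d κ a₀ b₀ K) in
/-- The differential inequality on an interval. -/
def DiffIneq : Prop := ∀ a b : ℝ, a₀ ≤ a → a ≤ b → b ≤ b₀ → ∀ n : ℕ,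
  (b - a) * (n * thetaN d κ n a) ≤ K * armSum d κ n b * (thetaN d κ n b - thetaN d κ n a)

theorem log_armSum_succ_sub_le (n : ℕ) (hn : 1 ≤ n) (p : ℝ) :
    Real.log (armSum d κ (n + 1) p) - Real.log (armSum d κ n p) ≤
      thetaN d κ n p / armSum d κ n p := by
  have h1 := one_le_armSum (d := d) (κ := κ) hn p
  have h0 := thetaN_nonneg (d := d) (κ := κ) n p
  rw [← Real.log_div (by rw [armSum_succ]; positivity) (by positivity)]
  refine (Real.log_le_sub_one_of_pos (by rw [armSum_succ]; positivity)).trans (le_of_eq ?_)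
  rw [armSum_succ]
  field_simp
  ring

/-- This replaces a derivative. `DiffIneq` involves the partial sum at `b`, the logarithmic
increment the one at `a`; the last term pays for the exchange and telescopes along a subdivision. -/
theorem step_log_armSum (H : DiffIneq d κ a₀ b₀ K) {a b : ℝ} (ha : a₀ ≤ a) (hab : a ≤ b)
    (hb : b ≤ b₀) {n : ℕ} (hn : 1 ≤ n) :
    (b - a) * (Real.log (armSum d κ (n + 1) a) - Real.log (armSum d κ n a)) ≤
      K * (thetaN d κ n b - thetaN d κ n a) / n +
        (b - a) * (1 / armSum d κ n a - 1 / armSum d κ n b) := by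
  have hn0 : (0 : ℝ) < n := by exact_mod_cast hn
  have hSa := one_le_armSum (d := d) (κ := κ) hn a
  have hSb := one_le_armSum (d := d) (κ := κ) hn b
  have h0 := thetaN_nonneg (d := d) (κ := κ) n a
  have h1 := thetaN_le_one (d := d) (κ := κ) n a
  have hS : 1 / armSum d κ n b ≤ 1 / armSum d κ n a :=
    one_div_le_one_div_of_le (by linarith) (armSum_mono n hab)
  have h2 : (b - a) * (thetaN d κ n a / armSum d κ n b) ≤
      K * (thetaN d κ n b - thetaN d κ n a) / n := by
    have := H a b ha hab hb n
    rw [← mul_div_assoc, div_le_div_iff₀ (by linarith) hn0]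
    linarith
  have h3 : thetaN d κ n a / armSum d κ n a - thetaN d κ n a / armSum d κ n b ≤
      1 / armSum d κ n a - 1 / armSum d κ n b := by
    rw [div_eq_mul_one_div (thetaN d κ n a), div_eq_mul_one_div (thetaN d κ n a) (armSum d κ n b)]
    nlinarith
  have h4 := log_armSum_succ_sub_le (d := d) (κ := κ) n hn a
  have h5 : (b - a) * (Real.log (armSum d κ (n + 1) a) - Real.log (armSum d κ n a)) ≤
      (b - a) * (thetaN d κ n a / armSum d κ n b +
        (1 / armSum d κ n a - 1 / armSum d κ n b)) :=
    mul_le_mul_of_nonneg_left (by linarith) (by linarith)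
  linarith [mul_add (b - a) (thetaN d κ n a / armSum d κ n b)
        (1 / armSum d κ n a - 1 / armSum d κ n b)]

/-- Cut `[a, b]` into `r` pieces and sum `step_log_armSum` over pieces and scales. The exchange
terms contribute at most one mesh size per scale, in all `n * (b - a) / r`, which vanishes as `r`
grows. -/
theorem log_armSum_le (H : DiffIneq d κ a₀ b₀ K) (hK : 0 ≤ K) {a b : ℝ} (ha : a₀ ≤ a) (hab : a ≤ b)
    (hb : b ≤ b₀) (n : ℕ) :
    (b - a) * Real.log (armSum d κ (n + 1) a) ≤
      K * ∑ i ∈ Finset.range n, thetaN d κ (i + 1) b / ((i + 1 : ℕ) : ℝ) := by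
  have key : ∀ r : ℕ, 1 ≤ r → (b - a) * Real.log (armSum d κ (n + 1) a) ≤
      K * ∑ i ∈ Finset.range n, thetaN d κ (i + 1) b / ((i + 1 : ℕ) : ℝ) +
        n * (b - a) / r := by
    intro r hr
    have hr0 : (0 : ℝ) < r := by exact_mod_cast hr
    set h : ℝ := (b - a) / r with hh
    have hh0 : 0 ≤ h := div_nonneg (by linarith) hr0.le
    set t : ℕ → ℝ := fun l => a + l * h with ht
    have ht0 : t 0 = a := by simp [ht]
    have htr : t r = b := by
      simp only [ht, hh]
      field_simp
      ring
    have htm : Monotone t := fun l l' hl => by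
      have : (l : ℝ) ≤ l' := by exact_mod_cast hl
      simp only [ht]
      gcongr
    have hts : ∀ l, t (l + 1) - t l = h := fun l => by
      simp only [ht]
      push_cast
      ring
    have h1 : ∀ i, ∑ l ∈ Finset.range r,
        h * (Real.log (armSum d κ (i + 1 + 1) (t l)) - Real.log (armSum d κ (i + 1) (t l))) ≤
        K * (thetaN d κ (i + 1) b / ((i + 1 : ℕ) : ℝ)) + h := by
      intro i
      have h2 : ∀ l ∈ Finset.range r,
          h * (Real.log (armSum d κ (i + 1 + 1) (t l)) - Real.log (armSum d κ (i + 1) (t l))) ≤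
          K / ((i + 1 : ℕ) : ℝ) * (thetaN d κ (i + 1) (t (l + 1)) - thetaN d κ (i + 1) (t l)) +
          h * ((-(1 / armSum d κ (i + 1) (t (l + 1)))) - (-(1 / armSum d κ (i + 1) (t l)))) := by
        intro l hl
        have := step_log_armSum H (a := t l) (b := t (l + 1))
          (by rw [← ht0] at ha; exact ha.trans (htm (Nat.zero_le _))) (htm (Nat.le_succ l))
          (by rw [← htr] at hb; exact (htm (Finset.mem_range.1 hl)).trans hb)
          (Nat.succ_le_succ (Nat.zero_le i))
        rw [hts] at this
        refine this.trans (le_of_eq ?_)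
        ring
      refine (Finset.sum_le_sum h2).trans ?_
      rw [Finset.sum_add_distrib, ← Finset.mul_sum, ← Finset.mul_sum,
        Finset.sum_range_sub (fun l => thetaN d κ (i + 1) (t l)),
        Finset.sum_range_sub (fun l => -(1 / armSum d κ (i + 1) (t l))), ht0, htr]
      have h3 := thetaN_nonneg (d := d) (κ := κ) (i + 1) a
      have h4 := one_le_armSum (d := d) (κ := κ) (n := i + 1) (by omega) a
      have h5 := one_le_armSum (d := d) (κ := κ) (n := i + 1) (by omega) b
      have h6 : 1 / armSum d κ (i + 1) a ≤ 1 := by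
        rw [div_le_one (by linarith)]; exact h4
      have h7 : 0 ≤ 1 / armSum d κ (i + 1) b := by positivity
      have h8 : 0 ≤ K / ((i + 1 : ℕ) : ℝ) := by positivity
      have h9 : K / ((i + 1 : ℕ) : ℝ) * (thetaN d κ (i + 1) b - thetaN d κ (i + 1) a) ≤
          K / ((i + 1 : ℕ) : ℝ) * thetaN d κ (i + 1) b :=
        mul_le_mul_of_nonneg_left (by linarith) h8
      have h10 : h * ((-(1 / armSum d κ (i + 1) b)) - (-(1 / armSum d κ (i + 1) a))) ≤ h * 1 :=
        mul_le_mul_of_nonneg_left (by linarith) hh0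
      calc _ ≤ _ := add_le_add h9 h10
        _ = _ := by ring
    have h2 := Finset.sum_le_sum fun i (_ : i ∈ Finset.range n) => h1 i
    rw [Finset.sum_comm, Finset.sum_add_distrib, ← Finset.mul_sum, Finset.sum_const,
      Finset.card_range, nsmul_eq_mul] at h2
    have h3 : ∀ l ∈ Finset.range r, h * Real.log (armSum d κ (n + 1) a) ≤
        ∑ i ∈ Finset.range n,
        h * (Real.log (armSum d κ (i + 1 + 1) (t l)) - Real.log (armSum d κ (i + 1) (t l))) := by
      intro l _
      rw [← Finset.mul_sum, Finset.sum_range_sub (fun i => Real.log (armSum d κ (i + 1) (t l))),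
        armSum_one, Real.log_one, sub_zero]
      have h4 := one_le_armSum (d := d) (κ := κ) (n := n + 1) (by omega) a
      refine mul_le_mul_of_nonneg_left (Real.log_le_log (by linarith) (armSum_mono _ ?_)) hh0
      rw [← ht0]
      exact htm (Nat.zero_le _)
    have h4 := (Finset.sum_le_sum h3).trans h2
    rw [Finset.sum_const, Finset.card_range, nsmul_eq_mul] at h4
    have h5 : (r : ℝ) * (h * Real.log (armSum d κ (n + 1) a)) =
        (b - a) * Real.log (armSum d κ (n + 1) a) := by
      rw [hh]; field_simp
    rw [h5] at h4
    refine h4.trans (le_of_eq ?_)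
    rw [hh]
    ring
  refine le_of_forall_pos_le_add fun ε hε => ?_
  obtain ⟨r, hr⟩ := exists_nat_ge (n * (b - a) / ε)
  refine (key (r + 1) (by omega)).trans ?_
  gcongr
  rw [div_le_iff₀ (by positivity)]
  rw [div_le_iff₀ hε] at hr
  push_cast
  nlinarith

/-- On `[a, b]` the partial sum is at most its value at `b`, so over each of `r` equal pieces θ_n
grows by a factor of at least `1 + x / r`. As it never exceeds 1, letting `r` grow gives the
exponential. -/
theorem thetaN_le_exp (H : DiffIneq d κ a₀ b₀ K) (hK : 0 < K) {a b : ℝ} (ha : a₀ ≤ a)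
    (hab : a ≤ b) (hb : b ≤ b₀) {n : ℕ} (hn : 1 ≤ n) :
    thetaN d κ n a ≤ Real.exp (-((b - a) * n / (K * armSum d κ n b))) := by
  have hSb := one_le_armSum (d := d) (κ := κ) hn b
  set x : ℝ := (b - a) * n / (K * armSum d κ n b) with hx
  have hx0 : 0 ≤ x := div_nonneg (mul_nonneg (by linarith) (by positivity)) (by positivity)
  have key : ∀ r : ℕ, 1 ≤ r → thetaN d κ n a * (1 + x / r) ^ r ≤ 1 := by
    intro r hr
    have hr0 : (0 : ℝ) < r := by exact_mod_cast hr
    set h : ℝ := (b - a) / r with hh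
    have hh0 : 0 ≤ h := div_nonneg (by linarith) hr0.le
    set t : ℕ → ℝ := fun l => a + l * h with ht
    have ht0 : t 0 = a := by simp [ht]
    have htr : t r = b := by
      simp only [ht, hh]
      field_simp
      ring
    have htm : Monotone t := fun l l' hl => by
      have : (l : ℝ) ≤ l' := by exact_mod_cast hl
      simp only [ht]
      gcongr
    have hts : ∀ l, t (l + 1) - t l = h := fun l => by
      simp only [ht]
      push_cast
      ring
    have h1 : ∀ l ≤ r, thetaN d κ n a * (1 + x / r) ^ l ≤ thetaN d κ n (t l) := by
      intro l hl
      induction l with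
      | zero => simp [ht0]
      | succ l ih =>
        have ih := ih (by omega)
        have h2 := H (t l) (t (l + 1))
          (by rw [← ht0] at ha; exact ha.trans (htm (Nat.zero_le _))) (htm (Nat.le_succ l))
          (by rw [← htr] at hb; exact (htm hl).trans hb) n
        rw [hts] at h2
        have h3 : armSum d κ n (t (l + 1)) ≤ armSum d κ n b := by
          rw [← htr]; exact armSum_mono n (htm hl)
        have h4 : thetaN d κ n (t l) ≤ thetaN d κ n (t (l + 1)) :=
          thetaN_mono n (htm (Nat.le_succ l))
        have h5 : h * (n * thetaN d κ n (t l)) ≤ K * armSum d κ n b *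
            (thetaN d κ n (t (l + 1)) - thetaN d κ n (t l)) := by
          refine h2.trans (mul_le_mul_of_nonneg_right ?_ (by linarith))
          exact mul_le_mul_of_nonneg_left h3 hK.le
        have h6 : x / r * thetaN d κ n (t l) ≤
            thetaN d κ n (t (l + 1)) - thetaN d κ n (t l) := by
          have : x / r * thetaN d κ n (t l) =
              h * (n * thetaN d κ n (t l)) / (K * armSum d κ n b) := by
            rw [hx, hh]; ring
          rw [this, div_le_iff₀ (by positivity)]
          linarith
        rw [pow_succ, ← mul_assoc]
        have h7 : 0 ≤ x / r := by positivity
        calc _ ≤ thetaN d κ n (t l) * (1 + x / r) := by gcongr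
          _ ≤ _ := by linarith
    have h2 := h1 r le_rfl
    exact h2.trans (thetaN_le_one _ _)
  have hlim := (Real.tendsto_one_add_div_pow_exp x).const_mul (thetaN d κ n a)
  have h1 : thetaN d κ n a * Real.exp x ≤ 1 :=
    le_of_tendsto hlim (Filter.eventually_atTop.2 ⟨1, key⟩)
  rw [Real.exp_neg, ← one_div, le_div_iff₀ (Real.exp_pos x)]
  exact h1

/-- Vanishing one-arm probabilities give sublinear partial sums below. -/
theorem exists_armSum_le_sqrt (H : DiffIneq d κ a₀ b₀ K) (hK : 0 < K) {a b : ℝ} (ha : a₀ ≤ a)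
    (hab : a < b) (hb : b ≤ b₀)
    (hlim : Filter.Tendsto (fun n => thetaN d κ n b) Filter.atTop (nhds 0)) :
    ∃ C : ℝ, 0 < C ∧ ∀ n : ℕ, 1 ≤ n → armSum d κ n a ≤ C * Real.sqrt n := by
  -- Eventually θ_i(b) is below `η`, so the sum in `log_armSum_le` is at most a constant plus `η *
  -- log n`. This choice of `η` makes the resulting power of `n` equal to `1 / 2`.
  set η : ℝ := (b - a) / (2 * K) with hη
  have hη0 : 0 < η := div_pos (by linarith) (by positivity)
  obtain ⟨i₀, hi₀⟩ := Filter.eventually_atTop.1 (hlim.eventually (gt_mem_nhds hη0))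
  have hsum : ∀ n : ℕ, ∑ i ∈ Finset.range n, thetaN d κ (i + 1) b / ((i + 1 : ℕ) : ℝ) ≤
      i₀ + η * (1 + Real.log n) := by
    intro n
    have h1 : ∀ i ∈ Finset.range n, thetaN d κ (i + 1) b / ((i + 1 : ℕ) : ℝ) ≤
        (if i < i₀ then 1 else 0) + η * (((i + 1 : ℕ) : ℝ))⁻¹ := by
      intro i _
      have hi1 : (1 : ℝ) ≤ ((i + 1 : ℕ) : ℝ) := by exact_mod_cast Nat.succ_le_succ (Nat.zero_le i)
      split_ifs with hi
      · have h2 : thetaN d κ (i + 1) b / ((i + 1 : ℕ) : ℝ) ≤ 1 := by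
          rw [div_le_one (by linarith)]
          exact (thetaN_le_one _ _).trans hi1
        have h3 : 0 ≤ η * (((i + 1 : ℕ) : ℝ))⁻¹ := by positivity
        linarith
      · rw [zero_add, div_eq_mul_inv]
        have := (hi₀ (i + 1) (by omega)).le
        gcongr
    refine (Finset.sum_le_sum h1).trans ?_
    rw [Finset.sum_add_distrib, ← Finset.mul_sum]
    have h2 : ∑ i ∈ Finset.range n, (if i < i₀ then (1 : ℝ) else 0) ≤ i₀ := by
      rw [Finset.sum_boole]
      have : ((Finset.range n).filter (fun i => i < i₀)).card ≤ i₀ := by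
        refine (Finset.card_le_card (t := Finset.range i₀) fun i hi => ?_).trans (by simp)
        simpa using (Finset.mem_filter.1 hi).2
      exact_mod_cast this
    have h3 : ∑ i ∈ Finset.range n, (((i + 1 : ℕ) : ℝ))⁻¹ ≤ 1 + Real.log n := by
      have := harmonic_le_one_add_log n
      rw [harmonic] at this
      push_cast at this ⊢
      exact this
    have h4 := mul_le_mul_of_nonneg_left h3 hη0.le
    linarith
  refine ⟨Real.exp (i₀ / (2 * η) + 1 / 2), Real.exp_pos _, fun n hn => ?_⟩
  have hn0 : (0 : ℝ) < n := by exact_mod_cast hn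
  have h1 := (log_armSum_le H hK.le ha hab.le hb n).trans
    (mul_le_mul_of_nonneg_left (hsum n) hK.le)
  have hba : b - a = 2 * K * η := by rw [hη]; field_simp
  have hS := one_le_armSum (d := d) (κ := κ) (n := n + 1) (by omega) a
  have h2 : Real.log (armSum d κ (n + 1) a) ≤ i₀ / (2 * η) + 1 / 2 + Real.log n / 2 := by
    rw [hba] at h1
    have h3 : (2 * η) * Real.log (armSum d κ (n + 1) a) ≤ i₀ + η * (1 + Real.log n) :=
      le_of_mul_le_mul_left (by linarith) hK
    have h4 : i₀ / (2 * η) + 1 / 2 + Real.log n / 2 = (i₀ + η * (1 + Real.log n)) / (2 * η) := by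
      field_simp
      ring
    rw [h4, le_div_iff₀ (by positivity)]
    linarith
  refine (armSum_le_armSum_succ n a).trans ?_
  rw [← Real.exp_log (show 0 < armSum d κ (n + 1) a by linarith), ← Real.exp_log
    (Real.sqrt_pos.2 hn0), ← Real.exp_add, Real.log_sqrt hn0.le]
  exact Real.exp_le_exp.2 h2

/-- Vanishing one-arm probabilities give exponential decay below. -/
theorem exists_exp_decay (H : DiffIneq d κ a₀ b₀ K) (hK : 0 < K) {p b : ℝ} (hp : a₀ ≤ p)
    (hpb : p < b) (hb : b ≤ b₀)
    (hlim : Filter.Tendsto (fun n => thetaN d κ n b) Filter.atTop (nhds 0)) :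
    ∃ α : ℝ, 0 < α ∧ ∀ n : ℕ, 1 ≤ n → thetaN d κ n p ≤ Real.exp (-(α * n)) := by
  -- Each third of `[p, b]` improves the bound: at `p + 2 * h` the partial sums are of order `√n`,
  -- so at `p + h` the decay is like `exp (-c √n)`, hence summable, and with bounded partial sums
  -- `thetaN_le_exp` gives exponential decay at `p`.
  set h : ℝ := (b - p) / 3 with hh
  have hh0 : 0 < h := by rw [hh]; linarith
  obtain ⟨C, hC, hsqrt⟩ := exists_armSum_le_sqrt H hK (a := p + 2 * h) (b := b) (by linarith)
    (by rw [hh]; linarith) hb hlim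
  set c : ℝ := h / (K * C) with hc
  have hc0 : 0 < c := by positivity
  have h1 : ∀ n : ℕ, 1 ≤ n → thetaN d κ n (p + h) ≤ 24 / c ^ 4 * (1 / (n : ℝ) ^ 2) := by
    intro n hn
    have hn0 : (0 : ℝ) < n := by exact_mod_cast hn
    have hs : 0 < Real.sqrt n := Real.sqrt_pos.2 hn0
    have hss : Real.sqrt n * Real.sqrt n = n := Real.mul_self_sqrt hn0.le
    have hS := one_le_armSum (d := d) (κ := κ) hn (p + 2 * h)
    have h2 := thetaN_le_exp H hK (a := p + h) (b := p + 2 * h) (by linarith) (by linarith)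
      (by linarith [hh]) hn
    have h3 : c * Real.sqrt n ≤
        (p + 2 * h - (p + h)) * n / (K * armSum d κ n (p + 2 * h)) := by
      have : c * Real.sqrt n = h * n / (K * (C * Real.sqrt n)) := by
        rw [hc, div_mul_eq_mul_div, div_eq_div_iff (by positivity) (by positivity)]
        calc h * √↑n * (K * (C * √↑n)) = h * (√↑n * √↑n) * (K * C) := by ring
          _ = _ := by rw [hss]
      rw [this, show p + 2 * h - (p + h) = h by ring]
      have := hsqrt n hn
      gcongr
    -- The fourth-order term of the exponential series turns `exp (-c √n)` into a multiple of the
    -- summable `1 / n ^ 2`.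
    have h4 : (c * Real.sqrt n) ^ 4 / 24 ≤ Real.exp (c * Real.sqrt n) := by
      have := Real.pow_div_factorial_le_exp (c * Real.sqrt n) (by positivity) 4
      norm_num [Nat.factorial] at this ⊢
      exact this
    have h5 : (c * Real.sqrt n) ^ 4 = c ^ 4 * (n : ℝ) ^ 2 := by
      calc (c * Real.sqrt n) ^ 4 = c ^ 4 * (Real.sqrt n * Real.sqrt n) ^ 2 := by ring
        _ = _ := by rw [hss]
    rw [h5] at h4
    refine h2.trans ((Real.exp_le_exp.2 (neg_le_neg h3)).trans ?_)
    rw [Real.exp_neg]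
    refine (inv_anti₀ (by positivity) h4).trans (le_of_eq ?_)
    field_simp
  obtain ⟨B, hB⟩ : ∃ B : ℝ, ∀ n : ℕ, armSum d κ n (p + h) ≤ B := by
    have hs : Summable fun n : ℕ => 24 / c ^ 4 * (1 / (n : ℝ) ^ 2) :=
      (Real.summable_one_div_nat_pow.2 (by norm_num)).mul_left _
    refine ⟨1 + ∑' n : ℕ, 24 / c ^ 4 * (1 / (n : ℝ) ^ 2), fun n => ?_⟩
    have h2 : ∀ k ∈ Finset.range n, thetaN d κ k (p + h) ≤
        (if k = 0 then 1 else 0) + 24 / c ^ 4 * (1 / (k : ℝ) ^ 2) := by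
      intro k _
      split_ifs with hk
      · have h3 := thetaN_le_one (d := d) (κ := κ) k (p + h)
        have h4 : 0 ≤ 24 / c ^ 4 * (1 / (k : ℝ) ^ 2) := by positivity
        linarith
      · rw [zero_add]
        exact h1 k (by omega)
    refine (Finset.sum_le_sum h2).trans ?_
    rw [Finset.sum_add_distrib]
    refine add_le_add ?_ (hs.sum_le_tsum _ fun i _ => by positivity)
    rw [Finset.sum_ite_eq']
    split_ifs <;> norm_num
  have hB0 : 1 ≤ B := (armSum_one (d := d) (κ := κ) (p + h)).ge.trans (hB 1)
  refine ⟨h / (K * B), by positivity, fun n hn => ?_⟩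
  have hS := one_le_armSum (d := d) (κ := κ) hn (p + h)
  refine (thetaN_le_exp H hK (a := p) (b := p + h) hp (by linarith)
    (by linarith [hh]) hn).trans (Real.exp_le_exp.2 (neg_le_neg ?_))
  rw [show p + h - p = h by ring, div_mul_eq_mul_div]
  have := hB n
  gcongr

theorem exists_diffIneq (hκ : 2 ≤ κ) {a₀ b₀ : ℝ} (ha₀ : 0 < a₀) (hb₀ : b₀ < 1) :
    ∃ K : ℝ, 0 < K ∧ DiffIneq d κ a₀ b₀ K := by
  rcases le_or_gt a₀ b₀ with hab₀ | hab₀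
  swap
  · exact ⟨1, one_pos, fun a b h1 h2 h3 => absurd (h1.trans (h2.trans h3)) (not_le.2 hab₀)⟩
  -- `c` is a lower bound, up to discretisation, for the probabilities that a label is below or
  -- above the threshold. The factor `1 - θ_n(b)` is then bounded below by `δ`, uniformly in `n ≥
  -- 1`.
  set c : ℝ := min a₀ ((1 - b₀) / 2) with hc
  have hc0 : 0 < c := lt_min ha₀ (by linarith)
  have hca : c ≤ a₀ := min_le_left _ _
  have hcb : c ≤ (1 - b₀) / 2 := min_le_right _ _
  have hc1 : c ≤ 1 := by linarith
  have hδ := thetaN_one_lt_one (d := d) (κ := κ) (p := b₀) (by linarith) hb₀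
  set δ : ℝ := 1 - thetaN d κ 1 b₀ with hδ'
  have hδ0 : 0 < δ := by rw [hδ']; linarith
  have hC := chainConst_pos (D := nbrBound d) hc0 hc1
  refine ⟨64 * chainConst (nbrBound d) c ^ 2 / δ, by positivity, fun a b ha hab hb n => ?_⟩
  rcases Nat.eq_zero_or_pos n with rfl | hn
  · simp [thetaN_zero]
  have h1 := differential_inequality (d := d) (κ := κ) hκ hc0 hc1 (hca.trans ha) hab
    (by linarith) n
  have h2 : δ ≤ 1 - thetaN d κ n b := by
    have h3 : thetaN d κ n b ≤ thetaN d κ 1 b := thetaN_anti b hn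
    have h4 : thetaN d κ 1 b ≤ thetaN d κ 1 b₀ := thetaN_mono 1 hb
    rw [hδ']
    linarith
  have h0 := thetaN_nonneg (d := d) (κ := κ) n a
  have h3 : (b - a) * (n * (thetaN d κ n a * δ)) ≤ 64 * chainConst (nbrBound d) c ^ 2 *
      armSum d κ n b * (thetaN d κ n b - thetaN d κ n a) := by
    refine le_trans (mul_le_mul_of_nonneg_left ?_ (by linarith)) h1
    gcongr
  have h4 : 64 * chainConst (nbrBound d) c ^ 2 / δ * armSum d κ n b *
      (thetaN d κ n b - thetaN d κ n a) = 64 * chainConst (nbrBound d) c ^ 2 *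
      armSum d κ n b * (thetaN d κ n b - thetaN d κ n a) / δ := by ring
  rw [h4, le_div_iff₀ hδ0]
  linarith

end Sharpness

/-! ### Infinite clusters -/

/-- In a locally finite graph, every vertex of an infinite component starts an infinite path. -/
theorem exists_injective_path {V : Type*} {G : SimpleGraph V}
    (hfin : ∀ v, (G.neighborSet v).Finite) {x : V} (hinf : {w | G.Reachable x w}.Infinite) :
    ∃ γ : ℕ → V, γ 0 = x ∧ Function.Injective γ ∧ ∀ i, G.Adj (γ i) (γ (i + 1)) := by
  -- König's lemma along geodesics: `W v` consists of the vertices with a geodesic from `x` through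
  -- `v`. If it is infinite, so is `W v'` for some neighbour `v'` one step further from `x`; the
  -- growing distance makes the path injective.
  let W : V → Set V := fun v =>
    {w | G.Reachable x w ∧ G.Reachable v w ∧ G.dist x w = G.dist x v + G.dist v w}
  have hx : (W x).Infinite := by
    refine hinf.mono fun w hw => ⟨hw, hw, by simp⟩
  have step : ∀ v : {v // (W v).Infinite}, ∃ v' : {v // (W v).Infinite},
      G.Adj v v' ∧ G.dist x v' = G.dist x v + 1 := by
    rintro ⟨v, hv⟩
    by_contra! hcon
    have hfin' : (⋃ v' ∈ {v' | G.Adj v v' ∧ G.dist x v' = G.dist x v + 1}, W v').Finite := by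
      refine Set.Finite.biUnion ((hfin v).subset fun v' h => h.1) fun v' hv' => ?_
      by_contra hv'inf
      exact hcon ⟨v', hv'inf⟩ hv'.1 hv'.2
    refine hv ((hfin'.insert v).subset ?_)
    rintro w ⟨h1, h2, h3⟩
    obtain ⟨q, hq⟩ := h2.exists_walk_length_eq_dist
    cases q with
    | nil => exact Or.inl rfl
    | @cons _ v' _ hadj q =>
      rw [SimpleGraph.Walk.length_cons] at hq
      have hxv : G.Reachable x v := h1.trans h2.symm
      have h4 := G.dist_le q
      have h5 := hxv.dist_triangle_left v'
      rw [SimpleGraph.dist_eq_one_iff_adj.2 hadj] at h5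
      have h6 := (hxv.trans hadj.reachable).dist_triangle_left w
      refine Or.inr (Set.mem_iUnion₂.2 ⟨v', ⟨hadj, by omega⟩, h1, q.reachable, by omega⟩)
  choose f hf using step
  let γ : ℕ → {v // (W v).Infinite} := fun i => f^[i] ⟨x, hx⟩
  have hγ : ∀ i, γ (i + 1) = f (γ i) := fun i => Function.iterate_succ_apply' f i _
  have hdist : ∀ i, G.dist x (γ i) = i := by
    intro i
    induction i with
    | zero => simp [γ]
    | succ i ih => rw [hγ, (hf (γ i)).2, ih]
  refine ⟨fun i => (γ i).1, rfl, fun i i' h => ?_, fun i => ?_⟩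
  · have h : (γ i).1 = (γ i').1 := h
    rw [← hdist i, ← hdist i', h]
  · change G.Adj (γ i).1 (γ (i + 1)).1
    rw [hγ]
    exact (hf (γ i)).1

/-- The union of the measurable sets `B i \ C i` lies in `A` and misses only points in every `C i`,
a null set. This spares a direct proof of measurability for events defined through a well-founded
recursion. -/
theorem nullMeasurableSet_of_approx {Ω : Type*} [MeasurableSpace Ω] {μ : Measure Ω}
    [IsFiniteMeasure μ] {A : Set Ω} (h : ∀ ε : ℝ, 0 < ε → ∃ B C : Set Ω, MeasurableSet B ∧
      MeasurableSet C ∧ μ.real C ≤ ε ∧ A ⊆ B ∪ C ∧ B ⊆ A ∪ C) : NullMeasurableSet A μ := by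
  choose B C hB hC hμ hA hA' using fun i : ℕ => h (1 / ((i : ℝ) + 1)) (by positivity)
  have hsub : ⋃ i, B i \ C i ⊆ A := Set.iUnion_subset fun i x hx => (hA' i hx.1).resolve_right hx.2
  have hnull : μ (A \ ⋃ i, B i \ C i) = 0 := by
    rw [← measureReal_eq_zero_iff]
    refine le_antisymm (ge_of_tendsto' tendsto_one_div_add_atTop_nhds_zero_nat fun i => ?_)
      measureReal_nonneg
    refine (measureReal_mono ?_).trans (hμ i)
    rintro x ⟨hx, hx'⟩
    by_contra hxC
    exact hx' (Set.mem_iUnion.2 ⟨i, (hA i hx).resolve_right hxC, hxC⟩)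
  have hm : MeasurableSet (⋃ i, B i \ C i) := MeasurableSet.iUnion fun i => (hB i).diff (hC i)
  have h1 : A = (⋃ i, B i \ C i) ∪ (A \ ⋃ i, B i \ C i) := (Set.union_sdiff_cancel hsub).symm
  rw [h1]
  exact hm.nullMeasurableSet.union (NullMeasurableSet.of_null hnull)

section Infinite

variable {d κ : ℕ} {p : ℝ}

theorem nullMeasurableSet_armEvent (hp : 0 ≤ p) (n : ℕ) :
    NullMeasurableSet (armEvent κ p (0 : Fin d → ℤ) n) (P d) := by
  refine nullMeasurableSet_of_approx fun ε hε => ?_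
  obtain ⟨m, M₀, hbad⟩ := exists_P_badSet_le (d := d) n hε
  have hj : p * ((M₀ + 1 : ℕ) : ℝ) ≤ ⌈p * ((M₀ + 1 : ℕ) : ℝ)⌉₊ := Nat.le_ceil _
  have hj' : (⌈p * ((M₀ + 1 : ℕ) : ℝ)⌉₊ : ℝ) < p * ((M₀ + 1 : ℕ) : ℝ) + 1 :=
    Nat.ceil_lt_add_one (by positivity)
  set j : ℕ := ⌈p * ((M₀ + 1 : ℕ) : ℝ)⌉₊
  have hO : ∀ U ∉ toMeasurable (P d) (Omega d)ᶜ, U ∈ Omega d := fun U hU => by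
    by_contra h
    exact hU (subset_toMeasurable _ _ h)
  refine ⟨disc (M₀ + 1) (boxEdges d (n + m)) ⁻¹'
      cross (boxEnds d (n + m)) κ (M₀ + 1) 0 (sphere d n) j,
    disc (M₀ + 1) (boxEdges d (n + m)) ⁻¹'
      badSet (boxEnds d (n + m)) (M₀ + 1) m j (innerEdges d (n + m) n) ∪
        toMeasurable (P d) (Omega d)ᶜ, measurable_disc _ (Set.toFinite _).measurableSet,
    (measurable_disc _ (Set.toFinite _).measurableSet).union (measurableSet_toMeasurable _ _),
    ?_, ?_, ?_⟩
  · refine (measureReal_union_le _ _).trans ?_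
    rw [measureReal_def (s := toMeasurable _ _), measure_toMeasurable, P_compl_Omega,
      ENNReal.toReal_zero, add_zero]
    exact hbad (M₀ + 1) (by omega) j
  · intro U hU
    by_cases h : U ∈ disc (M₀ + 1) (boxEdges d (n + m)) ⁻¹'
      badSet (boxEnds d (n + m)) (M₀ + 1) m j (innerEdges d (n + m) n)
    · exact Or.inr (Or.inl h)
    · exact Or.inl (disc_mem_cross_of_mem_armEvent hj hj' h hU)
  · intro U hU
    by_cases h : U ∈ disc (M₀ + 1) (boxEdges d (n + m)) ⁻¹'
      badSet (boxEnds d (n + m)) (M₀ + 1) m j (innerEdges d (n + m) n)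
    · exact Or.inr (Or.inl h)
    · by_cases h' : U ∈ toMeasurable (P d) (Omega d)ᶜ
      · exact Or.inr (Or.inr h')
      · exact Or.inl (mem_armEvent_of_disc_mem_cross hj hj' (hO U h') h hU)

theorem iInter_armEvent_subset :
    ⋂ n, armEvent κ p (0 : Fin d → ℤ) n ⊆ connInftyEvent κ p 0 := by
  intro U hU
  rw [Set.mem_iInter] at hU
  have hO : U ∈ Omega d := by
    obtain ⟨y, -, hO, -⟩ := Set.mem_iUnion₂.1 (hU 0)
    exact hO
  refine ⟨hO, exists_injective_path (G := openGraph κ p U hO)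
    (fun v => (finite_neighbors v).subset fun z hz => hz.1) ?_⟩
  intro hfin
  obtain ⟨N, hN⟩ := (hfin.image fun w => (norm1 w).toNat).bddAbove
  obtain ⟨y, hy, _, hr⟩ := Set.mem_iUnion₂.1 (hU (N + 1))
  have h1 : (norm1 y).toNat ≤ N := hN ⟨y, hr, rfl⟩
  have h2 : norm1 y = (N + 1 : ℕ) := hy
  omega

/-- Without percolation, the one-arm probabilities vanish. -/
theorem tendsto_thetaN (hp : 0 ≤ p) (h : theta d κ p = 0) :
    Filter.Tendsto (fun n => thetaN d κ n p) Filter.atTop (nhds 0) := by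
  have h0 : P d (⋂ n, armEvent κ p (0 : Fin d → ℤ) n) = 0 :=
    measure_mono_null iInter_armEvent_subset ((measureReal_eq_zero_iff (measure_ne_top _ _)).1 h)
  have h1 := tendsto_measure_iInter_atTop (fun n => nullMeasurableSet_armEvent (κ := κ) hp n)
    (fun n n' hn => armEvent_anti hn) ⟨0, measure_ne_top (P d) _⟩
  rw [h0] at h1
  exact (ENNReal.tendsto_toReal ENNReal.zero_ne_top).comp h1

/-- By Borel–Cantelli, almost surely only finitely many vertices are connected to the origin, while
an infinite path reaches infinitely many. -/
theorem theta_eq_zero_of_susceptibility_lt_top (h : susceptibility d κ p < ⊤) :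
    theta d κ p = 0 := by
  have h1 := measure_limsup_cofinite_eq_zero (μ := P d) h.ne
  refine (measureReal_eq_zero_iff (measure_ne_top _ _)).2 (measure_mono_null ?_ h1)
  rintro U ⟨hU, γ, h0, hinj, hadj⟩
  rw [Filter.mem_limsup_iff_frequently_mem, Filter.frequently_cofinite_iff_infinite]
  refine (Set.infinite_range_of_injective hinj).mono ?_
  rintro _ ⟨i, rfl⟩
  refine ⟨hU, ?_⟩
  induction i with
  | zero => rw [h0]
  | succ i ih => exact ih.trans (hadj i).reachable

theorem theta_eq_zero_mono {q : ℝ} (hpq : p ≤ q) (h : theta d κ q = 0) : theta d κ p = 0 := by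
  refine (measureReal_eq_zero_iff (measure_ne_top _ _)).2 (measure_mono_null ?_
    ((measureReal_eq_zero_iff (measure_ne_top _ _)).1 h))
  rintro U ⟨hU, γ, h0, hinj, hadj⟩
  exact ⟨hU, γ, h0, hinj, fun i => openGraph_mono hpq hU (hadj i)⟩

theorem P_connEvent_le (x : Fin d → ℤ) :
    P d (connEvent κ p 0 x) ≤ ENNReal.ofReal (thetaN d κ (norm1 x).toNat p) := by
  rw [thetaN_eq, ofReal_measureReal]
  exact measure_mono (connEvent_subset_armEvent (by rw [Int.toNat_of_nonneg (norm1_nonneg x)]))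

theorem norm1_eq_zero {x : Fin d → ℤ} : norm1 x = 0 ↔ x = 0 := by
  rw [norm1, Finset.sum_eq_zero_iff_of_nonneg fun i _ => abs_nonneg _]
  simp [funext_iff]

theorem one_le_norm1 {x : Fin d → ℤ} (hx : x ≠ 0) : 1 ≤ (norm1 x).toNat := by
  have h1 := norm1_nonneg x
  have h2 := mt norm1_eq_zero.1 hx
  omega

/-- This makes the sets under both suprema non-empty. -/
theorem susceptibility_at_zero : susceptibility d κ 0 < ⊤ := by
  rw [susceptibility, tsum_eq_single (0 : Fin d → ℤ)]
  · exact measure_lt_top _ _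
  · intro x hx
    have h1 := P_connEvent_le (d := d) (κ := κ) (p := 0) x
    rw [thetaN_at_zero (one_le_norm1 hx), ENNReal.ofReal_zero] at h1
    exact le_antisymm h1 zero_le

theorem tsum_prod_pow {α : Type*} (g : α → ENNReal) (d : ℕ) :
    ∑' x : Fin d → α, ∏ i, g (x i) = (∑' z, g z) ^ d := by
  induction d with
  | zero => simp
  | succ d ih =>
    rw [← (Fin.consEquiv fun _ => α).tsum_eq, ENNReal.tsum_prod', pow_succ', ← ih,
      ← ENNReal.tsum_mul_right]
    refine tsum_congr fun z => ?_
    rw [← ENNReal.tsum_mul_left]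
    refine tsum_congr fun x => ?_
    simp [Fin.consEquiv, Fin.prod_univ_succ]

theorem tsum_exp_neg_abs_lt_top {α : ℝ} (hα : 0 < α) :
    ∑' z : ℤ, ENNReal.ofReal (Real.exp (-(α * |(z : ℝ)|))) < ⊤ := by
  have hs : Summable fun n : ℕ => Real.exp (-(α * n)) := by
    have := Real.summable_exp_nat_mul_iff.2 (neg_lt_zero.2 hα)
    refine this.congr fun n => ?_
    congr 1
    ring
  have hs' : Summable fun z : ℤ => Real.exp (-(α * |(z : ℝ)|)) := by
    refine Summable.of_nat_of_neg (hs.congr fun n => ?_) (hs.congr fun n => ?_) <;> simp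
  exact (ENNReal.ofReal_tsum_of_nonneg (fun _ => (Real.exp_pos _).le) hs') ▸ ENNReal.ofReal_lt_top

/-- The bound `exp (-α ‖x‖₁)` factorises over the coordinates, so its sum over the lattice is a
power of a two-sided geometric series. -/
theorem susceptibility_lt_top_of_exp_decay {α : ℝ} (hα : 0 < α)
    (h : ∀ n : ℕ, 1 ≤ n → thetaN d κ n p ≤ Real.exp (-(α * n))) : susceptibility d κ p < ⊤ := by
  have h1 : ∀ x : Fin d → ℤ, P d (connEvent κ p 0 x) ≤
      ∏ i, ENNReal.ofReal (Real.exp (-(α * |(x i : ℝ)|))) := by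
    intro x
    have h2 : ∏ i, ENNReal.ofReal (Real.exp (-(α * |(x i : ℝ)|))) =
        ENNReal.ofReal (Real.exp (-(α * (norm1 x).toNat))) := by
      rw [← ENNReal.ofReal_prod_of_nonneg fun _ _ => (Real.exp_pos _).le, ← Real.exp_sum,
        Finset.sum_neg_distrib, ← Finset.mul_sum]
      have h3 : (((norm1 x).toNat : ℕ) : ℝ) = ((norm1 x : ℤ) : ℝ) := by
        exact_mod_cast Int.toNat_of_nonneg (norm1_nonneg x)
      rw [h3, norm1]
      push_cast
      rfl
    rw [h2]
    refine (P_connEvent_le x).trans (ENNReal.ofReal_le_ofReal ?_)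
    by_cases hx : x = 0
    · subst hx
      simpa [norm1_zero] using thetaN_le_one (d := d) (κ := κ) 0 p
    · exact h _ (one_le_norm1 hx)
  refine (ENNReal.tsum_le_tsum h1).trans_lt ?_
  rw [tsum_prod_pow fun z : ℤ => ENNReal.ofReal (Real.exp (-(α * |(z : ℝ)|)))]
  exact ENNReal.pow_lt_top (tsum_exp_neg_abs_lt_top hα)

/-- Exponential decay of the one-arm probability below the critical point. -/
theorem exp_decay_of_lt_pc (hκ : 2 ≤ κ) (hp0 : 0 ≤ p) (hp : p < pc d κ) :
    ∃ α : ℝ, 0 < α ∧ ∀ n : ℕ, 1 ≤ n → thetaN d κ n p ≤ Real.exp (-(α * n)) := by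
  have hne : {q : ℝ | q ∈ Set.Icc (0 : ℝ) 1 ∧ theta d κ q = 0}.Nonempty :=
    ⟨0, ⟨le_rfl, zero_le_one⟩, theta_eq_zero_of_susceptibility_lt_top susceptibility_at_zero⟩
  obtain ⟨b, ⟨hb, hθ⟩, hpb⟩ := exists_lt_of_lt_csSup hne hp
  have hb1 := hb.2
  -- The constants of `exists_diffIneq` need an interval inside `(0, 1)`, and `p = 0` or `b = 1` may
  -- occur; both ends are moved inwards, at no cost by monotonicity in the parameter.
  set p₁ : ℝ := (2 * p + b) / 3 with hp₁
  set b₁ : ℝ := (p + 2 * b) / 3 with hb₁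
  obtain ⟨K, hK, H⟩ := exists_diffIneq (d := d) (κ := κ) hκ (a₀ := p₁) (b₀ := b₁)
    (by rw [hp₁]; linarith) (by rw [hb₁]; linarith)
  obtain ⟨α, hα, h⟩ := exists_exp_decay H hK le_rfl (by rw [hp₁, hb₁]; linarith) le_rfl
    (tendsto_thetaN (by rw [hb₁]; linarith) (theta_eq_zero_mono (by rw [hb₁]; linarith) hθ))
  exact ⟨α, hα, fun n hn => (thetaN_mono n (by rw [hp₁]; linarith)).trans (h n hn)⟩

/-- Borel–Cantelli gives one inequality; for the other, the susceptibility is finite at every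
nonnegative `r` below `pc`. -/
theorem pc_eq_pcHat (hκ : 2 ≤ κ) : pc d κ = pcHat d κ := by
  have hbdd : BddAbove {p : ℝ | p ∈ Set.Icc (0 : ℝ) 1 ∧ theta d κ p = 0} := ⟨1, fun q hq => hq.1.2⟩
  have hbdd' : BddAbove {p : ℝ | p ∈ Set.Icc (0 : ℝ) 1 ∧ susceptibility d κ p < ⊤} :=
    ⟨1, fun q hq => hq.1.2⟩
  have h0 : (0 : ℝ) ∈ {p : ℝ | p ∈ Set.Icc (0 : ℝ) 1 ∧ susceptibility d κ p < ⊤} :=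
    ⟨⟨le_rfl, zero_le_one⟩, susceptibility_at_zero⟩
  refine le_antisymm (le_of_forall_lt fun q hq => ?_) (csSup_le_csSup hbdd ⟨0, h0⟩ fun q hq =>
    ⟨hq.1, theta_eq_zero_of_susceptibility_lt_top hq.2⟩)
  obtain ⟨r, hqr, hr⟩ := exists_between hq
  refine hqr.trans_le ?_
  rcases lt_or_ge r 0 with hr0 | hr0
  · exact hr0.le.trans (le_csSup hbdd' h0)
  · obtain ⟨α, hα, h⟩ := exp_decay_of_lt_pc hκ hr0 hr
    refine le_csSup hbdd' ⟨⟨hr0, hr.le.trans ?_⟩, susceptibility_lt_top_of_exp_decay hα h⟩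
    exact csSup_le ⟨0, h0.1, theta_eq_zero_of_susceptibility_lt_top h0.2⟩ fun q hq => hq.1.2

end Infinite

end CDP

end

theorem theorem1 (d κ : ℕ) (hd : 2 ≤ d) (hκ : 2 ≤ κ) (hκd : κ ≤ 2 * d) :
    (∀ p ∈ Set.Icc (0 : ℝ) 1, p < CDP.pc d κ →
      ∃ α : ℝ, 0 < α ∧ ∀ n : ℕ, 1 ≤ n → CDP.thetaN d κ n p ≤ Real.exp (-(α * n))) ∧
    CDP.pc d κ = CDP.pcHat d κ :=
  ⟨fun _ hp hlt => CDP.exp_decay_of_lt_pc hκ hp.1 hlt, CDP.pc_eq_pcHat hκ⟩
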